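/- Let $\mathsf{M}\subset B(\mathsf{H})$ be a von Neumann algebra, and let $P:\mathsf{M}\to\mathsf{M}$ be a linear map that is completely contractive (each amplification $M_n(\mathsf{M})\to M_n(\mathsf{M})$ is contractive) and normal (weak$^*$-weak$^*$-continuous). Put $\mathrm{Fix}\,P=\{x\in\mathsf{M}: Px=x\}$. Then $\mathrm{Fix}\,P$ is a weak$^*$-closed subspace of $\mathsf{M}$ and of $B(\mathsf{H})$, so in particular a dual operator space. It possesses a unique ternary product $\{\cdot,\cdot,\cdot\}$ which makes it a W*-TRO. Explicitly, for every free ultrafilter $\beta$ on $\mathbb{N}$ the weak$^*$ limit \[ \widetilde{P}_\beta(x)=\beta\text{-}\lim_{n\in\mathbb{N}}\frac1n\sum_{k=0}^{n-1}P^k(x) \] exists for every $x\in\mathsf{M}$, and \[ \{a,b,c\}=\widetilde{P}_\beta(ab^*c),\qquad a,b,c\in\mathrm{Fix}\,P. \] In particular, the product does not depend on $\beta$. Here a (concrete) TRO is a norm closed subspace of some $B(\mathsf{H}';\mathsf{K}')$ ($\mathsf{H}',\mathsf{K}'$ Hilbert spaces) that is closed under $(a,b,c)\mapsto ab^*c$,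 and it is a W*-TRO if it is moreover weak$^*$-closed. A ternary product makes $\mathrm{Fix}\,P$ (with the operator space structure inherited from $\mathsf{M}$) a TRO if there is a completely isometric linear map of $\mathrm{Fix}\,P$ onto a concrete TRO that carries the product to $ab^*c$; it makes $\mathrm{Fix}\,P$ a W*-TRO if that map can be chosen onto a concrete W*-TRO and homeomorphic for the weak$^*$ topologies. The uniqueness holds even among all products that make $\mathrm{Fix}\,P$ a TRO. -/

import Mathlib

open Filter Topology

/-- The weak* (ultraweak, `σ`-weak) topology on `B(H, K)`, the dual of the trace class operators:
the coarsest topology making every functional `x ↦ ∑ₙ ⟪ηₙ, x ξₙ⟫` continuous, where `(ξₙ)` and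
`(ηₙ)` are square-summable sequences in `H` and `K`. -/
@[reducible]
noncomputable def ultraweak (H K : Type*) [NormedAddCommGroup H] [InnerProductSpace ℂ H]
    [NormedAddCommGroup K] [InnerProductSpace ℂ K] : TopologicalSpace (H →L[ℂ] K) :=
  TopologicalSpace.induced
    (fun (x : H →L[ℂ] K) (p : lp (fun _ : ℕ => H) 2 × lp (fun _ : ℕ => K) 2) =>
      ∑' n, inner ℂ (p.2 n) (x (p.1 n)))
    Pi.topologicalSpace

section OperatorSpaces

variable {H K H' K' : Type*}
  [NormedAddCommGroup H] [InnerProductSpace ℂ H] [NormedAddCommGroup K] [InnerProductSpace ℂ K]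
  [NormedAddCommGroup H'] [InnerProductSpace ℂ H'] [NormedAddCommGroup K'] [InnerProductSpace ℂ K']

/-- The operator `Hⁿ → Kⁿ` between Hilbert space direct sums given by an `n × n` matrix of
operators `H → K`; its norm is the norm of the matrix in `Mₙ(B(H, K)) = B(Hⁿ, Kⁿ)`. -/
noncomputable def matrixOp {n : ℕ} (x : Matrix (Fin n) (Fin n) (H →L[ℂ] K)) :
    PiLp 2 (fun _ : Fin n => H) →L[ℂ] PiLp 2 (fun _ : Fin n => K) :=
  (PiLp.continuousLinearEquiv 2 ℂ (fun _ : Fin n => K)).symm.toContinuousLinearMap ∘L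
    ContinuousLinearMap.pi
      (fun i => ∑ j, x i j ∘L PiLp.proj (𝕜 := ℂ) 2 (fun _ : Fin n => H) j)

/-- The defining formula of `matrixOp`. -/
theorem matrixOp_apply {n : ℕ} (x : Matrix (Fin n) (Fin n) (H →L[ℂ] K))
    (ξ : PiLp 2 (fun _ : Fin n => H)) (i : Fin n) :
    matrixOp x ξ i = ∑ j, x i j (ξ j) := by
  simp [matrixOp]

/-- Let `E` and `F` be operator spaces, given by their inclusions `e` and `f` in `B(H, K)` and
`B(H', K')`. A linear map `φ : E → F` is completely contractive if each of its amplifications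
`Mₙ(E) → Mₙ(F)` is contractive. -/
def IsCompletelyContractive {E F : Type*} [AddCommGroup E] [Module ℂ E] [AddCommGroup F]
    [Module ℂ F] (e : E →ₗ[ℂ] (H →L[ℂ] K)) (f : F →ₗ[ℂ] (H' →L[ℂ] K')) (φ : E →ₗ[ℂ] F) : Prop :=
  ∀ (n : ℕ) (x : Matrix (Fin n) (Fin n) E),
    ‖matrixOp (x.map fun y => f (φ y))‖ ≤ ‖matrixOp (x.map e)‖

/-- Let `E` be an operator space, given by its inclusion `e` in `B(H, K)`. A linear map
`ι : E → B(H', K')` is completely isometric if each of its amplifications is isometric. -/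
def IsCompletelyIsometric {E : Type*} [AddCommGroup E] [Module ℂ E]
    (e : E →ₗ[ℂ] (H →L[ℂ] K)) (ι : E →ₗ[ℂ] (H' →L[ℂ] K')) : Prop :=
  ∀ (n : ℕ) (x : Matrix (Fin n) (Fin n) E), ‖matrixOp (x.map ι)‖ = ‖matrixOp (x.map e)‖

/-- The weak* topology that a subspace `E`, given by its inclusion `e` in `B(H, K)`, inherits
from `B(H, K)`. -/
@[reducible]
noncomputable def weakStar {E : Type*} [AddCommGroup E] [Module ℂ E] (e : E →ₗ[ℂ] (H →L[ℂ] K)) :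
    TopologicalSpace E :=
  TopologicalSpace.induced e (ultraweak H K)

/-- A (concrete) TRO: a norm closed subspace of `B(H, K)` that is closed under `(a, b, c) ↦ ab*c`. -/
structure IsTRO [CompleteSpace H] [CompleteSpace K] (X : Submodule ℂ (H →L[ℂ] K)) : Prop where
  isClosed : IsClosed (X : Set (H →L[ℂ] K))
  ternary_mem : ∀ a ∈ X, ∀ b ∈ X, ∀ c ∈ X, a ∘L ContinuousLinearMap.adjoint b ∘L c ∈ X

/-- A (concrete) W*-TRO: a weak*-closed TRO. -/
structure IsWStarTRO [CompleteSpace H] [CompleteSpace K] (X : Submodule ℂ (H →L[ℂ] K)) : Prop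
    extends IsTRO X where
  isClosed_ultraweak : IsClosed[ultraweak H K] (X : Set (H →L[ℂ] K))

end OperatorSpaces

universe u v

/-- The ternary product `m` makes the operator space `E` (given by its inclusion `e` in `B(H, K)`)
a TRO: there is a completely isometric linear map of `E` onto a concrete TRO that carries `m` to
the product `ab*c`. -/
def IsTROProduct {H K E : Type u}
    [NormedAddCommGroup H] [InnerProductSpace ℂ H] [NormedAddCommGroup K] [InnerProductSpace ℂ K]
    [AddCommGroup E] [Module ℂ E] (e : E →ₗ[ℂ] (H →L[ℂ] K)) (m : E → E → E → E) : Prop :=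
  ∃ (H' : Type v) (_ : NormedAddCommGroup H') (_ : InnerProductSpace ℂ H') (_ : CompleteSpace H')
    (K' : Type v) (_ : NormedAddCommGroup K') (_ : InnerProductSpace ℂ K') (_ : CompleteSpace K')
    (ι : E →ₗ[ℂ] (H' →L[ℂ] K')),
    IsCompletelyIsometric e ι ∧ IsTRO (LinearMap.range ι) ∧
    ∀ a b c, ι (m a b c) = ι a ∘L ContinuousLinearMap.adjoint (ι b) ∘L ι c

/-- The ternary product `m` makes the operator space `E` (given by its inclusion `e` in `B(H, K)`,
with the weak* topology inherited from there) a W*-TRO: there is a completely isometric linear map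
of `E` onto a concrete W*-TRO that carries `m` to the product `ab*c` and is a homeomorphism for the
weak* topologies (the topology of `E` is the one pulled back from the W*-TRO). -/
def IsWStarTROProduct {H K E : Type u}
    [NormedAddCommGroup H] [InnerProductSpace ℂ H] [NormedAddCommGroup K] [InnerProductSpace ℂ K]
    [AddCommGroup E] [Module ℂ E] (e : E →ₗ[ℂ] (H →L[ℂ] K)) (m : E → E → E → E) : Prop :=
  ∃ (H' : Type v) (_ : NormedAddCommGroup H') (_ : InnerProductSpace ℂ H') (_ : CompleteSpace H')
    (K' : Type v) (_ : NormedAddCommGroup K') (_ : InnerProductSpace ℂ K') (_ : CompleteSpace K')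
    (ι : E →ₗ[ℂ] (H' →L[ℂ] K')),
    IsCompletelyIsometric e ι ∧ IsWStarTRO (LinearMap.range ι) ∧ weakStar e = weakStar ι ∧
    ∀ a b c, ι (m a b c) = ι a ∘L ContinuousLinearMap.adjoint (ι b) ∘L ι c

section Fix

variable {H : Type*} [NormedAddCommGroup H] [InnerProductSpace ℂ H] [CompleteSpace H]

/-- The inclusion of a von Neumann algebra `M ⊆ B(H)` in `B(H)`. -/
noncomputable def vnIncl (M : VonNeumannAlgebra H) : M.toStarSubalgebra →ₗ[ℂ] (H →L[ℂ] H) :=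
  M.toStarSubalgebra.toSubalgebra.val.toLinearMap

/-- A linear map on `M` is normal if it is continuous for the weak* topology of `M`. -/
def IsNormalMap (M : VonNeumannAlgebra H) (P : M.toStarSubalgebra →ₗ[ℂ] M.toStarSubalgebra) :
    Prop :=
  Continuous[weakStar (vnIncl M), weakStar (vnIncl M)] P

/-- `Fix P = {x ∈ M : P x = x}`. -/
noncomputable def fixSpace (M : VonNeumannAlgebra H) (P : M.toStarSubalgebra →ₗ[ℂ] M.toStarSubalgebra) :
    Submodule ℂ M.toStarSubalgebra :=
  LinearMap.eqLocus P LinearMap.id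

/-- The inclusion of `Fix P` in `B(H)`. -/
noncomputable def fixIncl (M : VonNeumannAlgebra H)
    (P : M.toStarSubalgebra →ₗ[ℂ] M.toStarSubalgebra) : fixSpace M P →ₗ[ℂ] (H →L[ℂ] H) :=
  vnIncl M ∘ₗ (fixSpace M P).subtype

/-- The Cesàro average `(1/n) ∑_{k < n} P^k x`. -/
noncomputable def cesaro (M : VonNeumannAlgebra H)
    (P : M.toStarSubalgebra →ₗ[ℂ] M.toStarSubalgebra) (n : ℕ) (x : M.toStarSubalgebra) :
    M.toStarSubalgebra :=
  (n : ℂ)⁻¹ • ∑ k ∈ Finset.range n, (P ^ k) x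

/-- `Q x` is, for every `x ∈ M`, the weak* limit along `β` of the Cesàro averages of `P^k x`. -/
def IsCesaroLimit (M : VonNeumannAlgebra H) (P : M.toStarSubalgebra →ₗ[ℂ] M.toStarSubalgebra)
    (β : Ultrafilter ℕ) (Q : M.toStarSubalgebra → M.toStarSubalgebra) : Prop :=
  ∀ x, Tendsto (fun n => cesaro M P n x) β (@nhds _ (weakStar (vnIncl M)) (Q x))

end Fix

/-! Averaging reduces the theorem to projections. A Cesàro limit `Q` of the powers of `P` along a
free ultrafilter exists by weak* compactness of balls. It is completely contractive because matrix
norms are weakly lower semicontinuous, and it projects onto `E = Fix P` because `P(Cₙx) - Cₙx = (Pⁿx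
- x)/n` tends to 0 and `P` is normal (`IsCesaroLimit.exists_isCCProjection`). It remains to see that
`Q(ab*c)` makes `E` a W*-TRO and that `E` carries at most one TRO product. Uniqueness also removes
the dependence on the ultrafilter.

Uniqueness (`isTROProduct_unique`). If `‖X‖ ≤ r`, a step `t` along `r²A - XA*X` increases the bound
`r` only to second order in `t`. For `X` upper triangular with rows `(x, w)`, `(0, y)` and `A` with
the single entry `a` in the lower left corner, this field involves only `a` and `xa*y`. Following
the fields of two candidate values `p`, `q` of the product in opposite directions cancels `a` and
moves the corner along `q - p`. So the norm has no first order growth along that line, which is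
impossible for an unbounded convex function (`eq_of_tangent`). Applied to images under `Q`, the same
argument gives `Q(x(Qa)*y) = Q(xa*y)`.

Representation. Let `F = F ∘ Q` have norm at most one and take the value 1 at some `u ∈ E` of the
unit ball. First order perturbation at `u` gives `F(uu*z) = F(z) = F(zu*u)` and the positivity of `x
↦ F(ux)`. In the GNS space of all such `F` that are weak* continuous on `E`, `Q` becomes an
orthogonal projection, and compressed left multiplication turns `Q(ab*c)` into `ab*c`
(`gnsMap_ternary`). These functionals determine the norm of `E`. On `Mₙ(E)` the original and the
represented norm are equivalent and both satisfy `‖{x,x,x}‖ = ‖x‖³`, so they agree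
(`isCompletelyIsometric_gnsMap`).

Weak* topology. No normality of `Q` is available, so weak* continuity of the product needs its own
argument: a curve of columns whose norm is one up to fourth order detects a jump of `F(ub*a)` at
third order (`IsSupport.tendsto_left`), and a Krein–Shmulyan argument (`mem_predual_of_tendsto`)
finishes. Then the GNS coefficients are weak* continuous, and each weak* continuous functional on
`E` is a GNS coefficient without increase of norm. Hence the image is weak* closed and the
representation a weak* homeomorphism. -/

/-! ### The trace class pairing -/

section Predual

variable {H : Type*} [NormedAddCommGroup H]

/-- Pairs of vectors in the unit ball. -/
abbrev VecPair (H : Type*) [NormedAddCommGroup H] : Type _ :=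
  {p : H × H // ‖p.1‖ ≤ 1 ∧ ‖p.2‖ ≤ 1}

/-- Absolutely summable combinations of vector functionals with vectors in the unit ball. -/
abbrev VecSum (H : Type*) [NormedAddCommGroup H] : Type _ :=
  lp (fun _ : VecPair H => ℂ) 1

theorem VecSum.summable_norm (c : VecSum H) : Summable fun i => ‖c i‖ := by
  have := (lp.memℓp c).summable (by norm_num)
  simpa using this

theorem VecSum.norm_eq (c : VecSum H) : ‖c‖ = ∑' i, ‖c i‖ := by
  rw [lp.norm_eq_tsum_rpow (by norm_num)]
  simp

theorem summable_norm_mul_norm_of_lp (ξ η : lp (fun _ : ℕ => H) 2) :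
    Summable fun n => ‖ξ n‖ * ‖η n‖ :=
  lp.summable_mul (by simpa using Real.HolderConjugate.two_two) ξ η

variable [InnerProductSpace ℂ H]

theorem VecPair.norm_inner_le (i : VecPair H) (x : H →L[ℂ] H) :
    ‖inner ℂ i.1.2 (x i.1.1)‖ ≤ ‖x‖ := by
  calc ‖inner ℂ i.1.2 (x i.1.1)‖ ≤ ‖i.1.2‖ * ‖x i.1.1‖ := norm_inner_le_norm _ _
    _ ≤ 1 * (‖x‖ * 1) := by
        gcongr
        · exact i.2.2
        · exact (x.le_opNorm _).trans (by gcongr; exact i.2.1)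
    _ = ‖x‖ := by ring

theorem VecSum.norm_term_le (c : VecSum H) (x : H →L[ℂ] H) (i : VecPair H) :
    ‖c i * inner ℂ i.1.2 (x i.1.1)‖ ≤ ‖c i‖ * ‖x‖ := by
  rw [norm_mul]
  gcongr
  exact i.norm_inner_le x

theorem VecSum.summable_term (c : VecSum H) (x : H →L[ℂ] H) :
    Summable fun i => c i * inner ℂ i.1.2 (x i.1.1) :=
  .of_norm_bounded (c.summable_norm.mul_right ‖x‖) (c.norm_term_le x)

/-- The ultraweakly continuous functional on `B(H)` given by a combination of vector functionals. -/
noncomputable def traceForm : VecSum H →L[ℂ] (H →L[ℂ] H) →L[ℂ] ℂ :=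
  LinearMap.mkContinuous₂ (LinearMap.mk₂ ℂ
    (fun (c : VecSum H) (x : H →L[ℂ] H) => ∑' i, c i * inner ℂ i.1.2 (x i.1.1))
    (fun c d x => by
      rw [← (c.summable_term x).tsum_add (d.summable_term x)]
      exact tsum_congr fun i => by simp [add_mul])
    (fun a c x => by
      rw [smul_eq_mul, ← tsum_mul_left]
      exact tsum_congr fun i => by simp [mul_assoc])
    (fun c x y => by
      rw [← (c.summable_term x).tsum_add (c.summable_term y)]
      exact tsum_congr fun i => by simp [mul_add])
    (fun a c x => by
      rw [smul_eq_mul, ← tsum_mul_left]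
      exact tsum_congr fun i => by simp; ring)) 1
    (fun c x => by
      rw [one_mul, c.norm_eq, ← tsum_mul_right]
      exact tsum_of_norm_bounded (c.summable_norm.mul_right _).hasSum (c.norm_term_le x))

theorem traceForm_apply (c : VecSum H) (x : H →L[ℂ] H) :
    traceForm c x = ∑' i, c i * inner ℂ i.1.2 (x i.1.1) := rfl

theorem norm_traceForm_le (c : VecSum H) (x : H →L[ℂ] H) : ‖traceForm c x‖ ≤ ‖c‖ * ‖x‖ := by
  rw [traceForm_apply, c.norm_eq, ← tsum_mul_right]
  exact tsum_of_norm_bounded (c.summable_norm.mul_right _).hasSum (c.norm_term_le x)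

/-- Normalization of a vector. -/
noncomputable def unitize (ξ : H) : H := ((‖ξ‖ : ℂ)⁻¹) • ξ

theorem norm_unitize_le (ξ : H) : ‖unitize ξ‖ ≤ 1 := by
  rw [unitize, norm_smul, norm_inv, Complex.norm_real, norm_norm]
  exact inv_mul_le_one

theorem norm_smul_unitize (ξ : H) : (‖ξ‖ : ℂ) • unitize ξ = ξ := by
  by_cases h : ξ = 0
  · simp [h]
  · rw [unitize, smul_smul, mul_inv_cancel₀ (by simpa using h), one_smul]

open Classical in
/-- The vector functional `x ↦ ⟪η, x ξ⟫`. -/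
noncomputable def vecForm (ξ η : H) : VecSum H :=
  lp.single 1 ⟨(unitize ξ, unitize η), norm_unitize_le ξ, norm_unitize_le η⟩ ((‖ξ‖ * ‖η‖ : ℝ) : ℂ)

theorem norm_vecForm (ξ η : H) : ‖vecForm ξ η‖ = ‖ξ‖ * ‖η‖ := by
  classical
  rw [vecForm, lp.norm_single (by norm_num), Complex.norm_real, norm_mul, norm_norm, norm_norm]

theorem traceForm_vecForm (ξ η : H) (x : H →L[ℂ] H) :
    traceForm (vecForm ξ η) x = inner ℂ η (x ξ) := by
  classical
  rw [traceForm_apply, tsum_eq_single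
    (⟨(unitize ξ, unitize η), norm_unitize_le ξ, norm_unitize_le η⟩ : VecPair H)]
  · rw [vecForm, lp.single_apply_self]
    conv_rhs => rw [← norm_smul_unitize ξ, ← norm_smul_unitize η]
    simp only [map_smul, inner_smul_left, inner_smul_right, Complex.conj_ofReal]
    push_cast
    ring
  · intro i hi
    rw [vecForm, lp.single_apply_ne _ _ _ hi, zero_mul]

theorem lp_single_vecPair [DecidableEq (VecPair H)] (i : VecPair H) (a : ℂ) :
    ∀ x : H →L[ℂ] H, traceForm (lp.single 1 i a) x = a * traceForm (vecForm i.1.1 i.1.2) x := by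
  intro x
  rw [traceForm_vecForm, traceForm_apply, tsum_eq_single i, lp.single_apply_self]
  intro j hj
  rw [lp.single_apply_ne _ _ _ hj, zero_mul]

theorem exists_vecSum_of_lp (ξ η : lp (fun _ : ℕ => H) 2) :
    ∃ c : VecSum H, ∀ x : H →L[ℂ] H, traceForm c x = ∑' n, inner ℂ (η n) (x (ξ n)) := by
  have hs : Summable fun n => vecForm (ξ n) (η n) := by
    refine .of_norm ?_
    simpa [norm_vecForm] using summable_norm_mul_norm_of_lp ξ η
  refine ⟨∑' n, vecForm (ξ n) (η n), fun x => ?_⟩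
  have := (traceForm.flip x).map_tsum hs
  simpa [traceForm_vecForm] using this

theorem exists_lp_of_vecSum (c : VecSum H) :
    ∃ ξ η : lp (fun _ : ℕ => H) 2, ∀ x : H →L[ℂ] H,
      traceForm c x = ∑' n, inner ℂ (η n) (x (ξ n)) := by
  set S := Function.support fun i => ‖c i‖
  have hS : S.Countable := c.summable_norm.countable_support
  have : Countable S := hS
  obtain ⟨f, hf⟩ := exists_injective_nat S
  -- Each coefficient is shared between its two vectors with modulus `√‖c i‖` on either side, so
  -- that both families are square summable. The second factor is conjugated because the inner
  -- product is conjugate linear on the left.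
  let u : S → H := fun i => ((√‖c i‖ : ℝ) : ℂ) • i.1.1.1
  let v : S → H := fun i => ((starRingEnd ℂ) (c i) / ((√‖c i‖ : ℝ) : ℂ)) • i.1.1.2
  have hpos : ∀ i : S, 0 < √‖c i‖ := fun i =>
    Real.sqrt_pos.2 ((norm_nonneg _).lt_of_ne' i.2)
  have hu : ∀ i, ‖u i‖ ^ 2 ≤ ‖c i‖ := by
    intro i
    rw [norm_smul, Complex.norm_real, Real.norm_of_nonneg (Real.sqrt_nonneg _), mul_pow,
      Real.sq_sqrt (norm_nonneg _)]
    exact mul_le_of_le_one_right (norm_nonneg _) (pow_le_one₀ (norm_nonneg _) i.1.2.1)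
  have hv : ∀ i, ‖v i‖ ^ 2 ≤ ‖c i‖ := by
    intro i
    rw [norm_smul, norm_div, RCLike.norm_conj, Complex.norm_real,
      Real.norm_of_nonneg (Real.sqrt_nonneg _), mul_pow, div_pow,
      Real.sq_sqrt (norm_nonneg _), sq, mul_div_assoc, div_self
        (show ‖c i‖ ≠ 0 from i.2), mul_one]
    exact mul_le_of_le_one_right (norm_nonneg _) (pow_le_one₀ (norm_nonneg _) i.1.2.2)
  have hmem : ∀ w : S → H, (∀ i, ‖w i‖ ^ 2 ≤ ‖c i‖) →
      Memℓp (fun n => Function.extend f w 0 n) 2 := by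
    intro w hw
    refine memℓp_gen ?_
    have h1 : Summable fun i : S => ‖c i‖ := c.summable_norm.subtype _
    have h2 : Summable fun i : S => ‖w i‖ ^ 2 :=
      .of_nonneg_of_le (fun i => by positivity) hw h1
    have h3 := (Function.Injective.summable_iff (f := fun n => ‖Function.extend f w 0 n‖ ^ 2) hf
      (fun n hn => by
        have : Function.extend f w 0 n = 0 := by
          rw [Function.extend_apply' _ _ _ (by simpa using hn)]; rfl
        simp [this])).1 (by
          convert h2 using 2 with i
          simp [hf.extend_apply])
    simpa using h3
  refine ⟨⟨_, hmem u hu⟩, ⟨_, hmem v hv⟩, fun x => ?_⟩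
  have h1 : ∀ i : S, inner ℂ (v i) (x (u i)) = c i * inner ℂ i.1.1.2 (x i.1.1.1) := by
    intro i
    simp only [u, v, map_smul, inner_smul_left, inner_smul_right, map_div₀, Complex.conj_ofReal,
      Complex.conj_conj]
    have : ((√‖c i‖ : ℝ) : ℂ) ≠ 0 := by exact_mod_cast (hpos i).ne'
    field_simp
  rw [traceForm_apply]
  calc ∑' i, c i * inner ℂ i.1.2 (x i.1.1)
      = ∑' i : S, c i * inner ℂ i.1.1.2 (x i.1.1.1) := by
        refine (tsum_subtype_eq_of_support_subset
          (f := fun i : VecPair H => c i * inner ℂ i.1.2 (x i.1.1)) fun i hi => ?_).symm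
        simp only [Function.mem_support, S] at hi ⊢
        exact fun h => hi (by rw [norm_eq_zero.1 h, zero_mul])
    _ = ∑' i : S, inner ℂ (v i) (x (u i)) := tsum_congr fun i => (h1 i).symm
    _ = ∑' n, Function.extend f (fun i => inner ℂ (v i) (x (u i))) 0 n :=
        (tsum_extend_zero hf _).symm
    _ = _ := by
        refine tsum_congr fun n => ?_
        change _ = inner ℂ (Function.extend f v 0 n) (x (Function.extend f u 0 n))
        by_cases hn : ∃ i, f i = n
        · obtain ⟨i, rfl⟩ := hn
          simp [hf.extend_apply]
        · simp [Function.extend_apply' _ _ _ hn]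

/-- Convergence in the ultraweak topology is convergence of all combinations of vector
functionals. -/
theorem tendsto_ultraweak_iff {T : Type*} {l : Filter T} {a : T → H →L[ℂ] H} {x : H →L[ℂ] H} :
    Tendsto a l (@nhds _ (ultraweak H H) x) ↔
      ∀ c, Tendsto (fun t => traceForm c (a t)) l (𝓝 (traceForm c x)) := by
  rw [nhds_induced, tendsto_comap_iff, tendsto_pi_nhds]
  constructor
  · intro h c
    obtain ⟨ξ, η, hc⟩ := exists_lp_of_vecSum c
    simpa [hc] using h (ξ, η)
  · rintro h ⟨ξ, η⟩
    obtain ⟨c, hc⟩ := exists_vecSum_of_lp ξ η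
    simpa [hc] using h c

/-- A bounded family converges ultraweakly as soon as it converges in the weak operator topology. -/
theorem tendsto_ultraweak_of_bounded {T : Type*} {l : Filter T} {a : T → H →L[ℂ] H}
    {x : H →L[ℂ] H} {C : ℝ} (hC : ∀ t, ‖a t‖ ≤ C)
    (h : ∀ ξ η : H, Tendsto (fun t => inner ℂ η (a t ξ)) l (𝓝 (inner ℂ η (x ξ)))) :
    Tendsto a l (@nhds _ (ultraweak H H) x) := by
  refine tendsto_ultraweak_iff.2 fun c => ?_
  simp only [traceForm_apply]
  refine tendsto_tsum_of_dominated_convergence (c.summable_norm.mul_right C)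
    (fun i => (h _ _).const_mul _) (.of_forall fun t i => (c.norm_term_le _ i).trans ?_)
  gcongr
  exact hC t

theorem tendsto_ultraweak_of_norm {T : Type*} {l : Filter T} {a : T → H →L[ℂ] H}
    {x : H →L[ℂ] H} (h : Tendsto a l (𝓝 x)) : Tendsto a l (@nhds _ (ultraweak H H) x) :=
  tendsto_ultraweak_iff.2 fun c => ((traceForm c).continuous.tendsto x).comp h

theorem eq_of_traceForm_eq {x y : H →L[ℂ] H} (h : ∀ c, traceForm c x = traceForm c y) : x = y := by
  ext ξ
  refine ext_inner_left ℂ fun η => ?_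
  simpa [traceForm_vecForm] using h (vecForm ξ η)

theorem tendsto_ultraweak_unique {T : Type*} {l : Filter T} [NeBot l] {a : T → H →L[ℂ] H}
    {x y : H →L[ℂ] H} (hx : Tendsto a l (@nhds _ (ultraweak H H) x))
    (hy : Tendsto a l (@nhds _ (ultraweak H H) y)) : x = y :=
  eq_of_traceForm_eq fun c =>
    tendsto_nhds_unique (tendsto_ultraweak_iff.1 hx c) (tendsto_ultraweak_iff.1 hy c)

theorem continuous_traceForm (c : VecSum H) :
    @Continuous _ _ (ultraweak H H) _ (fun x => traceForm c x) := by
  let _ := ultraweak H H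
  exact continuous_iff_continuousAt.2 fun x => tendsto_ultraweak_iff.1 tendsto_id c

theorem ultraweak_eq_induced :
    ultraweak H H = TopologicalSpace.induced (fun x c => traceForm c x) Pi.topologicalSpace := by
  refine le_antisymm ?_ ?_
  · rw [← continuous_iff_le_induced]
    exact @continuous_pi _ _ _ (ultraweak H H) _ _ fun c => continuous_traceForm c
  · rw [← continuous_iff_le_induced]
    refine @continuous_pi _ _ _ (_) _ _ fun p => ?_
    obtain ⟨c, hc⟩ := exists_vecSum_of_lp p.1 p.2
    simp_rw [← hc]
    exact @Continuous.comp _ (VecSum H → ℂ) ℂ (_) _ _ (fun x c => traceForm c x)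
      (fun p => p c) (continuous_apply c)
      continuous_induced_dom

/-- Ultraweakly closed subspaces are weak* closed in the sense of annihilators. -/
theorem mem_of_annihilator {S : Submodule ℂ (H →L[ℂ] H)}
    (hS : IsClosed[ultraweak H H] (S : Set (H →L[ℂ] H))) {x : H →L[ℂ] H}
    (hx : ∀ c, (∀ y ∈ S, traceForm c y = 0) → traceForm c x = 0) : x ∈ S := by
  classical
  by_contra hxS
  have h1 : (S : Set (H →L[ℂ] H))ᶜ ∈ @nhds _ (ultraweak H H) x :=
    @IsOpen.mem_nhds _ (ultraweak H H) _ _ (@IsClosed.isOpen_compl _ (ultraweak H H) _ hS) hxS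
  rw [ultraweak_eq_induced, nhds_induced, mem_comap] at h1
  obtain ⟨U, hU, hUS⟩ := h1
  rw [nhds_pi, Filter.mem_pi] at hU
  obtain ⟨I, hI, W, hW, hWU⟩ := hU
  have := hI.fintype
  -- A basic neighbourhood restricts only finitely many coordinates, so the separation of `x` from
  -- `S` is already visible in the finite-dimensional space `I → ℂ`, where linear algebra provides
  -- the functional.
  let Ω : (H →L[ℂ] H) →ₗ[ℂ] (I → ℂ) := LinearMap.pi fun c => (traceForm c.1).toLinearMap
  have h2 : Ω x ∉ S.map Ω := by
    rintro ⟨y, hy, hyx⟩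
    refine hUS (a := y) (hWU fun c hc => ?_) hy
    have : traceForm c y = traceForm c x := congrFun hyx ⟨c, hc⟩
    change traceForm c y ∈ W c
    rw [this]
    exact mem_of_mem_nhds (hW c)
  obtain ⟨g, hg, hgS⟩ := Submodule.exists_le_ker_of_notMem h2
  have h3 : ∀ y, g (Ω y) =
      traceForm (∑ c : I, g (fun j => if c = j then 1 else 0) • (c : VecSum H)) y := by
    intro y
    rw [map_sum, sum_apply, LinearMap.pi_apply_eq_sum_univ g (Ω y)]
    refine Finset.sum_congr rfl fun c _ => ?_
    rw [map_smul, smul_apply, smul_eq_mul, smul_eq_mul, mul_comm]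
    rfl
  refine hg ?_
  rw [h3]
  refine hx _ fun y hy => ?_
  rw [← h3]
  exact hgS ⟨y, hy, rfl⟩

end Predual

theorem opNorm_le_of_inner {H K : Type*} [NormedAddCommGroup H] [InnerProductSpace ℂ H]
    [NormedAddCommGroup K] [InnerProductSpace ℂ K] {x : H →L[ℂ] K} {C : ℝ} (hC : 0 ≤ C)
    (h : ∀ ξ η, ‖inner ℂ η (x ξ)‖ ≤ C * ‖ξ‖ * ‖η‖) : ‖x‖ ≤ C := by
  refine x.opNorm_le_bound hC fun ξ => ?_
  have h1 := h ξ (x ξ)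
  rw [inner_self_eq_norm_sq_to_K, norm_pow, RCLike.norm_ofReal, abs_norm, sq] at h1
  rcases (norm_nonneg (x ξ)).eq_or_lt with h0 | h0
  · rw [← h0]; positivity
  · exact le_of_mul_le_mul_right h1 h0

/-! ### Weak* closed subspaces of `B(H)` as dual spaces -/

section Predual

variable {H : Type*} [NormedAddCommGroup H] [InnerProductSpace ℂ H]
  {E : Type*} [NormedAddCommGroup E] [NormedSpace ℂ E] (e : E →ₗᵢ[ℂ] (H →L[ℂ] H))

/-- The restriction of ultraweakly continuous functionals to a subspace of `B(H)`. -/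
noncomputable def traceRestrict : VecSum H →L[ℂ] StrongDual ℂ E :=
  (ContinuousLinearMap.compL ℂ E (H →L[ℂ] H) ℂ).flip e.toContinuousLinearMap ∘L traceForm

@[simp]
theorem traceRestrict_apply (c : VecSum H) (x : E) : traceRestrict e c x = traceForm c (e x) := rfl

/-- The weak* continuous functionals on a subspace of `B(H)`. -/
noncomputable def predual : Submodule ℂ (StrongDual ℂ E) :=
  LinearMap.range (traceRestrict e).toLinearMap

theorem mem_predual {f : StrongDual ℂ E} :
    f ∈ predual e ↔ ∃ c : VecSum H, ∀ x, f x = traceForm c (e x) := by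
  constructor
  · rintro ⟨c, rfl⟩
    exact ⟨c, fun x => rfl⟩
  · rintro ⟨c, hc⟩
    exact ⟨c, by ext x; exact (hc x).symm⟩

theorem norm_traceRestrict_le (c : VecSum H) : ‖traceRestrict e c‖ ≤ ‖c‖ :=
  ContinuousLinearMap.opNorm_le_bound _ (norm_nonneg _) fun x =>
    (norm_traceForm_le c (e x)).trans_eq (by rw [e.norm_map])

variable [CompleteSpace H]

/-- A subspace of `B(H)` that is weak* closed is the dual of the space of its weak* continuous
functionals. -/
theorem exists_eval_of_dual_vecSum
    (he : IsClosed[ultraweak H H] (Set.range e))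
    (Λ : StrongDual ℂ (VecSum H))
    (hΛ : ∀ c, traceRestrict e c = 0 → Λ c = 0) :
    ∃ x : E, (∀ c, Λ c = traceForm c (e x)) ∧ ‖x‖ ≤ ‖Λ‖ := by
  classical
  -- `Λ` depends only on the functional that `c` induces on `B(H)`. As `vecForm` is not itself
  -- linear in its vectors, this is what makes `Λ (vecForm ξ η)` sesquilinear and lets Riesz
  -- representation produce the operator `y`.
  have key : ∀ c d : VecSum H, (∀ x : H →L[ℂ] H, traceForm c x = traceForm d x) → Λ c = Λ d := by
    intro c d h
    refine sub_eq_zero.1 ?_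
    rw [← map_sub]
    refine hΛ _ ?_
    ext x
    simp [h]
  let B : H →L⋆[ℂ] H →L[ℂ] ℂ := LinearMap.mkContinuous₂ (LinearMap.mk₂'ₛₗ (starRingEnd ℂ)
    (RingHom.id ℂ) (fun η ξ => Λ (vecForm ξ η))
    (fun η η' ξ => by
      rw [← map_add]
      refine key _ _ fun x => ?_
      simp [traceForm_vecForm])
    (fun a η ξ => by
      rw [← map_smul]
      refine key _ _ fun x => ?_
      simp [traceForm_vecForm, mul_comm])
    (fun η ξ ξ' => by
      rw [← map_add]
      refine key _ _ fun x => ?_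
      simp [traceForm_vecForm])
    (fun a η ξ => by
      rw [← map_smul]
      refine key _ _ fun x => ?_
      simp [traceForm_vecForm])) ‖Λ‖
    (fun η ξ => (Λ.le_opNorm _).trans_eq (by rw [norm_vecForm]; ring))
  let y : H →L[ℂ] H :=
    ContinuousLinearMap.adjoint (InnerProductSpace.continuousLinearMapOfBilin B)
  have hy : ∀ ξ η, inner ℂ η (y ξ) = Λ (vecForm ξ η) := by
    intro ξ η
    rw [ContinuousLinearMap.adjoint_inner_right,
      InnerProductSpace.continuousLinearMapOfBilin_apply]
    rfl
  have hΛy : ∀ c, Λ c = traceForm c y := by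
    intro c
    have h1 := Λ.hasSum (lp.hasSum_single (by norm_num) c)
    rw [← h1.tsum_eq, traceForm_apply]
    refine tsum_congr fun i => ?_
    rw [hy, ← smul_eq_mul, ← map_smul]
    refine key _ _ fun x => ?_
    rw [lp_single_vecPair, map_smul, smul_apply, smul_eq_mul]
  have hyE : y ∈ LinearMap.range e.toLinearMap := by
    refine mem_of_annihilator he fun c hc => ?_
    rw [← hΛy]
    refine hΛ c ?_
    ext x
    exact hc _ ⟨x, rfl⟩
  obtain ⟨x, hx⟩ := hyE
  replace hx : e x = y := hx
  refine ⟨x, fun c => by rw [hx, hΛy], ?_⟩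
  rw [← e.norm_map, hx]
  refine opNorm_le_of_inner (norm_nonneg _) fun ξ η => ?_
  rw [hy, mul_assoc, ← norm_vecForm]
  exact Λ.le_opNorm _

/-- The predual is the image of the Banach space `VecSum H ⧸ N`. A class in the quotient is normed
by a functional of norm one, which is evaluation at some `x` with `‖x‖ ≤ 1`; so the quotient embeds
without shrinking norms and its range is complete. -/
theorem isClosed_predual
    (he : IsClosed[ultraweak H H] (Set.range e)) :
    IsClosed (predual e : Set (StrongDual ℂ E)) := by
  set N : Submodule ℂ (VecSum H) := LinearMap.ker (traceRestrict e).toLinearMap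
  have hN : IsClosed (N : Set (VecSum H)) := (traceRestrict e).isClosed_ker
  let T : (VecSum H ⧸ N) →L[ℂ] StrongDual ℂ E := N.liftQL (traceRestrict e) le_rfl
  have hT : AntilipschitzWith 1 T := by
    refine AddMonoidHomClass.antilipschitz_of_bound T fun q => ?_
    rw [NNReal.coe_one, one_mul]
    by_cases hq : ‖q‖ = 0
    · rw [hq]; positivity
    obtain ⟨g, hg1, hg⟩ := exists_dual_vector ℂ q hq
    obtain ⟨c, rfl⟩ := Submodule.mkQ_surjective N q
    obtain ⟨x, hx, hx1⟩ := exists_eval_of_dual_vecSum e he (g ∘L N.mkQL) (fun c hc => by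
      have : N.mkQ c = 0 := (Submodule.Quotient.mk_eq_zero N).2 hc
      change g (N.mkQ c) = 0
      rw [this, map_zero])
    have hgn : ‖g ∘L N.mkQL‖ ≤ 1 := by
      refine ContinuousLinearMap.opNorm_le_bound _ zero_le_one fun d => ?_
      refine (g.le_opNorm _).trans ?_
      rw [hg1]
      gcongr
      exact Submodule.Quotient.norm_mk_le N d
    have h1 : (‖N.mkQ c‖ : ℂ) = traceRestrict e c x := by
      rw [traceRestrict_apply, ← hx]
      exact hg.symm
    calc ‖N.mkQ c‖ = ‖traceRestrict e c x‖ := by rw [← h1]; simp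
      _ ≤ ‖traceRestrict e c‖ * ‖x‖ := ContinuousLinearMap.le_opNorm _ _
      _ ≤ ‖traceRestrict e c‖ * 1 := by gcongr; exact hx1.trans hgn
      _ = ‖T (N.mkQ c)‖ := by rw [mul_one]; rfl
  have h2 : (predual e : Set (StrongDual ℂ E)) = Set.range T := by
    ext f
    constructor
    · rintro ⟨c, rfl⟩
      exact ⟨N.mkQ c, rfl⟩
    · rintro ⟨q, rfl⟩
      obtain ⟨c, rfl⟩ := Submodule.mkQ_surjective N q
      exact ⟨c, rfl⟩
  rw [h2]
  exact hT.isClosed_range T.uniformContinuous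

theorem exists_eval_of_dual_predual
    (he : IsClosed[ultraweak H H] (Set.range e))
    (Λ : predual e →ₗ[ℂ] ℂ) {C : ℝ} (hC : 0 ≤ C)
    (hΛ : ∀ f, ‖Λ f‖ ≤ C * ‖f‖) : ∃ x : E, (∀ f, Λ f = f.1 x) ∧ ‖x‖ ≤ C := by
  let R : VecSum H →ₗ[ℂ] predual e := (traceRestrict e).toLinearMap.rangeRestrict
  have hR : ∀ c, ‖(Λ ∘ₗ R) c‖ ≤ C * ‖c‖ := by
    intro c
    refine (hΛ (R c)).trans ?_
    gcongr
    exact norm_traceRestrict_le e c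
  obtain ⟨x, hx, hxC⟩ := exists_eval_of_dual_vecSum e he ((Λ ∘ₗ R).mkContinuous C hR) (by
    intro c hc
    have : R c = 0 := Subtype.ext hc
    change Λ (R c) = 0
    rw [this, map_zero])
  refine ⟨x, ?_, hxC.trans (LinearMap.mkContinuous_norm_le _ hC _)⟩
  rintro ⟨f, c, rfl⟩
  exact hx c

/-- Hahn–Banach gives a norming functional on the predual, and bounded functionals there are
evaluations at points of `E`. -/
theorem exists_norm_attaining
    (he : IsClosed[ultraweak H H] (Set.range e))
    {f : StrongDual ℂ E} (hf : f ∈ predual e) :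
    ∃ x : E, ‖x‖ ≤ 1 ∧ f x = ‖f‖ := by
  by_cases h0 : ‖f‖ = 0
  · exact ⟨0, by simp, by simp [h0]⟩
  obtain ⟨g, hg1, hg⟩ := exists_dual_vector ℂ (⟨f, hf⟩ : predual e) h0
  obtain ⟨x, hx, hx1⟩ := exists_eval_of_dual_predual e he g.toLinearMap zero_le_one
    (fun f => by simpa [hg1] using g.le_opNorm f)
  exact ⟨x, hx1, (hx ⟨f, hf⟩).symm.trans hg⟩

/-- Banach–Alaoglu: the scalar limits exist by compactness of discs and form a bounded functional of
`c`, which is evaluation at a point of `E`. -/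
theorem exists_tendsto_ultraweak
    (he : IsClosed[ultraweak H H] (Set.range e))
    {T : Type*} (l : Ultrafilter T) {a : T → E} {C : ℝ}
    (ha : ∀ t, ‖a t‖ ≤ C) :
    ∃ x : E, Tendsto (fun t => e (a t)) l (@nhds _ (ultraweak H H) (e x)) := by
  have hC : 0 ≤ C := by
    obtain ⟨t⟩ := l.nonempty_of_mem Filter.univ_mem |>.to_type
    exact (norm_nonneg _).trans (ha t)
  have hb : ∀ (c : VecSum H) t, ‖traceForm c (e (a t))‖ ≤ C * ‖c‖ := by
    intro c t
    refine (norm_traceForm_le _ _).trans ?_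
    rw [e.norm_map, mul_comm]
    gcongr
    exact ha t
  have hlim : ∀ c : VecSum H, ∃ z : ℂ, ‖z‖ ≤ C * ‖c‖ ∧
      Tendsto (fun t => traceForm c (e (a t))) l (𝓝 z) := by
    intro c
    obtain ⟨z, hz, hz'⟩ := (isCompact_closedBall (0 : ℂ) (C * ‖c‖)).ultrafilter_le_nhds
      (l.map fun t => traceForm c (e (a t))) (by
        refine Filter.le_principal_iff.2 (Filter.mem_map.2 (Filter.univ_mem' fun t => ?_))
        simpa using hb c t)
    exact ⟨z, by simpa using hz, hz'⟩
  choose L hL hLt using hlim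
  let Λ : VecSum H →ₗ[ℂ] ℂ :=
    { toFun := L
      map_add' := fun c d => tendsto_nhds_unique (hLt (c + d)) (by
        simpa using (hLt c).add (hLt d))
      map_smul' := fun r c => tendsto_nhds_unique (hLt (r • c)) (by
        simpa using (hLt c).const_mul r) }
  obtain ⟨x, hx, -⟩ := exists_eval_of_dual_vecSum e he (Λ.mkContinuous C hL) (by
    intro c hc
    refine tendsto_nhds_unique (hLt c) ?_
    have : ∀ t, traceForm c (e (a t)) = 0 := fun t => by
      rw [← traceRestrict_apply, hc]; rfl
    simp [this])
  refine ⟨x, tendsto_ultraweak_iff.2 fun c => ?_⟩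
  rw [← hx]
  exact hLt c

/-- A form of the Krein–Shmulyan theorem: weak* continuity at 0 on the unit ball suffices. Such an
`f` is approximated in norm by weak* continuous functionals, and these form a norm closed space. -/
theorem mem_predual_of_tendsto
    (he : IsClosed[ultraweak H H] (Set.range e))
    (f : StrongDual ℂ E)
    (hf : ∀ l : Ultrafilter E, (∀ᶠ a in (l : Filter E), ‖a‖ ≤ 1) →
      (∀ c, Tendsto (fun a => traceForm c (e a)) l (𝓝 0)) → Tendsto f l (𝓝 0)) :
    f ∈ predual e := by
  have hcl := isClosed_predual e he
  rw [← SetLike.mem_coe, ← hcl.closure_eq, Metric.mem_closure_iff]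
  intro ε hε
  -- On the unit ball `f` is small where finitely many weak* continuous functionals are small.
  have h1 : ∀ᶠ a in (⨅ c : VecSum H, comap (fun a => traceForm c (e a)) (𝓝 0)) ⊓
      𝓟 {a : E | ‖a‖ ≤ 1}, ‖f a‖ < ε / 2 := by
    by_contra h
    rw [Filter.not_eventually] at h
    have hne : NeBot (((⨅ c : VecSum H, comap (fun a => traceForm c (e a)) (𝓝 0)) ⊓
      𝓟 {a : E | ‖a‖ ≤ 1}) ⊓ 𝓟 {a | ¬ ‖f a‖ < ε / 2}) :=
      Filter.frequently_iff_neBot.1 h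
    let l := Ultrafilter.of (((⨅ c : VecSum H, comap (fun a => traceForm c (e a)) (𝓝 0)) ⊓
      𝓟 {a : E | ‖a‖ ≤ 1}) ⊓ 𝓟 {a | ¬ ‖f a‖ < ε / 2})
    have hl := Ultrafilter.of_le (((⨅ c : VecSum H, comap (fun a => traceForm c (e a)) (𝓝 0)) ⊓
      𝓟 {a : E | ‖a‖ ≤ 1}) ⊓ 𝓟 {a | ¬ ‖f a‖ < ε / 2})
    have h2 := hf l (Filter.le_principal_iff.1 (hl.trans (inf_le_left.trans inf_le_right)))
      (fun c => Filter.tendsto_iff_comap.2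
        (hl.trans (inf_le_left.trans (inf_le_left.trans (iInf_le _ c)))))
    have h3 : ∀ᶠ a in (l : Filter E), ¬ ‖f a‖ < ε / 2 :=
      Filter.le_principal_iff.1 (hl.trans inf_le_right)
    have h4 : ∀ᶠ a in (l : Filter E), ‖f a‖ < ε / 2 := by
      have := h2.norm
      rw [norm_zero] at this
      exact this.eventually_lt_const (half_pos hε)
    obtain ⟨a, ha, ha'⟩ := (h3.and h4).exists
    exact ha ha'
  rw [Filter.eventually_inf_principal] at h1
  obtain ⟨I, hI, V, hV, hVs⟩ := Filter.mem_iInf.1 h1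
  have : Finite I := hI
  let L : I → E →ₗ[ℂ] ℂ := fun c => (traceRestrict e c.1).toLinearMap
  let S : Submodule ℂ E := ⨅ c, LinearMap.ker (L c)
  have hS : ∀ a ∈ S, ‖a‖ ≤ 1 → ‖f a‖ ≤ ε / 2 := by
    intro a ha ha1
    have h2 : a ∈ ⋂ c, V c := by
      refine Set.mem_iInter.2 fun c => ?_
      obtain ⟨W, hW, hWV⟩ := Filter.mem_comap.1 (hV c)
      refine hWV ?_
      have : traceForm c.1 (e a) = 0 := (Submodule.mem_iInf _).1 ha c
      rw [Set.mem_preimage, this]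
      exact mem_of_mem_nhds hW
    rw [← hVs] at h2
    exact (h2 ha1).le
  -- The restriction of `f` to `S` has norm at most `ε / 2`, and `g` extends it with the same norm.
  -- Then `f - g` vanishes on the common kernel `S` of finitely many weak* continuous functionals,
  -- so it is a combination of them.
  obtain ⟨g, hg, hgn⟩ := exists_extension_norm_eq S (f.comp S.subtypeL)
  have hg2 : ‖g‖ ≤ ε / 2 := by
    rw [hgn]
    refine ContinuousLinearMap.opNorm_le_of_unit_norm (by positivity) fun a ha => ?_
    exact hS a a.2 (by simpa using ha.le)
  have h3 : (f - g).toLinearMap ∈ Submodule.span ℂ (Set.range L) := by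
    refine mem_span_of_iInf_ker_le_ker fun a ha => ?_
    have := hg ⟨a, ha⟩
    change f a - g a = 0
    rw [this, sub_eq_zero]
    rfl
  have := Fintype.ofFinite I
  obtain ⟨w, hw⟩ := (Submodule.mem_span_range_iff_exists_fun ℂ).1 h3
  refine ⟨f - g, (mem_predual e).2 ⟨∑ c, w c • c.1, fun x => ?_⟩, ?_⟩
  · have := LinearMap.congr_fun hw x
    rw [map_sum, sum_apply]
    simp only [map_smul, smul_apply]
    simpa [L] using this.symm
  · rw [dist_eq_norm, sub_sub_cancel]
    exact hg2.trans_lt (half_lt_self hε)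

end Predual

/-! ### Tangent vector fields of the operator ball -/

section Tangent

variable {H K : Type*} [NormedAddCommGroup H] [InnerProductSpace ℂ H]
  [NormedAddCommGroup K] [InnerProductSpace ℂ K]

/-- Perturbations of an operator that keep its norm up to second order. -/
theorem norm_sq_add_smul_le {X Z : H →L[ℂ] K} {R : H →L[ℂ] H} {r : ℝ} (hX : ‖X‖ ≤ r)
    (h : ∀ v, (inner ℂ (X v) (Z v)).re =
      r ^ 2 * (inner ℂ (R v) v).re - (inner ℂ (X (R v)) (X v)).re) (t : ℝ) :
    ‖X + (t : ℂ) • Z‖ ^ 2 ≤ r ^ 2 + t ^ 2 * (r ^ 2 * ‖R‖ ^ 2 + ‖Z‖ ^ 2) := by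
  have hr : 0 ≤ r := (norm_nonneg _).trans hX
  set B := r ^ 2 + t ^ 2 * (r ^ 2 * ‖R‖ ^ 2 + ‖Z‖ ^ 2) with hB
  have hB0 : 0 ≤ B := by positivity
  refine (Real.le_sqrt (norm_nonneg _) hB0).1
    (ContinuousLinearMap.opNorm_le_bound _ (Real.sqrt_nonneg _) fun v => ?_)
  refine le_of_sq_le_sq ?_ (by positivity)
  rw [mul_pow, Real.sq_sqrt hB0]
  have h1 : ‖(X + (t : ℂ) • Z) v‖ ^ 2 =
      ‖X v‖ ^ 2 + 2 * t * (inner ℂ (X v) (Z v)).re + t ^ 2 * ‖Z v‖ ^ 2 := by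
    have := @norm_add_sq ℂ _ _ _ _ (X v) ((t : ℂ) • Z v)
    rw [inner_smul_right, norm_smul, Complex.norm_real, mul_pow, Real.norm_eq_abs, sq_abs] at this
    simp only [RCLike.re_to_complex, Complex.re_ofReal_mul] at this
    rw [add_apply, smul_apply, this]
    ring
  have h2 : ‖v - (t : ℂ) • R v‖ ^ 2 =
      ‖v‖ ^ 2 - 2 * t * (inner ℂ (R v) v).re + t ^ 2 * ‖R v‖ ^ 2 := by
    have := @norm_sub_sq ℂ _ _ _ _ v ((t : ℂ) • R v)
    rw [← inner_conj_symm, inner_smul_left, norm_smul, Complex.norm_real, mul_pow,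
      Real.norm_eq_abs, sq_abs] at this
    simp only [RCLike.re_to_complex, Complex.conj_re, Complex.conj_ofReal,
      Complex.re_ofReal_mul] at this
    rw [this]
    ring
  have h3 : ‖X (v - (t : ℂ) • R v)‖ ^ 2 =
      ‖X v‖ ^ 2 - 2 * t * (inner ℂ (X (R v)) (X v)).re + t ^ 2 * ‖X (R v)‖ ^ 2 := by
    have := @norm_sub_sq ℂ _ _ _ _ (X v) ((t : ℂ) • X (R v))
    rw [← inner_conj_symm, inner_smul_left, norm_smul, Complex.norm_real, mul_pow,
      Real.norm_eq_abs, sq_abs] at this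
    simp only [RCLike.re_to_complex, Complex.conj_re, Complex.conj_ofReal,
      Complex.re_ofReal_mul] at this
    rw [map_sub, map_smul, this]
    ring
  -- Comparing `X` at the shifted vector `v - tRv` with its norm bound produces exactly the first
  -- order term that the hypothesis on `Z` puts into `‖(X + tZ)v‖²`; what is left is of order `t²`.
  have h4 : ‖X (v - (t : ℂ) • R v)‖ ^ 2 ≤ r ^ 2 * ‖v - (t : ℂ) • R v‖ ^ 2 := by
    rw [← mul_pow]
    gcongr
    exact X.le_of_opNorm_le hX _
  have h5 : ‖R v‖ ^ 2 ≤ ‖R‖ ^ 2 * ‖v‖ ^ 2 := by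
    rw [← mul_pow]; gcongr; exact R.le_opNorm v
  have h6 : ‖Z v‖ ^ 2 ≤ ‖Z‖ ^ 2 * ‖v‖ ^ 2 := by
    rw [← mul_pow]; gcongr; exact Z.le_opNorm v
  have h7 : t ^ 2 * r ^ 2 * ‖R v‖ ^ 2 ≤ t ^ 2 * r ^ 2 * (‖R‖ ^ 2 * ‖v‖ ^ 2) := by gcongr
  have h8 : t ^ 2 * ‖Z v‖ ^ 2 ≤ t ^ 2 * (‖Z‖ ^ 2 * ‖v‖ ^ 2) := by gcongr
  have h9 : 0 ≤ t ^ 2 * ‖X (R v)‖ ^ 2 := by positivity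
  rw [h2, h3] at h4
  rw [h1, h v, hB]
  linarith

variable [CompleteSpace H] [CompleteSpace K]

/-- The vector fields `X ↦ r² A - X A* X` are tangent to the spheres. -/
theorem norm_sq_add_tangent_le (X A : H →L[ℂ] K) {r : ℝ} (hX : ‖X‖ ≤ r) (t : ℝ) :
    ‖X + (t : ℂ) • ((r ^ 2 : ℂ) • A - X ∘L ContinuousLinearMap.adjoint A ∘L X)‖ ^ 2 ≤
      r ^ 2 * (1 + 5 * ‖A‖ ^ 2 * t ^ 2 * r ^ 2) := by
  have hr : 0 ≤ r := (norm_nonneg _).trans hX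
  set R := ContinuousLinearMap.adjoint A ∘L X with hR
  have hRn : ‖R‖ ≤ ‖A‖ * r := by
    refine (ContinuousLinearMap.opNorm_comp_le _ _).trans ?_
    rw [LinearIsometryEquiv.norm_map]
    gcongr
  have hZ : ‖(r ^ 2 : ℂ) • A - X ∘L R‖ ≤ 2 * (‖A‖ * r ^ 2) := by
    refine (norm_sub_le _ _).trans ?_
    rw [norm_smul, norm_pow, Complex.norm_real, Real.norm_of_nonneg hr]
    have : ‖X ∘L R‖ ≤ r * (‖A‖ * r) :=
      (ContinuousLinearMap.opNorm_comp_le _ _).trans (by gcongr)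
    nlinarith
  refine (norm_sq_add_smul_le (R := R) hX (fun v => ?_) t).trans ?_
  · simp only [hR, sub_apply, smul_apply, ContinuousLinearMap.comp_apply, inner_sub_right,
      inner_smul_right, ContinuousLinearMap.adjoint_inner_left, Complex.sub_re]
    rw [← Complex.ofReal_pow, Complex.re_ofReal_mul, ← inner_conj_symm (X _) (X v),
      Complex.conj_re]
  -- The constant 5 is 1 from `R`, with `‖R‖ ≤ ‖A‖r`, plus 4 from the field, whose norm is at most
  -- `2‖A‖r²`.
  · have h1 : r ^ 2 * ‖R‖ ^ 2 ≤ r ^ 2 * (‖A‖ * r) ^ 2 := by gcongr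
    have h2 : ‖(r ^ 2 : ℂ) • A - X ∘L R‖ ^ 2 ≤ (2 * (‖A‖ * r ^ 2)) ^ 2 := by gcongr
    have h3 : t ^ 2 * (r ^ 2 * ‖R‖ ^ 2 + ‖(r ^ 2 : ℂ) • A - X ∘L R‖ ^ 2) ≤
        t ^ 2 * (r ^ 2 * (‖A‖ * r) ^ 2 + (2 * (‖A‖ * r ^ 2)) ^ 2) := by gcongr
    linarith

/-- A second tangent field: `R = X*Y` meets the first order condition with `r = 1`. A functional
that attains its norm at `X` must therefore annihilate every `Y - XX*Y`. -/
theorem norm_sq_add_defect_le (X Y : H →L[ℂ] K) (hX : ‖X‖ ≤ 1) (t : ℝ) :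
    ‖X + (t : ℂ) • (Y - X ∘L ContinuousLinearMap.adjoint X ∘L Y)‖ ^ 2 ≤
      1 + 5 * ‖Y‖ ^ 2 * t ^ 2 := by
  set R := ContinuousLinearMap.adjoint X ∘L Y with hR
  have hRn : ‖R‖ ≤ ‖Y‖ := by
    refine (ContinuousLinearMap.opNorm_comp_le _ _).trans ?_
    rw [LinearIsometryEquiv.norm_map]
    exact mul_le_of_le_one_left (norm_nonneg _) hX
  have hZ : ‖Y - X ∘L R‖ ≤ 2 * ‖Y‖ := by
    refine (norm_sub_le _ _).trans ?_
    have : ‖X ∘L R‖ ≤ 1 * ‖Y‖ :=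
      (ContinuousLinearMap.opNorm_comp_le _ _).trans (by gcongr)
    linarith
  refine (norm_sq_add_smul_le (R := R) hX (fun v => ?_) t).trans ?_
  · simp only [hR, sub_apply, ContinuousLinearMap.comp_apply, inner_sub_right,
      ContinuousLinearMap.adjoint_inner_left, Complex.sub_re]
    rw [← inner_conj_symm (X _) (X v), Complex.conj_re, ← inner_conj_symm (Y _) (X v),
      Complex.conj_re]
    ring
  · have h1 : ‖R‖ ^ 2 ≤ ‖Y‖ ^ 2 := by gcongr
    have h2 : ‖Y - X ∘L R‖ ^ 2 ≤ (2 * ‖Y‖) ^ 2 := by gcongr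
    have h3 : t ^ 2 * (1 ^ 2 * ‖R‖ ^ 2 + ‖Y - X ∘L R‖ ^ 2) ≤
        t ^ 2 * (1 ^ 2 * ‖Y‖ ^ 2 + (2 * ‖Y‖) ^ 2) := by gcongr
    linarith

end Tangent

/-! ### Matrices of operators -/

section Amplification

variable {H K : Type*} [NormedAddCommGroup H] [InnerProductSpace ℂ H]
  [NormedAddCommGroup K] [InnerProductSpace ℂ K] {E : Type*} [AddCommGroup E] [Module ℂ E]

/-- The amplification `Mₙ(E) → B(Hⁿ, Kⁿ)` of a linear map `E → B(H, K)`. -/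
noncomputable def amplify (e : E →ₗ[ℂ] (H →L[ℂ] K)) (n : ℕ) :
    Matrix (Fin n) (Fin n) E →ₗ[ℂ]
      (PiLp 2 (fun _ : Fin n => H) →L[ℂ] PiLp 2 (fun _ : Fin n => K)) where
  toFun x := matrixOp (x.map e)
  map_add' x y := by
    ext ξ i
    simp [matrixOp_apply, Finset.sum_add_distrib]
  map_smul' c x := by
    ext ξ i
    simp [matrixOp_apply, Finset.smul_sum]

theorem amplify_apply (e : E →ₗ[ℂ] (H →L[ℂ] K)) {n : ℕ} (x : Matrix (Fin n) (Fin n) E) :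
    amplify e n x = matrixOp (x.map e) := rfl

theorem inner_matrixOp {n : ℕ} (x : Matrix (Fin n) (Fin n) (H →L[ℂ] K))
    (ξ : PiLp 2 (fun _ : Fin n => H)) (η : PiLp 2 (fun _ : Fin n => K)) :
    inner ℂ η (matrixOp x ξ) = ∑ i, ∑ j, inner ℂ (η i) (x i j (ξ j)) := by
  simp [PiLp.inner_apply, matrixOp_apply, inner_sum]

theorem norm_entry_le_norm_matrixOp {n : ℕ} (x : Matrix (Fin n) (Fin n) (H →L[ℂ] K))
    (i j : Fin n) : ‖x i j‖ ≤ ‖matrixOp x‖ := by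
  classical
  refine ContinuousLinearMap.opNorm_le_bound _ (norm_nonneg (matrixOp x)) fun ξ => ?_
  have h1 : matrixOp x (PiLp.single 2 j ξ) i = x i j ξ := by
    rw [matrixOp_apply, Finset.sum_eq_single j]
    · simp
    · intro k _ hk
      simp [hk]
    · simp
  rw [← h1]
  refine (PiLp.norm_apply_le _ i).trans (((matrixOp x).le_opNorm _).trans_eq ?_)
  rw [PiLp.norm_single]

theorem norm_matrixOp_le_sum {n : ℕ} (x : Matrix (Fin n) (Fin n) (H →L[ℂ] K)) :
    ‖matrixOp x‖ ≤ ∑ i, ∑ j, ‖x i j‖ := by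
  refine opNorm_le_of_inner (by positivity) fun ξ η => ?_
  rw [inner_matrixOp, Finset.sum_mul, Finset.sum_mul]
  refine norm_sum_le_of_le _ fun i _ => ?_
  rw [Finset.sum_mul, Finset.sum_mul]
  refine norm_sum_le_of_le _ fun j _ => ?_
  calc ‖inner ℂ (η i) (x i j (ξ j))‖ ≤ ‖η i‖ * (‖x i j‖ * ‖ξ j‖) :=
        (norm_inner_le_norm _ _).trans (by gcongr; exact (x i j).le_opNorm _)
    _ ≤ ‖η‖ * (‖x i j‖ * ‖ξ‖) := by
        gcongr
        · exact PiLp.norm_apply_le _ _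
        · exact PiLp.norm_apply_le _ _
    _ = ‖x i j‖ * ‖ξ‖ * ‖η‖ := by ring

/-- The norm of a matrix of operators is weakly lower semicontinuous. -/
theorem norm_matrixOp_le_of_tendsto {n : ℕ} {T : Type*} {l : Filter T} [NeBot l]
    {x : T → Matrix (Fin n) (Fin n) (H →L[ℂ] K)} {y : Matrix (Fin n) (Fin n) (H →L[ℂ] K)}
    {C : ℝ} (hx : ∀ᶠ t in l, ‖matrixOp (x t)‖ ≤ C)
    (h : ∀ i j ξ η, Tendsto (fun t => inner ℂ η (x t i j ξ)) l (𝓝 (inner ℂ η (y i j ξ)))) :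
    ‖matrixOp y‖ ≤ C := by
  have hC : 0 ≤ C := by
    obtain ⟨t, ht⟩ := hx.exists
    exact (norm_nonneg (matrixOp (x t))).trans ht
  refine opNorm_le_of_inner hC fun ξ η => ?_
  have h1 : Tendsto (fun t => inner ℂ η (matrixOp (x t) ξ)) l
      (𝓝 (inner ℂ η (matrixOp y ξ))) := by
    simp only [inner_matrixOp]
    exact tendsto_finsetSum _ fun i _ => tendsto_finsetSum _ fun j _ => h i j _ _
  refine le_of_tendsto h1.norm (hx.mono fun t ht => ?_)
  refine (norm_inner_le_norm _ _).trans ?_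
  rw [mul_comm]
  gcongr
  exact (matrixOp (x t)).le_of_opNorm_le ht _

theorem matrixOp_comp {L : Type*} [NormedAddCommGroup L] [InnerProductSpace ℂ L] {n : ℕ}
    (x : Matrix (Fin n) (Fin n) (K →L[ℂ] L)) (y : Matrix (Fin n) (Fin n) (H →L[ℂ] K)) :
    matrixOp x ∘L matrixOp y = matrixOp (.of fun i j => ∑ k, x i k ∘L y k j) := by
  ext ξ i
  simp only [ContinuousLinearMap.comp_apply, matrixOp_apply, map_sum, Matrix.of_apply, sum_apply]
  rw [Finset.sum_comm]

theorem adjoint_matrixOp [CompleteSpace H] [CompleteSpace K] {n : ℕ}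
    (x : Matrix (Fin n) (Fin n) (H →L[ℂ] K)) :
    ContinuousLinearMap.adjoint (matrixOp x) =
      matrixOp (.of fun i j => ContinuousLinearMap.adjoint (x j i)) := by
  refine ((ContinuousLinearMap.eq_adjoint_iff _ _).2 fun η ξ => ?_).symm
  rw [inner_matrixOp, ← inner_conj_symm, inner_matrixOp, map_sum, Finset.sum_comm]
  refine Finset.sum_congr rfl fun i _ => ?_
  rw [map_sum]
  refine Finset.sum_congr rfl fun j _ => ?_
  rw [inner_conj_symm, Matrix.of_apply, ContinuousLinearMap.adjoint_inner_left]

/-- The ternary product of matrices of operators. -/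
theorem matrixOp_ternary [CompleteSpace H] [CompleteSpace K] {n : ℕ}
    (x y z : Matrix (Fin n) (Fin n) (H →L[ℂ] K)) :
    matrixOp x ∘L ContinuousLinearMap.adjoint (matrixOp y) ∘L matrixOp z =
      matrixOp (.of fun i j => ∑ k, ∑ l, x i k ∘L ContinuousLinearMap.adjoint (y l k) ∘L z l j) := by
  rw [adjoint_matrixOp, matrixOp_comp, matrixOp_comp]
  congr 1
  ext i j : 2
  simp [ContinuousLinearMap.comp_finsetSum]

end Amplification

/-! ### Uniqueness of the ternary product -/

section UniqueProduct

/-- The value `p` of a ternary product `(x, a, y) ↦ p` is determined by the norms of upper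
triangular matrices, through the tangent vector fields of the unit ball of `M₂(E)`. -/
theorem eq_of_tangent {E : Type*} [AddCommGroup E] [Module ℂ E]
    (N : Seminorm ℂ (Matrix (Fin 2) (Fin 2) E)) (hN : ∀ h, N !![0, h; 0, 0] = 0 → h = 0)
    {x y a p q : E} {C D : ℝ} (hC : 0 ≤ C) (hD : 0 ≤ D)
    (hp : ∀ w r, N !![x, w; 0, y] ≤ r → ∀ t : ℝ,
      N !![x, w - (t : ℂ) • p; ((t * r ^ 2 : ℝ) : ℂ) • a, y] ^ 2 ≤
        r ^ 2 * (1 + C * t ^ 2 * r ^ 2))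
    (hq : ∀ w r, N !![x, w; 0, y] ≤ r → ∀ t : ℝ,
      N !![x, w - (t : ℂ) • q; ((t * r ^ 2 : ℝ) : ℂ) • a, y] ^ 2 ≤
        r ^ 2 * (1 + D * t ^ 2 * r ^ 2)) : p = q := by
  by_contra hpq
  set h := q - p with hh
  set δ := N !![0, h; 0, 0] with hδ
  have hh0 : 0 < δ := lt_of_le_of_ne (apply_nonneg _ _) fun h0 =>
    hpq (sub_eq_zero.1 (hN h h0.symm)).symm
  let X : ℝ → Matrix (Fin 2) (Fin 2) E := fun t => !![x, (t : ℂ) • h; 0, y]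
  let φ : ℝ → ℝ := fun t => N (X t)
  have hφ0 : ∀ t, 0 ≤ φ t := fun t => apply_nonneg N _
  set B := 2 * (C + D) with hB
  have hB0 : 0 ≤ B := by positivity
  have grow : ∀ t s, φ (t + s) ^ 2 ≤ φ t ^ 2 * (1 + B * s ^ 2 * φ t ^ 2) := by
    intro t s
    set r := φ t
    have h1 := hp ((t : ℂ) • h) r le_rfl (2 * s)
    have h2 := hq ((t : ℂ) • h) r le_rfl (-(2 * s))
    set Y := !![x, (t : ℂ) • h - ((2 * s : ℝ) : ℂ) • p; ((2 * s * r ^ 2 : ℝ) : ℂ) • a, y]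
    set Z := !![x, (t : ℂ) • h - ((-(2 * s) : ℝ) : ℂ) • q; ((-(2 * s) * r ^ 2 : ℝ) : ℂ) • a, y]
    -- The steps `2s` and `-2s` along the two fields cancel in the entry `a`, and their average
    -- moves the corner by `s(q - p) = s h`.
    have h3 : X (t + s) = (2⁻¹ : ℂ) • (Y + Z) := by
      ext i j
      fin_cases i <;> fin_cases j
      · simp [X, Y, Z, ← two_smul ℂ]
      · simp only [X, Y, Z, hh, Matrix.smul_apply, Matrix.add_apply]
        simp
        module
      · simp only [X, Y, Z, hh, Matrix.smul_apply, Matrix.add_apply]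
        simp
      · simp [X, Y, Z, ← two_smul ℂ]
    have h4 : φ (t + s) ≤ 2⁻¹ * (N Y + N Z) := by
      change N (X (t + s)) ≤ _
      rw [h3, map_smul_eq_mul]
      norm_num
      exact map_add_le_add _ _ _
    have h5 : φ (t + s) ^ 2 ≤ (2⁻¹ * (N Y + N Z)) ^ 2 := by
      gcongr
    nlinarith [sq_nonneg (N Y - N Z)]
  have big : ∀ t : ℝ, 0 ≤ t → t * δ ≤ φ t + φ 0 := by
    intro t ht
    have h1 : (t : ℂ) • !![0, h; 0, 0] = X t - X 0 := by
      ext i j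
      fin_cases i <;> fin_cases j <;> simp [X]
    calc t * δ = N ((t : ℂ) • !![0, h; 0, 0]) := by
          rw [map_smul_eq_mul, Complex.norm_real, Real.norm_of_nonneg ht]
      _ ≤ φ t + φ 0 := by rw [h1]; exact map_sub_le_add _ _ _
  -- Convexity of `φ`: `X t` lies on the segment from `X 0` to `X (t + s)`.
  have conv : ∀ t s : ℝ, 0 < t → 0 ≤ s → (t + s) * φ t ≤ s * φ 0 + t * φ (t + s) := by
    intro t s ht hs
    have h1 : ((t + s : ℝ) : ℂ) • X t = (s : ℂ) • X 0 + (t : ℂ) • X (t + s) := by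
      ext i j
      fin_cases i <;> fin_cases j
      · simp [X]; module
      · simp [X]; module
      · simp [X]
      · simp [X]; module
    calc (t + s) * φ t = N (((t + s : ℝ) : ℂ) • X t) := by
          rw [map_smul_eq_mul, Complex.norm_real, Real.norm_of_nonneg (by positivity)]
      _ ≤ N ((s : ℂ) • X 0) + N ((t : ℂ) • X (t + s)) := by
          rw [h1]; exact map_add_le_add _ _ _
      _ = s * φ 0 + t * φ (t + s) := by
          rw [map_smul_eq_mul, map_smul_eq_mul, Complex.norm_real, Complex.norm_real,
            Real.norm_of_nonneg hs, Real.norm_of_nonneg ht.le]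
  -- Choose `t` where `φ` exceeds `φ 0`.
  set t := (2 * φ 0 + 1) / δ with ht
  have ht0 : 0 < t := by have := hφ0 0; positivity
  have hr : φ 0 + 1 ≤ φ t := by
    have h1 := big t ht0.le
    rw [ht, div_mul_cancel₀ _ hh0.ne', ← ht] at h1
    linarith
  set r := φ t
  have hr0 : 0 < r := by have := hφ0 0; linarith
  -- Convexity forces `φ` to grow by at least `s / t`, whereas `grow` allows only order `s²`.
  -- Together they require `2 ≤ B s r³ t`, and this choice makes that product less than 1.
  set s := 1 / (t * (B * r ^ 3 + 1)) with hs
  have hs0 : 0 < s := by positivity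
  have h1 := conv t s ht0 hs0.le
  have h2 := grow t s
  have h3 : r + s / t ≤ φ (t + s) := by
    have : t * (r + s / t) ≤ t * φ (t + s) := by
      have : t * (r + s / t) = t * r + s := by field_simp
      rw [this]
      nlinarith
    exact le_of_mul_le_mul_left this ht0
  have h4 : (r + s / t) ^ 2 ≤ r ^ 2 * (1 + B * s ^ 2 * r ^ 2) :=
    (pow_le_pow_left₀ (by positivity) h3 2).trans h2
  have h5 : 2 * r * (s / t) ≤ B * s ^ 2 * r ^ 4 := by nlinarith [sq_nonneg (s / t)]
  have h6 : s * (t * (B * r ^ 3 + 1)) = 1 := by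
    rw [hs]; exact one_div_mul_cancel (by positivity)
  have h7 : 2 ≤ B * s * r ^ 3 * t := by
    have h8 : (s * r / t) * 2 ≤ (s * r / t) * (B * s * r ^ 3 * t) := by
      calc (s * r / t) * 2 = 2 * r * (s / t) := by ring
        _ ≤ B * s ^ 2 * r ^ 4 := h5
        _ = (s * r / t) * (B * s * r ^ 3 * t) := by field_simp
    exact le_of_mul_le_mul_left h8 (by positivity)
  nlinarith [mul_pos hs0 ht0]

variable {H K : Type*} [NormedAddCommGroup H] [InnerProductSpace ℂ H]
  [NormedAddCommGroup K] [InnerProductSpace ℂ K] {E : Type*} [AddCommGroup E] [Module ℂ E]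

/-- The matrix norms of an operator space. -/
noncomputable def ampNorm (e : E →ₗ[ℂ] (H →L[ℂ] K)) (n : ℕ) :
    Seminorm ℂ (Matrix (Fin n) (Fin n) E) :=
  .ofSMulLE (fun x => ‖amplify e n x‖)
    (by rw [map_zero]; exact ContinuousLinearMap.opNorm_zero)
    (fun x y => by rw [map_add]; exact ContinuousLinearMap.opNorm_add_le _ _)
    (fun c x => by rw [map_smul]; exact ContinuousLinearMap.opNorm_smul_le _ _)

theorem ampNorm_apply (e : E →ₗ[ℂ] (H →L[ℂ] K)) {n : ℕ} (x : Matrix (Fin n) (Fin n) E) :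
    ampNorm e n x = ‖amplify e n x‖ := rfl

theorem ampNorm_eq_zero {e : E →ₗ[ℂ] (H →L[ℂ] K)} (he : Function.Injective e) (h : E)
    (h0 : ampNorm e 2 !![0, h; 0, 0] = 0) : h = 0 := by
  have h1 := norm_entry_le_norm_matrixOp (!![0, h; 0, 0].map e) 0 1
  rw [← amplify_apply, ← ampNorm_apply, h0] at h1
  exact he ((norm_le_zero_iff.1 h1).trans (map_zero e).symm)

/-- Upper triangular matrices and the ternary product. -/
theorem matrixOp_ternary_upper [CompleteSpace H] [CompleteSpace K] (x y w a : H →L[ℂ] K) :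
    matrixOp !![x, w; 0, y] ∘L ContinuousLinearMap.adjoint (matrixOp !![0, 0; a, 0]) ∘L
      matrixOp !![x, w; 0, y] = matrixOp !![0, x ∘L ContinuousLinearMap.adjoint a ∘L y; 0, 0] := by
  rw [matrixOp_ternary]
  congr 1
  ext i j : 2
  fin_cases i <;> fin_cases j <;> simp [Fin.sum_univ_two]

/-- For `A = !![0, 0; a, 0]` the matrix `XA*X` has the single entry `xa*y` in the corner. Hence the
diagonal of `X` stays fixed along the field, and the corner moves at a rate that does not depend on
`w`. -/
theorem tangent_upper [CompleteSpace H] [CompleteSpace K] (x y w a : H →L[ℂ] K) {r : ℝ}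
    (hr : ‖matrixOp !![x, w; 0, y]‖ ≤ r) (t : ℝ) :
    ‖matrixOp !![x, w - (t : ℂ) • (x ∘L ContinuousLinearMap.adjoint a ∘L y);
      ((t * r ^ 2 : ℝ) : ℂ) • a, y]‖ ^ 2 ≤
      r ^ 2 * (1 + 5 * ‖matrixOp !![0, 0; a, 0]‖ ^ 2 * t ^ 2 * r ^ 2) := by
  have h := norm_sq_add_tangent_le (matrixOp !![x, w; 0, y]) (matrixOp !![0, 0; a, 0]) hr t
  rw [matrixOp_ternary_upper] at h
  convert h using 3
  ext ξ i
  fin_cases i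
  · simp [matrixOp_apply, Fin.sum_univ_two, -Complex.coe_smul]
    module
  · simp [matrixOp_apply, Fin.sum_univ_two, -Complex.coe_smul]
    module

end UniqueProduct

theorem amplify_comp_isometric {H K H' K' E : Type*}
    [NormedAddCommGroup H] [InnerProductSpace ℂ H] [NormedAddCommGroup K] [InnerProductSpace ℂ K]
    [NormedAddCommGroup H'] [InnerProductSpace ℂ H']
    [NormedAddCommGroup K'] [InnerProductSpace ℂ K'] [AddCommGroup E] [Module ℂ E]
    {e : E →ₗ[ℂ] (H →L[ℂ] K)} {ι : E →ₗ[ℂ] (H' →L[ℂ] K')} (h : IsCompletelyIsometric e ι) {n : ℕ}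
    (x : Matrix (Fin n) (Fin n) E) : ‖amplify ι n x‖ = ‖amplify e n x‖ := h n x

/-- A completely isometric TRO structure controls the tangent vector fields. -/
theorem tangent_of_isometric {H K H' K' E : Type*}
    [NormedAddCommGroup H] [InnerProductSpace ℂ H] [NormedAddCommGroup K] [InnerProductSpace ℂ K]
    [NormedAddCommGroup H'] [InnerProductSpace ℂ H'] [CompleteSpace H']
    [NormedAddCommGroup K'] [InnerProductSpace ℂ K'] [CompleteSpace K']
    [AddCommGroup E] [Module ℂ E]
    {e : E →ₗ[ℂ] (H →L[ℂ] K)} {ι : E →ₗ[ℂ] (H' →L[ℂ] K')} (h : IsCompletelyIsometric e ι)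
    {x y a p : E} (hp : ι p = ι x ∘L ContinuousLinearMap.adjoint (ι a) ∘L ι y) :
    ∃ C : ℝ, 0 ≤ C ∧ ∀ w r, ampNorm e 2 !![x, w; 0, y] ≤ r → ∀ t : ℝ,
      ampNorm e 2 !![x, w - (t : ℂ) • p; ((t * r ^ 2 : ℝ) : ℂ) • a, y] ^ 2 ≤
        r ^ 2 * (1 + C * t ^ 2 * r ^ 2) := by
  refine ⟨5 * ‖matrixOp !![0, 0; ι a, 0]‖ ^ 2, by positivity, fun w r hr t => ?_⟩
  rw [ampNorm_apply, ← amplify_comp_isometric h, amplify_apply] at hr ⊢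
  have hm : ∀ w' a', (!![x, w'; a', y]).map ι = !![ι x, ι w'; ι a', ι y] := by
    intro w' a'
    ext i j : 2
    fin_cases i <;> fin_cases j <;> rfl
  rw [hm, map_zero] at hr
  rw [hm, map_sub, map_smul, map_smul, hp]
  exact tangent_upper _ _ _ _ hr t

/-- Both structures give tangent estimates for one and the same norm on `M₂(E)`, with the same `x`,
`a`, `y`; this norm alone determines the product. -/
theorem isTROProduct_unique {H K E : Type u}
    [NormedAddCommGroup H] [InnerProductSpace ℂ H] [NormedAddCommGroup K] [InnerProductSpace ℂ K]
    [AddCommGroup E] [Module ℂ E] {e : E →ₗ[ℂ] (H →L[ℂ] K)} (he : Function.Injective e)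
    {m m' : E → E → E → E} (hm : IsTROProduct.{u, u} e m) (hm' : IsTROProduct.{u, v} e m') :
    m' = m := by
  obtain ⟨_, _, _, _, _, _, _, _, ι, hι, -, h⟩ := hm
  obtain ⟨_, _, _, _, _, _, _, _, ι', hι', -, h'⟩ := hm'
  funext x a y
  obtain ⟨C, hC, hC'⟩ := tangent_of_isometric hι (h x a y)
  obtain ⟨D, hD, hD'⟩ := tangent_of_isometric hι' (h' x a y)
  exact eq_of_tangent _ (ampNorm_eq_zero he) hD hC hD' hC'

/-! ### Completely contractive projections -/

theorem le_mul_of_sq_le_sq_mul {a r B : ℝ} (hr : 0 ≤ r) (hB : 0 ≤ B)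
    (h : a ^ 2 ≤ r ^ 2 * (1 + B)) : a ≤ r * (1 + B) := by
  refine le_of_sq_le_sq (h.trans ?_) (by positivity)
  rw [mul_pow]
  gcongr
  nlinarith

/-- The triangle inequality gives `t(‖X‖³ - ‖Y‖) ≤ O(t²)`; divide by `t` and let `t` tend to 0. -/
theorem pow_three_le_of_tangent {W : Type*} [NormedAddCommGroup W] [NormedSpace ℂ W] {X Y : W}
    (h : ∀ t : ℝ, 0 < t → ‖((1 + t * ‖X‖ ^ 2 : ℝ) : ℂ) • X - (t : ℂ) • Y‖ ≤
      ‖X‖ * (1 + 5 * ‖X‖ ^ 2 * t ^ 2 * ‖X‖ ^ 2)) : ‖X‖ ^ 3 ≤ ‖Y‖ := by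
  set r := ‖X‖
  have hr0 : 0 ≤ r := norm_nonneg X
  have key : ∀ t : ℝ, 0 < t →
      (1 + t * r ^ 2) * r - t * ‖Y‖ ≤ r * (1 + 5 * r ^ 2 * t ^ 2 * r ^ 2) := by
    intro t ht
    refine le_trans ?_ (h t ht)
    refine le_trans (le_of_eq ?_) (norm_sub_norm_le _ _)
    rw [norm_smul, norm_smul, Complex.norm_real, Complex.norm_real, Real.norm_of_nonneg ht.le,
      Real.norm_of_nonneg (by positivity)]
  by_contra! hlt
  set d := r ^ 3 - ‖Y‖ with hd
  have hd0 : 0 < d := by linarith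
  have h1 := key (d / (5 * r ^ 5 + 1)) (by positivity)
  have h2 : d / (5 * r ^ 5 + 1) * (5 * r ^ 5 + 1) = d := div_mul_cancel₀ _ (by positivity)
  set t := d / (5 * r ^ 5 + 1)
  have ht : 0 < t := by positivity
  have h3 : t * d ≤ t * (t * (5 * r ^ 5)) := by nlinarith
  have h4 := le_of_mul_le_mul_left h3 ht
  nlinarith

section Projection

variable {H : Type*} [NormedAddCommGroup H] [InnerProductSpace ℂ H] [CompleteSpace H]

/-- `Q` is a completely contractive projection of `M` onto `E`. -/
structure IsCCProjection (M : VonNeumannAlgebra H) (E : Submodule ℂ M.toStarSubalgebra)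
    (Q : M.toStarSubalgebra →ₗ[ℂ] M.toStarSubalgebra) : Prop where
  cc : IsCompletelyContractive (vnIncl M) (vnIncl M) Q
  mem : ∀ x, Q x ∈ E
  fix : ∀ x ∈ E, Q x = x

variable {M : VonNeumannAlgebra H} {E : Submodule ℂ M.toStarSubalgebra}
  {Q : M.toStarSubalgebra →ₗ[ℂ] M.toStarSubalgebra}

theorem vnIncl_ternary (x y z : M.toStarSubalgebra) :
    vnIncl M (x * star y * z) =
      vnIncl M x ∘L ContinuousLinearMap.adjoint (vnIncl M y) ∘L vnIncl M z := by
  rw [← ContinuousLinearMap.star_eq_adjoint]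
  change (x : H →L[ℂ] H) * star (y : H →L[ℂ] H) * (z : H →L[ℂ] H) = _
  rw [mul_assoc]
  rfl

theorem vnIncl_injective : Function.Injective (vnIncl M) := Subtype.val_injective

theorem amplify_map_le (hQ : IsCompletelyContractive (vnIncl M) (vnIncl M) Q) {n : ℕ}
    (x : Matrix (Fin n) (Fin n) M.toStarSubalgebra) :
    ‖amplify (vnIncl M) n (x.map Q)‖ ≤ ‖amplify (vnIncl M) n x‖ := hQ n x

/-- The inclusion of `E` in `B(H)`. -/
noncomputable def subIncl (M : VonNeumannAlgebra H) (E : Submodule ℂ M.toStarSubalgebra) :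
    E →ₗ[ℂ] (H →L[ℂ] H) := vnIncl M ∘ₗ E.subtype

theorem IsCCProjection.idem (hQ : IsCCProjection M E Q) (x : M.toStarSubalgebra) :
    Q (Q x) = Q x := hQ.fix _ (hQ.mem x)

/-- `Q` fixes `x`, `y`, `w` and contracts `M₂(M)`, so it pushes the tangent estimate for operators
down to `E`. There the lower left entry becomes `Q a`, while the corner is formed from `a` itself
before `Q` is applied. -/
theorem IsCCProjection.tangent (hQ : IsCCProjection M E Q) (x y : E) (a : M.toStarSubalgebra) :
    ∃ C : ℝ, 0 ≤ C ∧ ∀ w r, ampNorm (subIncl M E) 2 !![x, w; 0, y] ≤ r → ∀ t : ℝ,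
      ampNorm (subIncl M E) 2 !![x, w - (t : ℂ) • ⟨Q (x * star a * y), hQ.mem _⟩;
        ((t * r ^ 2 : ℝ) : ℂ) • ⟨Q a, hQ.mem a⟩, y] ^ 2 ≤ r ^ 2 * (1 + C * t ^ 2 * r ^ 2) := by
  refine ⟨5 * ‖matrixOp !![0, 0; vnIncl M a, 0]‖ ^ 2, by positivity, fun w r hr t => ?_⟩
  have h1 : amplify (subIncl M E) 2 !![x, w; 0, y] =
      matrixOp !![vnIncl M x, vnIncl M w; 0, vnIncl M y] := by
    rw [amplify_apply]
    congr 1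
    ext i j : 2
    fin_cases i <;> fin_cases j <;> rfl
  rw [ampNorm_apply, h1] at hr
  have h2 := tangent_upper _ _ _ (vnIncl M a) hr t
  refine le_trans ?_ h2
  have h3 : amplify (vnIncl M) 2 !![(x : M.toStarSubalgebra), w - (t : ℂ) • (x * star a * y);
        ((t * r ^ 2 : ℝ) : ℂ) • a, y] = matrixOp !![vnIncl M x, vnIncl M w -
        (t : ℂ) • (vnIncl M x ∘L ContinuousLinearMap.adjoint (vnIncl M a) ∘L vnIncl M y);
        ((t * r ^ 2 : ℝ) : ℂ) • vnIncl M a, vnIncl M y] := by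
    rw [amplify_apply, ← vnIncl_ternary]
    congr 1
    ext i j : 2
    fin_cases i <;> fin_cases j <;> rfl
  rw [← h3]
  gcongr
  refine le_trans (le_of_eq ?_) (amplify_map_le hQ.cc _)
  rw [ampNorm_apply, amplify_apply, amplify_apply]
  congr 2
  ext i j : 2
  fin_cases i <;> fin_cases j <;>
    simp [subIncl, hQ.fix _ x.2, hQ.fix _ y.2, hQ.fix _ w.2]

/-- The fields for `a` and for `Q a` have the same lower left entry after `Q` is applied, so
`eq_of_tangent` forces their corners to agree. -/
theorem IsCCProjection.map_mul_star_mul (hQ : IsCCProjection M E Q) {x y : M.toStarSubalgebra}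
    (hx : x ∈ E) (hy : y ∈ E) (a : M.toStarSubalgebra) :
    Q (x * star (Q a) * y) = Q (x * star a * y) := by
  obtain ⟨C, hC, hC'⟩ := hQ.tangent ⟨x, hx⟩ ⟨y, hy⟩ a
  obtain ⟨D, hD, hD'⟩ := hQ.tangent ⟨x, hx⟩ ⟨y, hy⟩ (Q a)
  simp only [hQ.idem] at hD'
  have := eq_of_tangent _ (ampNorm_eq_zero (e := subIncl M E)
    (vnIncl_injective.comp Subtype.val_injective)) hD hC hD' hC'
  exact congrArg Subtype.val this

/-- The ternary product that a projection `Q` onto `E` gives. -/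
noncomputable def IsCCProjection.ternary (hQ : IsCCProjection M E Q) (a b c : E) : E :=
  ⟨Q (a * star (b : M.toStarSubalgebra) * c), hQ.mem _⟩

/-- The ternary product of matrices over `E`. -/
noncomputable def IsCCProjection.matTernary (hQ : IsCCProjection M E Q) {n : ℕ}
    (x y z : Matrix (Fin n) (Fin n) E) : Matrix (Fin n) (Fin n) E :=
  .of fun i j => ∑ k, ∑ l, hQ.ternary (x i k) (y l k) (z l j)

/-- One inequality is contractivity of `Q`. For the other, apply `Q` to a step along the tangent
field `r²X - XX*X`: the result `(1 + tr²)X - tQ(XX*X)` has norm at most `r + O(t²)`, so `Q(XX*X)`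
must offset the radial growth `tr³`. -/
theorem IsCCProjection.norm_matTernary (hQ : IsCCProjection M E Q) {n : ℕ}
    (x : Matrix (Fin n) (Fin n) E) :
    ‖amplify (subIncl M E) n (hQ.matTernary x x x)‖ = ‖amplify (subIncl M E) n x‖ ^ 3 := by
  set X := amplify (subIncl M E) n x with hX
  set r := ‖X‖ with hr
  have hr0 : 0 ≤ r := norm_nonneg X
  let y : Matrix (Fin n) (Fin n) M.toStarSubalgebra := x.map Subtype.val
  let z : Matrix (Fin n) (Fin n) M.toStarSubalgebra :=
    .of fun i j => ∑ k, ∑ l, y i k * star (y l k) * y l j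
  have hyX : amplify (vnIncl M) n y = X := rfl
  have hz : amplify (vnIncl M) n z = X ∘L ContinuousLinearMap.adjoint X ∘L X := by
    rw [hX, amplify_apply, amplify_apply, matrixOp_ternary]
    congr 1
    ext i j : 2
    simp only [z, Matrix.map_apply, Matrix.of_apply, map_sum, vnIncl_ternary]
    rfl
  have hQz : amplify (vnIncl M) n (z.map Q) = amplify (subIncl M E) n (hQ.matTernary x x x) := by
    rw [amplify_apply, amplify_apply]
    congr 1
    ext i j : 2
    simp only [z, Matrix.map_apply, Matrix.of_apply, map_sum, IsCCProjection.matTernary, subIncl,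
      LinearMap.comp_apply, IsCCProjection.ternary]
    rfl
  have hQy : y.map Q = y := by
    ext i j : 2
    exact congrArg _ (hQ.fix _ (x i j).2)
  set Y := amplify (subIncl M E) n (hQ.matTernary x x x) with hY
  refine le_antisymm ?_ ?_
  · rw [← hQz]
    refine (amplify_map_le hQ.cc z).trans ?_
    rw [hz]
    refine (ContinuousLinearMap.opNorm_comp_le _ _).trans ?_
    have h1 := ContinuousLinearMap.opNorm_comp_le (ContinuousLinearMap.adjoint X) X
    rw [LinearIsometryEquiv.norm_map] at h1
    calc r * ‖ContinuousLinearMap.adjoint X ∘L X‖ ≤ r * (r * r) := by gcongr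
      _ = r ^ 3 := by ring
  · refine pow_three_le_of_tangent fun t ht => ?_
    have h1 := norm_sq_add_tangent_le X X le_rfl t
    have h3 : (y + (t : ℂ) • (((r : ℂ) ^ 2) • y - z)).map Q =
        ((1 + t * r ^ 2 : ℝ) : ℂ) • y - (t : ℂ) • z.map Q := by
      ext i j : 2
      have : Q (y i j) = y i j := hQ.fix _ (x i j).2
      simp only [Matrix.map_apply, Matrix.add_apply, Matrix.smul_apply, Matrix.sub_apply,
        map_add, map_smul, map_sub, this]
      push_cast
      module
    have h2 := amplify_map_le hQ.cc (y + (t : ℂ) • (((r : ℂ) ^ 2) • y - z))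
    rw [h3, map_sub, map_smul, map_smul, hQz, hyX, map_add, map_smul, map_sub, map_smul, hyX,
      hz] at h2
    refine h2.trans ?_
    refine le_mul_of_sq_le_sq_mul ?_ ?_ h1
    · exact hr0
    · positivity

end Projection

/-! ### Support functionals -/

theorem eq_zero_of_sq_le {d C : ℝ} (h : ∀ t : ℝ, (1 + t * d) ^ 2 ≤ 1 + C * t ^ 2) : d = 0 := by
  by_contra hd
  have hd2 : 0 < d ^ 2 := by positivity
  have hC : 0 ≤ C := by
    nlinarith [h 1, h (-1)]
  have h1 := h (d / (C + 1))
  have h2 : d / (C + 1) * (C + 1) = d := div_mul_cancel₀ _ (by positivity)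
  set t := d / (C + 1)
  have h3 : t * d = t ^ 2 * (C + 1) := by rw [sq, mul_assoc, h2]
  have ht : 0 < t ^ 2 := by
    have : t ≠ 0 := fun h0 => hd (by rw [← h2, h0, zero_mul])
    positivity
  nlinarith

theorem nonneg_of_sq_le {d C : ℝ} (h : ∀ t : ℝ, 0 ≤ t → (1 - t * d) ^ 2 ≤ 1 + C * t ^ 2) :
    0 ≤ d := by
  by_contra! hd
  have hC : 0 ≤ C := by nlinarith [h 1 zero_le_one]
  have h1 := h (-d / (C + 1)) (div_nonneg (by linarith) (by positivity))
  have h2 : -d / (C + 1) * (C + 1) = -d := div_mul_cancel₀ _ (by positivity)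
  set t := -d / (C + 1)
  have h3 : t * d = -(t ^ 2 * (C + 1)) := by rw [sq, mul_assoc, h2]; ring
  have ht : 0 < t ^ 2 := by
    have : t ≠ 0 := fun h0 => hd.ne (by linarith [h0 ▸ h2])
    positivity
  rw [h3] at h1
  nlinarith [mul_nonneg hC ht.le, sq_nonneg (t ^ 2 * (C + 1))]

section Support

variable {H : Type*} [NormedAddCommGroup H] [InnerProductSpace ℂ H] [CompleteSpace H]
  {M : VonNeumannAlgebra H} {E : Submodule ℂ M.toStarSubalgebra}
  {Q : M.toStarSubalgebra →ₗ[ℂ] M.toStarSubalgebra}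
  {F : StrongDual ℂ M.toStarSubalgebra} {u : M.toStarSubalgebra}

/-- A functional of norm at most one, invariant under `Q`, that attains its norm at `u ∈ E`. -/
structure IsSupport (E : Submodule ℂ M.toStarSubalgebra)
    (Q : M.toStarSubalgebra →ₗ[ℂ] M.toStarSubalgebra) (F : StrongDual ℂ M.toStarSubalgebra)
    (u : M.toStarSubalgebra) : Prop where
  norm_le : ‖F‖ ≤ 1
  map_proj : ∀ x, F (Q x) = F x
  mem : u ∈ E
  norm_le' : ‖u‖ ≤ 1
  map_eq : F u = 1

theorem IsSupport.norm_apply_le (h : IsSupport E Q F u) (x : M.toStarSubalgebra) :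
    ‖F x‖ ≤ ‖x‖ := by
  simpa using F.le_of_opNorm_le h.norm_le x

/-- Since `F` attains its norm at `u`, its real part has no first order change in a direction along
which the norm grows only quadratically. -/
theorem IsSupport.eq_zero_of_norm_sq_le (h : IsSupport E Q F u) {x : M.toStarSubalgebra} {C : ℝ}
    (hx : ∀ t : ℝ, ‖u + (t : ℂ) • x‖ ^ 2 ≤ 1 + C * t ^ 2) : (F x).re = 0 := by
  refine eq_zero_of_sq_le (C := C) fun t => le_trans ?_ (hx t)
  have h1 := h.norm_apply_le (u + (t : ℂ) • x)
  rw [map_add, h.map_eq, map_smul, smul_eq_mul] at h1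
  refine le_trans ?_ (pow_le_pow_left₀ (norm_nonneg _) h1 2)
  refine sq_le_sq' ?_ ?_
  · have := Complex.abs_re_le_norm (1 + t * F x)
    have h2 := neg_abs_le (1 + t * F x).re
    simp only [Complex.add_re, Complex.one_re, Complex.re_ofReal_mul] at this h2
    linarith
  · have := Complex.re_le_norm (1 + t * F x)
    simpa only [Complex.add_re, Complex.one_re, Complex.re_ofReal_mul] using this

/-- The direction `z - uu*z` is tangent at `u`; replacing `z` by `iz` handles the imaginary part. -/
theorem IsSupport.map_left (h : IsSupport E Q F u) (z : M.toStarSubalgebra) :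
    F (u * star u * z) = F z := by
  have key : ∀ z : M.toStarSubalgebra, (F (z - u * star u * z)).re = 0 := by
    intro z
    refine h.eq_zero_of_norm_sq_le (C := 5 * ‖z‖ ^ 2) fun t => ?_
    have := norm_sq_add_defect_le (vnIncl M u) (vnIncl M z) h.norm_le' t
    rwa [← vnIncl_ternary, ← map_sub, ← map_smul, ← map_add] at this
  refine (sub_eq_zero.1 ?_).symm
  rw [← map_sub]
  refine Complex.ext (key z) ?_
  have := key (Complex.I • z)
  rw [mul_smul_comm, ← smul_sub, map_smul, smul_eq_mul] at this
  simp only [Complex.mul_re, Complex.I_re, Complex.I_im, zero_mul, one_mul, zero_sub,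
    neg_eq_zero] at this
  exact this

theorem IsSupport.map_right (h : IsSupport E Q F u) (z : M.toStarSubalgebra) :
    F (z * star u * u) = F z := by
  have key : ∀ z : M.toStarSubalgebra, (F (z - z * star u * u)).re = 0 := by
    intro z
    refine h.eq_zero_of_norm_sq_le (C := 5 * ‖z‖ ^ 2) fun t => ?_
    have h0 : ‖star u‖ ≤ 1 := by rw [norm_star]; exact h.norm_le'
    have := norm_sq_add_defect_le (vnIncl M (star u)) (vnIncl M (star z)) h0 t
    rw [← vnIncl_ternary, ← map_sub, ← map_smul, ← map_add] at this
    change ‖star u + (t : ℂ) • (star z - star u * star (star u) * star z)‖ ^ 2 ≤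
      1 + 5 * ‖star z‖ ^ 2 * t ^ 2 at this
    rw [norm_star z, ← norm_star] at this
    simpa [mul_assoc] using this
  refine (sub_eq_zero.1 ?_).symm
  rw [← map_sub]
  refine Complex.ext (key z) ?_
  have := key (Complex.I • z)
  rw [smul_mul_assoc, smul_mul_assoc, ← smul_sub, map_smul, smul_eq_mul] at this
  simp only [Complex.mul_re, Complex.I_re, Complex.I_im, zero_mul, one_mul, zero_sub,
    neg_eq_zero] at this
  exact this

/-- The functional `x ↦ F(ux)` has norm at most one and takes the value 1 at the identity. If `x`
has nonnegative real part, then `‖1 - tx‖² ≤ 1 + O(t²)` for `t ≥ 0`, which rules out a negative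
first order term. -/
theorem IsSupport.re_nonneg (h : IsSupport E Q F u) {x : M.toStarSubalgebra}
    (hx : ∀ v : H, 0 ≤ (inner ℂ v ((x : H →L[ℂ] H) v)).re) : 0 ≤ (F (u * x)).re := by
  refine nonneg_of_sq_le (C := ‖x‖ ^ 2) fun t ht => ?_
  have h1 : ‖(1 : M.toStarSubalgebra) - (t : ℂ) • x‖ ^ 2 ≤ 1 + ‖x‖ ^ 2 * t ^ 2 := by
    refine (Real.le_sqrt (norm_nonneg _) (by positivity)).1 ?_
    change ‖(1 : H →L[ℂ] H) - (t : ℂ) • (x : H →L[ℂ] H)‖ ≤ _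
    refine ContinuousLinearMap.opNorm_le_bound _ (Real.sqrt_nonneg _) fun v => ?_
    refine le_of_sq_le_sq ?_ (by positivity)
    rw [mul_pow, Real.sq_sqrt (by positivity)]
    have h2 := @norm_sub_sq ℂ _ _ _ _ v ((t : ℂ) • (x : H →L[ℂ] H) v)
    rw [inner_smul_right, norm_smul, Complex.norm_real, mul_pow, Real.norm_eq_abs, sq_abs] at h2
    simp only [RCLike.re_to_complex, Complex.re_ofReal_mul] at h2
    rw [sub_apply, smul_apply, one_apply_eq_self, h2]
    have h3 := mul_nonneg ht (hx v)
    have h4 : ‖(x : H →L[ℂ] H) v‖ ^ 2 ≤ ‖x‖ ^ 2 * ‖v‖ ^ 2 := by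
      rw [← mul_pow]; gcongr; exact (x : H →L[ℂ] H).le_opNorm v
    nlinarith [sq_nonneg t]
  refine le_trans ?_ h1
  have h2 : ‖F (u * (1 - (t : ℂ) • x))‖ ≤ ‖(1 : M.toStarSubalgebra) - (t : ℂ) • x‖ :=
    (h.norm_apply_le _).trans ((norm_mul_le _ _).trans
      (mul_le_of_le_one_left (norm_nonneg _) h.norm_le'))
  refine le_trans ?_ (pow_le_pow_left₀ (norm_nonneg _) h2 2)
  rw [mul_sub, mul_one, mul_smul_comm, map_sub, map_smul, h.map_eq, smul_eq_mul]
  have h3 := Complex.abs_re_le_norm (1 - t * F (u * x))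
  rw [← sq_abs]
  refine pow_le_pow_left₀ (abs_nonneg _) ?_ 2
  simpa only [Complex.sub_re, Complex.one_re, Complex.re_ofReal_mul] using h3

theorem IsSupport.im_eq_zero (h : IsSupport E Q F u) {x : M.toStarSubalgebra} (hx : star x = x) :
    (F (u * x)).im = 0 := by
  have h1 : (F (u * (Complex.I • x))).re = 0 := by
    refine h.eq_zero_of_norm_sq_le (C := ‖x‖ ^ 2) fun t => ?_
    have h2 : u + (t : ℂ) • (u * (Complex.I • x)) =
        u * (1 + (t : ℂ) • (Complex.I • x)) := by
      rw [mul_add, mul_one, mul_smul_comm, mul_smul_comm, mul_smul_comm]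
    rw [h2]
    have h3 : ‖(1 : H →L[ℂ] H) + (t : ℂ) • (Complex.I • (x : H →L[ℂ] H))‖ ^ 2 ≤ _ :=
      norm_sq_add_smul_le (R := 0) (r := 1) ContinuousLinearMap.norm_id_le (fun v => by
        have hs : ContinuousLinearMap.adjoint (x : H →L[ℂ] H) = x :=
          congrArg Subtype.val hx
        have h4 : (inner ℂ v ((x : H →L[ℂ] H) v)).im = 0 := by
          rw [← Complex.conj_eq_iff_im, inner_conj_symm]
          conv_lhs => rw [← hs]
          rw [ContinuousLinearMap.adjoint_inner_left]
        simp [h4]) t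
    have h5 : ‖u * (1 + (t : ℂ) • (Complex.I • x))‖ ≤
        ‖(1 : H →L[ℂ] H) + (t : ℂ) • (Complex.I • (x : H →L[ℂ] H))‖ :=
      (norm_mul_le _ _).trans (mul_le_of_le_one_left (norm_nonneg _) h.norm_le')
    refine (pow_le_pow_left₀ (norm_nonneg _) h5 2).trans (h3.trans_eq ?_)
    rw [norm_zero, norm_smul, Complex.norm_I]
    change 1 ^ 2 + t ^ 2 * (1 ^ 2 * 0 ^ 2 + (1 * ‖x‖) ^ 2) = _
    ring
  rw [mul_smul_comm, map_smul, smul_eq_mul] at h1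
  simpa using h1

theorem IsSupport.map_mul_star (h : IsSupport E Q F u) (x : M.toStarSubalgebra) :
    F (u * star x) = (starRingEnd ℂ) (F (u * x)) := by
  have h1 := h.im_eq_zero (x := x + star x) (by rw [star_add, star_star, add_comm])
  have h2 := h.im_eq_zero (x := Complex.I • (x - star x)) (by
    rw [star_smul, star_sub, star_star, Complex.star_def, Complex.conj_I, neg_smul, ← smul_neg,
      neg_sub])
  rw [mul_add, map_add, Complex.add_im] at h1
  rw [mul_smul_comm, map_smul, smul_eq_mul, mul_sub, map_sub] at h2
  simp only [Complex.mul_im, Complex.I_re, Complex.I_im, Complex.sub_re, Complex.sub_im] at h2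
  refine Complex.ext ?_ ?_
  · rw [Complex.conj_re]; linarith
  · rw [Complex.conj_im]; linarith

theorem IsSupport.re_star_mul_self_nonneg (h : IsSupport E Q F u) (x : M.toStarSubalgebra) :
    0 ≤ (F (u * (star x * x))).re := by
  refine h.re_nonneg fun v => ?_
  change 0 ≤ (inner ℂ v (ContinuousLinearMap.adjoint (x : H →L[ℂ] H) ((x : H →L[ℂ] H) v))).re
  rw [ContinuousLinearMap.adjoint_inner_right]
  exact inner_self_nonneg (𝕜 := ℂ)

/-- Insert `uu*` on the left: `F(kd*e) = F(u(dk*u)*e)`. Here `dk*u` may be replaced by `Q(dk*u) =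
Q(d(Qk)*u) = 0`. -/
theorem IsSupport.map_mul_star_mul_eq_zero_left (hQ : IsCCProjection M E Q)
    (h : IsSupport E Q F u) {k d e : M.toStarSubalgebra} (hk : Q k = 0) (hd : d ∈ E) (he : e ∈ E) :
    F (k * star d * e) = 0 := by
  have h1 : Q (d * star k * u) = 0 := by
    rw [← hQ.map_mul_star_mul hd h.mem, hk]; simp
  have h2 := hQ.map_mul_star_mul h.mem he (d * star k * u)
  rw [h1, star_zero, mul_zero, zero_mul, map_zero] at h2
  rw [← h.map_left, ← h.map_proj]
  have h3 : u * star u * (k * star d * e) = u * star (d * star k * u) * e := by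
    simp [mul_assoc]
  rw [h3, ← h2, map_zero]

theorem IsSupport.map_mul_star_mul_eq_zero_right (hQ : IsCCProjection M E Q)
    (h : IsSupport E Q F u) {k d e : M.toStarSubalgebra} (hk : Q k = 0) (hd : d ∈ E) (he : e ∈ E) :
    F (e * star d * k) = 0 := by
  have h1 : Q (u * star k * d) = 0 := by
    rw [← hQ.map_mul_star_mul h.mem hd, hk]; simp
  have h2 := hQ.map_mul_star_mul he h.mem (u * star k * d)
  rw [h1, star_zero, mul_zero, zero_mul, map_zero] at h2
  rw [← h.map_right, ← h.map_proj]
  have h3 : e * star d * k * star u * u = e * star (u * star k * d) * u := by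
    simp [mul_assoc]
  rw [h3, ← h2, map_zero]

end Support

/-! ### Norms of columns -/

section Column

variable {H : Type*} [NormedAddCommGroup H] [InnerProductSpace ℂ H]

theorem norm_sq_column_le (x y : H →L[ℂ] H) (v : H) :
    ‖x v‖ ^ 2 + ‖y v‖ ^ 2 ≤ ‖matrixOp !![x, 0; y, 0]‖ ^ 2 * ‖v‖ ^ 2 := by
  have h1 := (matrixOp !![x, 0; y, 0]).le_opNorm (PiLp.single 2 0 v)
  have h2 : ‖matrixOp !![x, 0; y, 0] (PiLp.single 2 0 v)‖ ^ 2 = ‖x v‖ ^ 2 + ‖y v‖ ^ 2 := by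
    rw [PiLp.norm_sq_eq_of_L2, Fin.sum_univ_two, matrixOp_apply, matrixOp_apply,
      Fin.sum_univ_two, Fin.sum_univ_two]
    simp
  rw [PiLp.norm_single] at h1
  rw [← h2, ← mul_pow]
  exact pow_le_pow_left₀ (norm_nonneg _) h1 2

theorem norm_column_sq_le {x y : H →L[ℂ] H} {C : ℝ} (hC : 0 ≤ C)
    (h : ∀ v, ‖x v‖ ^ 2 + ‖y v‖ ^ 2 ≤ C * ‖v‖ ^ 2) : ‖matrixOp !![x, 0; y, 0]‖ ≤ √C := by
  refine ContinuousLinearMap.opNorm_le_bound _ (Real.sqrt_nonneg _) fun v => ?_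
  refine le_of_sq_le_sq ?_ (by positivity)
  rw [mul_pow, Real.sq_sqrt hC]
  have h2 : ‖matrixOp !![x, 0; y, 0] v‖ ^ 2 = ‖x (v 0)‖ ^ 2 + ‖y (v 0)‖ ^ 2 := by
    rw [PiLp.norm_sq_eq_of_L2, Fin.sum_univ_two, matrixOp_apply, matrixOp_apply,
      Fin.sum_univ_two, Fin.sum_univ_two]
    simp
  rw [h2]
  refine (h _).trans ?_
  gcongr
  exact PiLp.norm_apply_le v 0

variable [CompleteSpace H]

/-- A curve of columns starting at `u` in the direction of `w` with norm one up to fourth order. -/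
theorem norm_column_curve_le {u : H →L[ℂ] H} (hu : ‖u‖ ≤ 1) (w : H →L[ℂ] H) :
    ‖matrixOp !![u - (2⁻¹ : ℂ) • (u ∘L ContinuousLinearMap.adjoint w ∘L w), 0; w, 0]‖ ≤
      √(1 + 4⁻¹ * ‖w‖ ^ 4) := by
  refine norm_column_sq_le (by positivity) fun v => ?_
  set p := ContinuousLinearMap.adjoint w (w v) with hp
  have h1 : (u - (2⁻¹ : ℂ) • (u ∘L ContinuousLinearMap.adjoint w ∘L w)) v =
      u (v - (2⁻¹ : ℂ) • p) := by
    simp [hp]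
  have h2 : ‖u (v - (2⁻¹ : ℂ) • p)‖ ^ 2 ≤ ‖v - (2⁻¹ : ℂ) • p‖ ^ 2 := by
    gcongr
    have := u.le_of_opNorm_le hu (v - (2⁻¹ : ℂ) • p)
    rwa [one_mul] at this
  have h3 : ‖v - (2⁻¹ : ℂ) • p‖ ^ 2 = ‖v‖ ^ 2 - ‖w v‖ ^ 2 + 4⁻¹ * ‖p‖ ^ 2 := by
    rw [@norm_sub_sq ℂ, inner_smul_right, hp, ContinuousLinearMap.adjoint_inner_right,
      inner_self_eq_norm_sq_to_K, norm_smul]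
    norm_num [← Complex.ofReal_pow]
    ring
  have h4 : ‖p‖ ≤ ‖w‖ ^ 2 * ‖v‖ := by
    calc ‖p‖ ≤ ‖ContinuousLinearMap.adjoint w‖ * (‖w‖ * ‖v‖) :=
          (ContinuousLinearMap.le_opNorm _ _).trans (by gcongr; exact w.le_opNorm v)
      _ = ‖w‖ ^ 2 * ‖v‖ := by rw [LinearIsometryEquiv.norm_map]; ring
  have h5 : ‖p‖ ^ 2 ≤ ‖w‖ ^ 4 * ‖v‖ ^ 2 := by
    calc ‖p‖ ^ 2 ≤ (‖w‖ ^ 2 * ‖v‖) ^ 2 := by gcongr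
      _ = ‖w‖ ^ 4 * ‖v‖ ^ 2 := by ring
  rw [h1]
  linarith

end Column

/-! ### Weak* continuity of the ternary product -/

section Normality

variable {H : Type*} [NormedAddCommGroup H] [InnerProductSpace ℂ H] [CompleteSpace H]
  {M : VonNeumannAlgebra H} {E : Submodule ℂ M.toStarSubalgebra}
  {Q : M.toStarSubalgebra →ₗ[ℂ] M.toStarSubalgebra}
  {F : StrongDual ℂ M.toStarSubalgebra} {u : M.toStarSubalgebra}

/-- Convergence in the weak operator topology. -/
def WeakOpTendsto {T : Type*} (z : T → M.toStarSubalgebra) (l : Filter T)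
    (x : M.toStarSubalgebra) : Prop :=
  ∀ ξ η : H, Tendsto (fun t => inner ℂ η ((z t : H →L[ℂ] H) ξ)) l
    (𝓝 (inner ℂ η ((x : H →L[ℂ] H) ξ)))

/-- Positivity of `x ↦ F(ux)` is applied twice: to `ρ - y*y - b*b`, and to `(y - u)*(y - u)`, which
bounds `F(uy*y)` below by `2 Re F(y) - 1`. -/
theorem IsSupport.column_bound (h : IsSupport E Q F u) {y b : M.toStarSubalgebra} {ρ : ℝ}
    (hρ : ‖matrixOp !![vnIncl M y, 0; vnIncl M b, 0]‖ ^ 2 ≤ ρ) :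
    2 * (F y).re + (F (u * (star b * b))).re ≤ ρ + 1 := by
  have h1 := h.re_nonneg (x := (ρ : ℂ) • 1 - star y * y - star b * b) fun v => by
    change 0 ≤ (inner ℂ v ((ρ : ℂ) • v -
      ContinuousLinearMap.adjoint (vnIncl M y) (vnIncl M y v) -
      ContinuousLinearMap.adjoint (vnIncl M b) (vnIncl M b v))).re
    rw [inner_sub_right, inner_sub_right, ContinuousLinearMap.adjoint_inner_right,
      ContinuousLinearMap.adjoint_inner_right, inner_smul_right, inner_self_eq_norm_sq_to_K,
      inner_self_eq_norm_sq_to_K, inner_self_eq_norm_sq_to_K]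
    have h2 := norm_sq_column_le (vnIncl M y) (vnIncl M b) v
    have h3 : ‖matrixOp !![vnIncl M y, 0; vnIncl M b, 0]‖ ^ 2 * ‖v‖ ^ 2 ≤ ρ * ‖v‖ ^ 2 := by
      gcongr
    simp only [Complex.sub_re, Complex.coe_algebraMap, ← Complex.ofReal_pow, ← Complex.ofReal_mul,
      Complex.ofReal_re]
    linarith
  have h2 := h.re_star_mul_self_nonneg (y - u)
  have h3 : F (u * star u * y) = F y := h.map_left y
  have h4 : F (u * (star y * u)) = (starRingEnd ℂ) (F y) := by
    rw [← h3, mul_assoc, ← h.map_mul_star, star_mul, star_star]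
  have h5 : F (u * star u * u) = 1 := by rw [h.map_left, h.map_eq]
  rw [star_sub, sub_mul, mul_sub, mul_sub, mul_sub, mul_sub, mul_sub, map_sub, map_sub, map_sub, h4,
    ← mul_assoc u (star u) y, ← mul_assoc u (star u) u, h3, h5] at h2
  rw [mul_sub, mul_sub, mul_smul_comm, mul_one, map_sub, map_sub, map_smul, h.map_eq] at h1
  simp at h1 h2
  linarith

/-- With weights `s` and `s²` the cross term `F(ub*a)` is isolated at order `s³`, above the fourth
order errors of the column curve. -/
theorem IsSupport.map_ternary_add (h : IsSupport E Q F u) (b a : M.toStarSubalgebra) (s : ℝ) (c : ℂ) :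
    (F (u * star ((s : ℂ) • b + ((s ^ 2 : ℝ) * c) • a) * ((s : ℂ) • b + ((s ^ 2 : ℝ) * c) • a))).re =
      s ^ 2 * (F (u * (star b * b))).re + 2 * s ^ 3 * (c * F (u * star b * a)).re +
      s ^ 4 * Complex.normSq c * (F (u * (star a * a))).re := by
  have h1 : F (u * (star a * b)) = (starRingEnd ℂ) (F (u * star b * a)) := by
    rw [mul_assoc, ← h.map_mul_star, star_mul, star_star]
  have h2 : u * star ((s : ℂ) • b + ((s ^ 2 : ℝ) * c) • a) * ((s : ℂ) • b + ((s ^ 2 : ℝ) * c) • a) =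
      ((s ^ 2 : ℝ) : ℂ) • (u * (star b * b)) + (((s ^ 3 : ℝ) : ℂ) * c) • (u * star b * a) +
      (((s ^ 3 : ℝ) : ℂ) * (starRingEnd ℂ) c) • (u * (star a * b)) +
      (((s ^ 4 : ℝ) : ℂ) * ((starRingEnd ℂ) c * c)) • (u * (star a * a)) := by
    simp only [star_add, star_smul, mul_add, add_mul, smul_mul_assoc, mul_smul_comm,
      Complex.star_def, map_mul, Complex.conj_ofReal, mul_assoc]
    push_cast
    module
  rw [h2]
  simp only [map_add, map_smul, smul_eq_mul, h1, ← Complex.normSq_eq_conj_mul_self, mul_assoc,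
    ← map_mul, Complex.add_re, Complex.re_ofReal_mul, Complex.conj_re]
  ring

theorem re_map_star_smul_mul_smul (F : StrongDual ℂ M.toStarSubalgebra) (u b : M.toStarSubalgebra)
    (s : ℝ) :
    (F (u * (star ((s : ℂ) • b) * ((s : ℂ) • b)))).re = s ^ 2 * (F (u * (star b * b))).re := by
  have : u * (star ((s : ℂ) • b) * ((s : ℂ) • b)) = ((s ^ 2 : ℝ) : ℂ) • (u * (star b * b)) := by
    simp only [star_smul, smul_mul_assoc, mul_smul_comm, smul_smul, Complex.star_def,
      Complex.conj_ofReal]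
    push_cast
    rw [sq]
  rw [this, map_smul, smul_eq_mul, Complex.re_ofReal_mul]

theorem norm_map_le_of_cc (hQ : IsCompletelyContractive (vnIncl M) (vnIncl M) Q)
    (x : M.toStarSubalgebra) : ‖Q x‖ ≤ ‖x‖ := by
  have h1 := norm_entry_le_norm_matrixOp ((Matrix.of fun _ _ : Fin 1 => Q x).map (vnIncl M)) 0 0
  have h2 := norm_matrixOp_le_sum ((Matrix.of fun _ _ : Fin 1 => x).map (vnIncl M))
  have h3 := amplify_map_le hQ (Matrix.of fun _ _ : Fin 1 => x)
  refine h1.trans (h3.trans (h2.trans_eq ?_))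
  rw [Fin.sum_univ_one, Fin.sum_univ_one]
  rfl

/-- The columns with entries `u - ½Q(uwₜ*wₜ)` and `wₜ` are images under `Q` of points of the column
curve. Weak lower semicontinuity carries their norm bound to the limit; `z` need not be `Q(uw₀*w₀)`,
and no continuity of `Q` enters. -/
theorem IsSupport.norm_column_limit_le (h : IsSupport E Q F u) (hQ : IsCCProjection M E Q)
    {T : Type*} {l : Filter T} [NeBot l] {w : T → M.toStarSubalgebra} {w₀ z : M.toStarSubalgebra}
    {r : ℝ} (hw : ∀ t, w t ∈ E) (hwr : ∀ t, ‖w t‖ ≤ r) (hwl : WeakOpTendsto w l w₀)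
    (hzl : WeakOpTendsto (fun t => Q (u * star (w t) * w t)) l z) :
    ‖matrixOp !![vnIncl M (u - (2⁻¹ : ℂ) • z), 0; vnIncl M w₀, 0]‖ ≤ √(1 + 4⁻¹ * r ^ 4) := by
  refine norm_matrixOp_le_of_tendsto (l := l) (x := fun t =>
    !![vnIncl M (u - (2⁻¹ : ℂ) • Q (u * star (w t) * w t)), 0; vnIncl M (w t), 0])
    (.of_forall fun t => ?_) fun i j ξ η => ?_
  · have h1 := amplify_map_le hQ.cc
      !![u - (2⁻¹ : ℂ) • (u * star (w t) * w t), 0; w t, 0]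
    have h2 : amplify (vnIncl M) 2 (!![u - (2⁻¹ : ℂ) • (u * star (w t) * w t), 0; w t, 0].map Q) =
        matrixOp !![vnIncl M (u - (2⁻¹ : ℂ) • Q (u * star (w t) * w t)), 0;
          vnIncl M (w t), 0] := by
      rw [amplify_apply]
      congr 1
      ext i j : 2
      fin_cases i <;> fin_cases j <;> simp [hQ.fix _ h.mem, hQ.fix _ (hw t)]
    have h3 : amplify (vnIncl M) 2 !![u - (2⁻¹ : ℂ) • (u * star (w t) * w t), 0; w t, 0] =
        matrixOp !![vnIncl M u - (2⁻¹ : ℂ) • (vnIncl M u ∘L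
          ContinuousLinearMap.adjoint (vnIncl M (w t)) ∘L vnIncl M (w t)), 0;
          vnIncl M (w t), 0] := by
      rw [amplify_apply, ← vnIncl_ternary]
      congr 1
      ext i j : 2
      fin_cases i <;> fin_cases j <;> simp
    rw [h2, h3] at h1
    refine h1.trans ((norm_column_curve_le h.norm_le' _).trans ?_)
    refine Real.sqrt_le_sqrt ?_
    have h4 : ‖vnIncl M (w t)‖ ^ 4 ≤ r ^ 4 := pow_le_pow_left₀ (norm_nonneg _) (hwr t) 4
    linarith
  · fin_cases i <;> fin_cases j
    · change Tendsto (fun t => inner ℂ η ((u : H →L[ℂ] H) ξ - (2⁻¹ : ℂ) •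
        (Q (u * star (w t) * w t) : H →L[ℂ] H) ξ)) l
        (𝓝 (inner ℂ η ((u : H →L[ℂ] H) ξ - (2⁻¹ : ℂ) • (z : H →L[ℂ] H) ξ)))
      simp only [inner_sub_right, inner_smul_right]
      exact ((hzl ξ η).const_mul _).const_sub _
    · exact tendsto_const_nhds
    · exact hwl ξ η
    · exact tendsto_const_nhds

/-- The forms `(b, a) ↦ F(u b* a)` on `E` are weak* continuous in `a`. -/
theorem IsSupport.tendsto_left (hQ : IsCCProjection M E Q) (h : IsSupport E Q F u) {T : Type*}
    {l : Ultrafilter T}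
    (hE : ∀ (z : T → M.toStarSubalgebra) (C : ℝ), (∀ t, z t ∈ E) → (∀ t, ‖z t‖ ≤ C) →
      ∃ x ∈ E, WeakOpTendsto z l x)
    (hF : ∀ (z : T → M.toStarSubalgebra) (C : ℝ) (x : M.toStarSubalgebra), (∀ t, z t ∈ E) →
      (∀ t, ‖z t‖ ≤ C) → x ∈ E → WeakOpTendsto z l x → Tendsto (fun t => F (z t)) l (𝓝 (F x)))
    {b : M.toStarSubalgebra} (hb : b ∈ E) {a : T → M.toStarSubalgebra} (ha : ∀ t, a t ∈ E)
    (ha1 : ∀ t, ‖a t‖ ≤ 1) (ha0 : WeakOpTendsto a l 0) :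
    Tendsto (fun t => F (u * star b * a t)) l (𝓝 0) := by
  wlog hb1 : ‖b‖ ≤ 1 generalizing b
  · have h1 := this (b := ((‖b‖ : ℂ)⁻¹) • b) (E.smul_mem _ hb) (by
      rw [norm_smul, norm_inv, Complex.norm_real, norm_norm]; exact inv_mul_le_one)
    have h2 := h1.const_mul (‖b‖ : ℂ)
    rw [mul_zero] at h2
    refine h2.congr fun t => ?_
    have hb0 : (‖b‖ : ℂ) ≠ 0 := by
      have : 0 < ‖b‖ := zero_lt_one.trans (not_le.1 hb1)
      exact_mod_cast this.ne'
    rw [star_smul, mul_smul_comm, smul_mul_assoc, map_smul, smul_eq_mul, star_inv₀,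
      Complex.star_def, Complex.conj_ofReal, mul_inv_cancel_left₀ hb0]
  have hbd : ∀ t, ‖F (u * star b * a t)‖ ≤ 1 := by
    intro t
    refine (h.norm_apply_le _).trans ((norm_mul_le _ _).trans ?_)
    refine mul_le_one₀ ((norm_mul_le _ _).trans ?_) (norm_nonneg _) (ha1 t)
    exact mul_le_one₀ h.norm_le' (norm_nonneg _) (by rwa [norm_star])
  obtain ⟨lam, -, hlam⟩ := (isCompact_closedBall (0 : ℂ) 1).ultrafilter_le_nhds
    (l.map fun t => F (u * star b * a t)) (by
      refine Filter.le_principal_iff.2 (Filter.mem_map.2 (Filter.univ_mem' fun t => ?_))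
      simpa using hbd t)
  replace hlam : Tendsto (fun t => F (u * star b * a t)) l (𝓝 lam) := hlam
  suffices hl0 : lam = 0 by rwa [hl0] at hlam
  -- The phase `c` gives the cross term a definite sign.
  obtain ⟨c, hc1, hc⟩ : ∃ c : ℂ, ‖c‖ = 1 ∧ c * lam = -(‖lam‖ : ℂ) := by
    by_cases h0 : lam = 0
    · exact ⟨1, by simp, by simp [h0]⟩
    · have : (‖lam‖ : ℂ) ≠ 0 := by simpa using h0
      refine ⟨-((starRingEnd ℂ) lam / ‖lam‖), ?_, ?_⟩
      · simp [h0]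
      · rw [neg_mul, div_mul_eq_mul_div, Complex.conj_mul', sq, mul_div_assoc, div_self this,
          mul_one]
  -- The perturbation `s²c aₜ` of `sb` vanishes in the weak limit of `wₜ`, but leaves `-2s³‖lam‖` in
  -- `F z`. Since `‖wₜ‖ ≤ 2s`, the limit column has squared norm at most `1 + 4s⁴`, and
  -- `column_bound` gives `s² Re F(ub*b) - Re F(z) ≤ 4s⁴`. With the term `s⁴` from `aₜ*aₜ` this
  -- yields `2s³‖lam‖ ≤ 5s⁴`.
  have key : ∀ s : ℝ, 0 < s → s ≤ 1 → ‖lam‖ ≤ 5 / 2 * s := by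
    intro s hs hs1
    let w : T → M.toStarSubalgebra := fun t => (s : ℂ) • b + ((s ^ 2 : ℝ) * c) • a t
    have hw : ∀ t, w t ∈ E := fun t => E.add_mem (E.smul_mem _ hb) (E.smul_mem _ (ha t))
    have hwn : ∀ t, ‖w t‖ ≤ 2 * s := by
      intro t
      refine (norm_add_le _ _).trans ?_
      rw [norm_smul, norm_smul, norm_mul, Complex.norm_real, Complex.norm_real, hc1,
        Real.norm_of_nonneg hs.le, Real.norm_of_nonneg (by positivity)]
      nlinarith [ha1 t, norm_nonneg b, norm_nonneg (a t)]
    have hwl : WeakOpTendsto w l ((s : ℂ) • b) := by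
      intro ξ η
      have h1 := (ha0 ξ η).const_mul (((s ^ 2 : ℝ) : ℂ) * c)
      have h2 := h1.const_add (inner ℂ η (((s : ℂ) • b : M.toStarSubalgebra).1 ξ))
      have h3 : (((0 : M.toStarSubalgebra) : H →L[ℂ] H) ξ) = 0 := rfl
      rw [h3, inner_zero_right, mul_zero, add_zero] at h2
      refine h2.congr fun t => ?_
      change _ = inner ℂ η (((s : ℂ) • b : M.toStarSubalgebra).1 ξ +
        (((s ^ 2 : ℝ) : ℂ) * c) • ((a t).1 ξ))
      rw [inner_add_right, inner_smul_right]
    have hz : ∀ t, ‖Q (u * star (w t) * w t)‖ ≤ 4 := by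
      intro t
      refine (norm_map_le_of_cc hQ.cc _).trans ((norm_mul_le _ _).trans ?_)
      have h1 : ‖u * star (w t)‖ ≤ 2 := by
        refine (norm_mul_le _ _).trans ?_
        rw [norm_star]
        nlinarith [hwn t, h.norm_le', norm_nonneg (w t), norm_nonneg u]
      nlinarith [hwn t, norm_nonneg (w t), norm_nonneg (u * star (w t))]
    obtain ⟨z, hzE, hzl⟩ := hE (fun t => Q (u * star (w t) * w t)) 4 (fun t => hQ.mem _) hz
    have hFz := hF _ 4 z (fun t => hQ.mem _) hz hzE hzl
    simp only [h.map_proj] at hFz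
    have hre : (F z).re ≤ s ^ 2 * (F (u * (star b * b))).re - 2 * s ^ 3 * ‖lam‖ + s ^ 4 := by
      have h1 : Tendsto (fun t => (F (u * star (w t) * w t)).re) l (𝓝 (F z).re) :=
        (Complex.continuous_re.tendsto _).comp hFz
      have h2 : Tendsto (fun t => s ^ 2 * (F (u * (star b * b))).re +
          2 * s ^ 3 * (c * F (u * star b * a t)).re + s ^ 4) l
          (𝓝 (s ^ 2 * (F (u * (star b * b))).re + 2 * s ^ 3 * (c * lam).re + s ^ 4)) :=
        ((((Complex.continuous_re.tendsto _).comp (hlam.const_mul c)).const_mul _).const_add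
          _).add_const _
      rw [hc, Complex.neg_re, Complex.ofReal_re] at h2
      refine (le_of_tendsto_of_tendsto' h1 h2 fun t => ?_).trans_eq (by ring)
      rw [h.map_ternary_add]
      have h3 : (F (u * (star (a t) * a t))).re ≤ 1 := by
        refine (Complex.re_le_norm _).trans ((h.norm_apply_le _).trans ((norm_mul_le _ _).trans ?_))
        refine mul_le_one₀ h.norm_le' (norm_nonneg _) ((norm_mul_le _ _).trans ?_)
        exact mul_le_one₀ (by rw [norm_star]; exact ha1 t) (norm_nonneg _) (ha1 t)
      rw [Complex.normSq_eq_norm_sq, hc1]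
      have : 0 < s ^ 4 := by positivity
      nlinarith
    have hcol := h.norm_column_limit_le hQ hw hwn hwl hzl
    have h1 := h.column_bound ((Real.le_sqrt (norm_nonneg _) (by positivity)).1 hcol)
    have h2 := re_map_star_smul_mul_smul F u b s
    have h3 : (F (u - (2⁻¹ : ℂ) • z)).re = 1 - 2⁻¹ * (F z).re := by
      rw [map_sub, map_smul, h.map_eq]
      simp
    rw [h2, h3] at h1
    have h4 : s ^ 3 * ‖lam‖ ≤ s ^ 3 * (5 / 2 * s) := by nlinarith
    exact le_of_mul_le_mul_left h4 (by positivity)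
  by_contra hne
  have hpos : 0 < ‖lam‖ := norm_pos_iff.2 hne
  have h1 := key (min 1 (‖lam‖ / 5)) (by positivity) (min_le_left _ _)
  have h2 := min_le_right 1 (‖lam‖ / 5)
  linarith

end Normality

theorem eq_zero_or_exists_norm_eq_one {H E : Type*} [NormedAddCommGroup H] [InnerProductSpace ℂ H]
    [NormedAddCommGroup E] [NormedSpace ℂ E] (e : E →ₗᵢ[ℂ] (H →L[ℂ] H)) {f : StrongDual ℂ E}
    (hf : f ∈ predual e) : (∀ x, f x = 0) ∨ ∃ (r : ℂ) (g : StrongDual ℂ E),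
      g ∈ predual e ∧ ‖g‖ = 1 ∧ ∀ x, f x = r * g x := by
  by_cases h : f = 0
  · exact Or.inl fun x => by rw [h]; rfl
  have h0 : ‖f‖ ≠ 0 := norm_ne_zero_iff.2 h
  have h0' : (‖f‖ : ℂ) ≠ 0 := by exact_mod_cast h0
  refine Or.inr ⟨‖f‖, (‖f‖ : ℂ)⁻¹ • f, Submodule.smul_mem _ _ hf, ?_, fun x => ?_⟩
  · rw [norm_smul, norm_inv, Complex.norm_real, norm_norm, inv_mul_cancel₀ h0]
  · rw [smul_apply, smul_eq_mul, mul_inv_cancel_left₀ h0']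

/-! ### Adjoints, and weak* continuous functionals on the range -/

section Normality

variable {H : Type*} [NormedAddCommGroup H] [InnerProductSpace ℂ H] [CompleteSpace H]
  {M : VonNeumannAlgebra H} {E : Submodule ℂ M.toStarSubalgebra}
  {Q : M.toStarSubalgebra →ₗ[ℂ] M.toStarSubalgebra}
  {F : StrongDual ℂ M.toStarSubalgebra} {u : M.toStarSubalgebra}

/-- The map `x ↦ Q(x*)*`. -/
noncomputable def starConj (Q : M.toStarSubalgebra →ₗ[ℂ] M.toStarSubalgebra) :
    M.toStarSubalgebra →ₗ[ℂ] M.toStarSubalgebra where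
  toFun x := star (Q (star x))
  map_add' x y := by simp
  map_smul' c x := by simp

/-- The functional `x ↦ conj F(x*)`. -/
noncomputable def starDual (F : StrongDual ℂ M.toStarSubalgebra) :
    StrongDual ℂ M.toStarSubalgebra :=
  LinearMap.mkContinuous
    { toFun := fun x => (starRingEnd ℂ) (F (star x))
      map_add' := fun x y => by simp
      map_smul' := fun c x => by simp } ‖F‖ fun x => by
    simpa using F.le_opNorm (star x)

theorem starDual_apply (x : M.toStarSubalgebra) :
    starDual F x = (starRingEnd ℂ) (F (star x)) := rfl

/-- The space of adjoints of elements of `E`. -/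
def starSub (E : Submodule ℂ M.toStarSubalgebra) : Submodule ℂ M.toStarSubalgebra where
  carrier := {x | star x ∈ E}
  add_mem' {x y} hx hy := by
    simpa using E.add_mem hx hy
  zero_mem' := by simp
  smul_mem' c x hx := by
    simpa using E.smul_mem (star c) hx

theorem mem_starSub {x : M.toStarSubalgebra} : x ∈ starSub E ↔ star x ∈ E := Iff.rfl

theorem norm_amplify_conjTranspose {n : ℕ} (x : Matrix (Fin n) (Fin n) M.toStarSubalgebra) :
    ‖amplify (vnIncl M) n x.conjTranspose‖ = ‖amplify (vnIncl M) n x‖ := by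
  rw [amplify_apply, amplify_apply, ← LinearIsometryEquiv.norm_map ContinuousLinearMap.adjoint
    (matrixOp (x.map (vnIncl M))), adjoint_matrixOp]
  rfl

/-- Adjoints exchange left and right multiplication, so that a one-sided result about `Q` and its
support functionals yields its mirror image. -/
theorem IsCCProjection.starConj (hQ : IsCCProjection M E Q) :
    IsCCProjection M (starSub E) (starConj Q) where
  cc n x := by
    have h1 := amplify_map_le hQ.cc x.conjTranspose
    rw [norm_amplify_conjTranspose, ← norm_amplify_conjTranspose] at h1
    exact h1
  mem x := by
    rw [mem_starSub]
    change star (star (Q (star x))) ∈ E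
    rw [star_star]
    exact hQ.mem _
  fix x hx := by
    change star (Q (star x)) = x
    rw [hQ.fix _ hx, star_star]

theorem IsSupport.starDual (h : IsSupport E Q F u) :
    IsSupport (starSub E) (starConj Q) (starDual F) (star u) where
  norm_le := (LinearMap.mkContinuous_norm_le _ (norm_nonneg _) _).trans h.norm_le
  map_proj x := by
    rw [starDual_apply, starDual_apply]
    change (starRingEnd ℂ) (F (star (star (Q (star x))))) = _
    rw [star_star, h.map_proj]
  mem := by
    rw [mem_starSub, star_star]
    exact h.mem
  norm_le' := by rw [norm_star]; exact h.norm_le'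
  map_eq := by rw [starDual_apply, star_star, h.map_eq, map_one]

theorem WeakOpTendsto.star_right {T : Type*} {z : T → M.toStarSubalgebra} {l : Filter T}
    {x : M.toStarSubalgebra} (h : WeakOpTendsto z l x) :
    WeakOpTendsto (fun t => star (z t)) l (star x) := by
  intro ξ η
  have h1 : ∀ y : M.toStarSubalgebra, inner ℂ η (((star y : M.toStarSubalgebra) : H →L[ℂ] H) ξ) =
      (starRingEnd ℂ) (inner ℂ ξ ((y : H →L[ℂ] H) η)) := by
    intro y
    change inner ℂ η (ContinuousLinearMap.adjoint (y : H →L[ℂ] H) ξ) = _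
    rw [ContinuousLinearMap.adjoint_inner_right, inner_conj_symm]
  simp only [h1]
  exact (Complex.continuous_conj.tendsto _).comp (h η ξ)

/-- The forms `(b, a) ↦ F(a b* u)` on `E` are weak* continuous in `a`. -/
theorem IsSupport.tendsto_right (hQ : IsCCProjection M E Q) (h : IsSupport E Q F u) {T : Type*}
    {l : Ultrafilter T}
    (hE : ∀ (z : T → M.toStarSubalgebra) (C : ℝ), (∀ t, z t ∈ E) → (∀ t, ‖z t‖ ≤ C) →
      ∃ x ∈ E, WeakOpTendsto z l x)
    (hF : ∀ (z : T → M.toStarSubalgebra) (C : ℝ) (x : M.toStarSubalgebra), (∀ t, z t ∈ E) →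
      (∀ t, ‖z t‖ ≤ C) → x ∈ E → WeakOpTendsto z l x → Tendsto (fun t => F (z t)) l (𝓝 (F x)))
    {b : M.toStarSubalgebra} (hb : b ∈ E) {a : T → M.toStarSubalgebra} (ha : ∀ t, a t ∈ E)
    (ha1 : ∀ t, ‖a t‖ ≤ 1) (ha0 : WeakOpTendsto a l 0) :
    Tendsto (fun t => F (a t * star b * u)) l (𝓝 0) := by
  have h1 := h.starDual.tendsto_left hQ.starConj (l := l) (fun z C hz hC => by
      obtain ⟨x, hx, hzx⟩ := hE (fun t => star (z t)) C hz (fun t => by rw [norm_star]; exact hC t)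
      exact ⟨star x, by rwa [mem_starSub, star_star], by simpa using hzx.star_right⟩)
    (fun z C x hz hC hx hzx => (Complex.continuous_conj.tendsto _).comp
      (hF (fun t => star (z t)) C (star x) hz (fun t => by rw [norm_star]; exact hC t) hx hzx.star_right))
    (b := star b) (by rwa [mem_starSub, star_star]) (a := fun t => star (a t))
    (fun t => by rw [mem_starSub, star_star]; exact ha t)
    (fun t => by rw [norm_star]; exact ha1 t) (by simpa using ha0.star_right)
  have h2 := (Complex.continuous_conj.tendsto _).comp h1
  rw [map_zero] at h2
  refine h2.congr fun t => ?_
  simp [starDual_apply, mul_assoc]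

/-- The isometric inclusion of `E` in `B(H)`. -/
noncomputable def subInclIso (M : VonNeumannAlgebra H) (E : Submodule ℂ M.toStarSubalgebra) :
    E →ₗᵢ[ℂ] (H →L[ℂ] H) := ⟨subIncl M E, fun _ => rfl⟩

theorem subInclIso_apply (a : E) : subInclIso M E a = vnIncl M a := rfl

/-- Restrictions to `E` of weak* continuous functionals. -/
def IsNormalFun (E : Submodule ℂ M.toStarSubalgebra) (φ : E → ℂ) : Prop :=
  ∃ c : VecSum H, ∀ a, φ a = traceForm c (subInclIso M E a)

theorem mem_predual_iff_isNormalFun {f : StrongDual ℂ E} :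
    f ∈ predual (subInclIso M E) ↔ IsNormalFun E f := mem_predual _

theorem isNormalFun_of_tendsto
    (he : IsClosed[ultraweak H H] (Set.range (subInclIso M E)))
    (f : StrongDual ℂ M.toStarSubalgebra)
    (hf : ∀ (l : Ultrafilter E) (a : E → M.toStarSubalgebra), (∀ t, a t ∈ E) → (∀ t, ‖a t‖ ≤ 1) →
      WeakOpTendsto a l 0 → Tendsto (fun t => f (a t)) l (𝓝 0)) :
    IsNormalFun E fun a => f a := by
  classical
  refine mem_predual_iff_isNormalFun.1
    (mem_predual_of_tendsto _ he (f.comp E.subtypeL) fun l hl1 hl => ?_)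
  -- The ultrafilter lies in the unit ball only eventually; the cut-off by 0 makes the bound hold
  -- everywhere.
  let a : E → M.toStarSubalgebra := fun t => if ‖t‖ ≤ 1 then t else 0
  have ha : ∀ᶠ t in (l : Filter E), a t = t := hl1.mono fun t ht => if_pos ht
  refine (hf l a (fun t => ?_) (fun t => ?_) fun ξ η => ?_).congr' (ha.mono fun t ht => ?_)
  · by_cases h : ‖t‖ ≤ 1
    · rw [show a t = t from if_pos h]
      exact t.2
    · rw [show a t = 0 from if_neg h]
      exact E.zero_mem
  · by_cases h : ‖t‖ ≤ 1
    · rw [show a t = t from if_pos h]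
      exact h
    · rw [show a t = 0 from if_neg h, norm_zero]
      exact zero_le_one
  · have h1 := hl (vecForm ξ η)
    simp only [traceForm_vecForm] at h1
    have h2 : inner ℂ η (((0 : M.toStarSubalgebra) : H →L[ℂ] H) ξ) = 0 := inner_zero_right _
    rw [h2]
    refine h1.congr' (ha.mono fun t ht => ?_)
    change _ = inner ℂ η ((a t : H →L[ℂ] H) ξ)
    rw [ht]
    rfl
  · rw [ht]
    rfl

theorem exists_weakOpTendsto
    (he : IsClosed[ultraweak H H] (Set.range (subInclIso M E)))
    {T : Type*} (l : Ultrafilter T) (z : T → M.toStarSubalgebra) (C : ℝ)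
    (hz : ∀ t, z t ∈ E) (hC : ∀ t, ‖z t‖ ≤ C) : ∃ x ∈ E, WeakOpTendsto z l x := by
  obtain ⟨x, hx⟩ := exists_tendsto_ultraweak (subInclIso M E) he l (a := fun t => ⟨z t, hz t⟩) hC
  refine ⟨x, x.2, fun ξ η => ?_⟩
  have := tendsto_ultraweak_iff.1 hx (vecForm ξ η)
  simp only [traceForm_vecForm] at this
  exact this

theorem IsNormalFun.tendsto {φ : M.toStarSubalgebra → ℂ} (hφ : IsNormalFun E fun a => φ a)
    {T : Type*} {l : Filter T} (z : T → M.toStarSubalgebra) (C : ℝ) (x : M.toStarSubalgebra)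
    (hz : ∀ t, z t ∈ E) (hC : ∀ t, ‖z t‖ ≤ C) (hx : x ∈ E) (h : WeakOpTendsto z l x) :
    Tendsto (fun t => φ (z t)) l (𝓝 (φ x)) := by
  obtain ⟨c, hc⟩ := hφ
  have h1 : Tendsto (fun t => (z t : H →L[ℂ] H)) l (@nhds _ (ultraweak H H) x) :=
    tendsto_ultraweak_of_bounded hC h
  have h2 := tendsto_ultraweak_iff.1 h1 c
  rw [show φ x = traceForm c x from hc ⟨x, hx⟩]
  exact h2.congr fun t => (hc ⟨z t, hz t⟩).symm

theorem IsSupport.isNormalFun_left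
    (he : IsClosed[ultraweak H H] (Set.range (subInclIso M E)))
    (hQ : IsCCProjection M E Q) (h : IsSupport E Q F u)
    (hF : IsNormalFun E fun a => F a) {b : M.toStarSubalgebra} (hb : b ∈ E) :
    IsNormalFun E fun a => F (u * star b * a) :=
  isNormalFun_of_tendsto he (F.comp (ContinuousLinearMap.mul ℂ M.toStarSubalgebra (u * star b)))
    fun l _ ha ha1 ha0 => h.tendsto_left hQ (exists_weakOpTendsto he l)
      (fun z C x hz hC hx h => hF.tendsto z C x hz hC hx h) hb ha ha1 ha0

theorem IsSupport.isNormalFun_right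
    (he : IsClosed[ultraweak H H] (Set.range (subInclIso M E)))
    (hQ : IsCCProjection M E Q) (h : IsSupport E Q F u)
    (hF : IsNormalFun E fun a => F a) {b : M.toStarSubalgebra} (hb : b ∈ E) :
    IsNormalFun E fun a => F (a * star b * u) := by
  refine isNormalFun_of_tendsto he
    (F.comp ((ContinuousLinearMap.mul ℂ M.toStarSubalgebra).flip (star b * u))) fun l a ha ha1 ha0 => ?_
  have := h.tendsto_right hQ (exists_weakOpTendsto he l)
      (fun z C x hz hC hx h => hF.tendsto z C x hz hC hx h) hb ha ha1 ha0
  simp only [mul_assoc] at this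
  exact this

/-- A weak* continuous functional of norm one on `E` extends to a support functional. -/
theorem exists_isSupport
    (he : IsClosed[ultraweak H H] (Set.range (subInclIso M E)))
    (hQ : IsCCProjection M E Q) {f : StrongDual ℂ E}
    (hf : f ∈ predual (subInclIso M E)) (hf1 : ‖f‖ = 1) :
    ∃ F u, IsSupport E Q F u ∧ ∀ a : E, F a = f a := by
  obtain ⟨u, hu, hfu⟩ := exists_norm_attaining _ he hf
  let Q' : M.toStarSubalgebra →L[ℂ] E :=
    LinearMap.mkContinuous (Q.codRestrict E hQ.mem) 1 fun x => by
      rw [one_mul]; exact norm_map_le_of_cc hQ.cc x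
  have hQ' : ∀ a : E, Q' a = a := fun a => Subtype.ext (hQ.fix _ a.2)
  refine ⟨f.comp Q', u, ⟨?_, fun x => ?_, u.2, hu, ?_⟩, fun a => ?_⟩
  · refine ContinuousLinearMap.opNorm_le_bound _ zero_le_one fun x => ?_
    rw [one_mul]
    refine (f.le_opNorm _).trans ?_
    rw [hf1, one_mul]
    exact norm_map_le_of_cc hQ.cc x
  · have : Q' (Q x) = Q' x := Subtype.ext (hQ.idem x)
    rw [ContinuousLinearMap.comp_apply, this, ContinuousLinearMap.comp_apply]
  · rw [ContinuousLinearMap.comp_apply, hQ', hfu, hf1, Complex.ofReal_one]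
  · rw [ContinuousLinearMap.comp_apply, hQ']

theorem IsNormalFun.const_mul {φ : E → ℂ} (h : IsNormalFun E φ) (r : ℂ) :
    IsNormalFun E fun a => r * φ a := by
  obtain ⟨c, hc⟩ := h
  exact ⟨r • c, fun a => by simp [hc a]⟩

/-- Every weak* continuous functional on `E` is a multiple of a support functional. -/
theorem IsNormalFun.exists_isSupport
    (he : IsClosed[ultraweak H H] (Set.range (subInclIso M E)))
    (hQ : IsCCProjection M E Q) {φ : E → ℂ}
    (h : IsNormalFun E φ) : (∀ a, φ a = 0) ∨ ∃ F u, ∃ r : ℂ, IsSupport E Q F u ∧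
      IsNormalFun E (fun a => F a) ∧ ∀ a : E, φ a = r * F a := by
  obtain ⟨c, hc⟩ := h
  rcases eq_zero_or_exists_norm_eq_one (subInclIso M E) (f := traceRestrict (subInclIso M E) c)
    ⟨c, rfl⟩ with h0 | ⟨r, g, hg, hg1, hr⟩
  · exact Or.inl fun a => (hc a).trans (h0 a)
  · obtain ⟨F, u, hFu, hF⟩ := _root_.exists_isSupport he hQ hg hg1
    refine Or.inr ⟨F, u, r, hFu, ?_, fun a => ?_⟩
    · simpa only [hF] using mem_predual_iff_isNormalFun.1 hg
    · rw [hF, ← hr, hc]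
      rfl

/-- Support functionals that are weak* continuous on `E` separate the points of `E`. -/
theorem eq_zero_of_isSupport
    (he : IsClosed[ultraweak H H] (Set.range (subInclIso M E)))
    (hQ : IsCCProjection M E Q) {x : M.toStarSubalgebra} (hx : x ∈ E)
    (h : ∀ F u, IsSupport E Q F u → IsNormalFun E (fun a => F a) → F x = 0) : x = 0 := by
  have h1 : (x : H →L[ℂ] H) = 0 := by
    refine eq_of_traceForm_eq fun c => ?_
    rw [map_zero]
    have hφ : IsNormalFun E fun a => traceForm c (subInclIso M E a) := ⟨c, fun a => rfl⟩
    rcases hφ.exists_isSupport he hQ with h0 | ⟨F, u, r, hFu, hF, hr⟩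
    · exact h0 ⟨x, hx⟩
    · have := hr ⟨x, hx⟩
      rw [h F u hFu hF, mul_zero] at this
      exact this
  exact Subtype.ext h1

/-- Support functionals separate the points of `E`, and each of them kills `kd*e` for `k = Qx - x`
in the kernel of `Q`. -/
theorem IsCCProjection.map_proj_mul_left
    (he : IsClosed[ultraweak H H] (Set.range (subInclIso M E)))
    (hQ : IsCCProjection M E Q) {d e : M.toStarSubalgebra}
    (hd : d ∈ E) (heE : e ∈ E) (x : M.toStarSubalgebra) :
    Q (Q x * star d * e) = Q (x * star d * e) := by
  refine sub_eq_zero.1 (eq_zero_of_isSupport he hQ (E.sub_mem (hQ.mem _) (hQ.mem _))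
    fun F u h _ => ?_)
  rw [← map_sub, h.map_proj, ← sub_mul, ← sub_mul]
  exact h.map_mul_star_mul_eq_zero_left hQ (by rw [map_sub, hQ.idem, sub_self]) hd heE

theorem IsCCProjection.map_proj_mul_right
    (he : IsClosed[ultraweak H H] (Set.range (subInclIso M E)))
    (hQ : IsCCProjection M E Q) {d e : M.toStarSubalgebra}
    (hd : d ∈ E) (heE : e ∈ E) (x : M.toStarSubalgebra) :
    Q (e * star d * Q x) = Q (e * star d * x) := by
  refine sub_eq_zero.1 (eq_zero_of_isSupport he hQ (E.sub_mem (hQ.mem _) (hQ.mem _))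
    fun F u h _ => ?_)
  rw [← map_sub, h.map_proj, ← mul_sub]
  exact h.map_mul_star_mul_eq_zero_right hQ (by rw [map_sub, hQ.idem, sub_self]) hd heE

/-- The ternary product is weak* continuous in the first variable. -/
theorem IsNormalFun.comp_ternary_right
    (he : IsClosed[ultraweak H H] (Set.range (subInclIso M E)))
    (hQ : IsCCProjection M E Q) {φ : E → ℂ}
    (hφ : IsNormalFun E φ) (y z : E) : IsNormalFun E fun a => φ (hQ.ternary a y z) := by
  rcases hφ.exists_isSupport he hQ with h0 | ⟨F, u, r, hFu, hF, hr⟩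
  · exact ⟨0, fun a => by simp [h0]⟩
  simp only [hr]
  refine IsNormalFun.const_mul ?_ r
  -- Moving the product to the other side, `F(ay*z) = F(ay*zu*u) = F(a(uz*y)*u)`, and `uz*y` may be
  -- replaced by its image under `Q`, which lies in `E`.
  have h1 := hFu.isNormalFun_right he hQ hF (hQ.mem (u * star (z : M.toStarSubalgebra) * y))
  convert h1 using 2 with a
  rw [← hFu.map_proj (a * star (Q _) * u), hQ.map_mul_star_mul a.2 hFu.mem, hFu.map_proj,
    IsCCProjection.ternary, hFu.map_proj, ← hFu.map_right]
  simp [mul_assoc]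

end Normality

/-! ### The Gelfand-Naimark-Segal representation of a family of support functionals -/

section GNS

variable {H : Type*} [NormedAddCommGroup H] [InnerProductSpace ℂ H] [CompleteSpace H]
  {M : VonNeumannAlgebra H} {E : Submodule ℂ M.toStarSubalgebra}
  {Q : M.toStarSubalgebra →ₗ[ℂ] M.toStarSubalgebra}

/-- The operator inequality `(ax)*(ax) ≤ ‖a‖²x*x` under the positive functional `F(u·)`; it makes
left multiplication bounded on the GNS space. -/
theorem IsSupport.re_star_mul_mul_le {F : StrongDual ℂ M.toStarSubalgebra}
    {u : M.toStarSubalgebra} (h : IsSupport E Q F u) (a x : M.toStarSubalgebra) :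
    (F (u * (star (a * x) * (a * x)))).re ≤ ‖a‖ ^ 2 * (F (u * (star x * x))).re := by
  have h1 := h.re_nonneg (x := ((‖a‖ ^ 2 : ℝ) : ℂ) • (star x * x) - star (a * x) * (a * x))
    fun v => by
      change 0 ≤ (inner ℂ v (((‖a‖ ^ 2 : ℝ) : ℂ) •
        (ContinuousLinearMap.adjoint (vnIncl M x) (vnIncl M x v)) -
        ContinuousLinearMap.adjoint (vnIncl M (a * x)) (vnIncl M a (vnIncl M x v)))).re
      rw [inner_sub_right, inner_smul_right, ContinuousLinearMap.adjoint_inner_right,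
        ContinuousLinearMap.adjoint_inner_right]
      change 0 ≤ (_ - inner ℂ (vnIncl M a (vnIncl M x v)) (vnIncl M a (vnIncl M x v))).re
      rw [inner_self_eq_norm_sq_to_K, inner_self_eq_norm_sq_to_K]
      have h2 : ‖vnIncl M a (vnIncl M x v)‖ ^ 2 ≤ (‖a‖ * ‖vnIncl M x v‖) ^ 2 := by
        gcongr
        exact (vnIncl M a).le_opNorm _
      simp only [Complex.sub_re, Complex.coe_algebraMap, ← Complex.ofReal_pow,
        ← Complex.ofReal_mul, Complex.ofReal_re]
      rw [mul_pow] at h2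
      linarith
  rw [mul_sub, mul_smul_comm, map_sub, map_smul, smul_eq_mul, Complex.sub_re,
    Complex.re_ofReal_mul] at h1
  linarith

variable (E Q) in
/-- The support functionals that are weak* continuous on `E`. -/
def NormalSupport : Type _ :=
  {p : StrongDual ℂ M.toStarSubalgebra × M.toStarSubalgebra //
    IsSupport E Q p.1 p.2 ∧ IsNormalFun E fun a => p.1 a}

/-- The positive functional `x ↦ F(ux)` of a support functional. -/
noncomputable def NormalSupport.pos (i : NormalSupport E Q) : M.toStarSubalgebra →ₗ[ℂ] ℂ :=
  i.1.1.toLinearMap ∘ₗ LinearMap.mulLeft ℂ i.1.2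

theorem NormalSupport.pos_apply (i : NormalSupport E Q) (x : M.toStarSubalgebra) :
    i.pos x = i.1.1 (i.1.2 * x) := rfl

theorem NormalSupport.pos_star (i : NormalSupport E Q) (x : M.toStarSubalgebra) :
    i.pos (star x) = (starRingEnd ℂ) (i.pos x) := i.2.1.map_mul_star x

variable (E Q) in
/-- Finitely supported families of elements of `M`, indexed by the support functionals. -/
def PreGNS : Type _ := NormalSupport E Q →₀ M.toStarSubalgebra

noncomputable instance : AddCommGroup (PreGNS E Q) :=
  inferInstanceAs (AddCommGroup (NormalSupport E Q →₀ M.toStarSubalgebra))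

noncomputable instance : Module ℂ (PreGNS E Q) :=
  inferInstanceAs (Module ℂ (NormalSupport E Q →₀ M.toStarSubalgebra))

/-- The entries of a family. -/
noncomputable def PreGNS.coeff (x : PreGNS E Q) (i : NormalSupport E Q) : M.toStarSubalgebra :=
  Finsupp.toFun x i

/-- The family with a single entry `x` at the index `i`. -/
noncomputable def PreGNS.single (i : NormalSupport E Q) (x : M.toStarSubalgebra) : PreGNS E Q :=
  Finsupp.single i x

theorem PreGNS.coeff_add (x y : PreGNS E Q) (i : NormalSupport E Q) :
    (x + y).coeff i = x.coeff i + y.coeff i := rfl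

theorem PreGNS.coeff_smul (c : ℂ) (x : PreGNS E Q) (i : NormalSupport E Q) :
    (c • x).coeff i = c • x.coeff i := rfl

/-- The semi-inner product given by the support functionals. -/
noncomputable def PreGNS.form (x y : PreGNS E Q) : ℂ :=
  Finsupp.sum y fun i b => i.pos (star (x.coeff i) * b)

theorem PreGNS.form_eq_sum {x y : PreGNS E Q} {s : Finset (NormalSupport E Q)}
    (hs : y.support ⊆ s) :
    PreGNS.form x y = ∑ i ∈ s, i.pos (star (x.coeff i) * y.coeff i) :=
  Finsupp.sum_of_support_subset _ hs _ (by simp)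

variable (E Q) in
/-- The semi-inner product given by the support functionals. -/
noncomputable abbrev PreGNS.core : PreInnerProductSpace.Core ℂ (PreGNS E Q) where
  inner x y := PreGNS.form x y
  conj_inner_symm x y := by
    classical
    rw [PreGNS.form_eq_sum (s := x.support ∪ y.support) Finset.subset_union_left,
      PreGNS.form_eq_sum (s := x.support ∪ y.support) Finset.subset_union_right, map_sum]
    refine Finset.sum_congr rfl fun i _ => ?_
    rw [← NormalSupport.pos_star, star_mul, star_star]
  re_inner_nonneg x := by
    rw [PreGNS.form_eq_sum subset_rfl, map_sum]
    exact Finset.sum_nonneg fun i _ => i.2.1.re_star_mul_self_nonneg _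
  add_left x y z := by
    rw [PreGNS.form_eq_sum subset_rfl, PreGNS.form_eq_sum subset_rfl,
      PreGNS.form_eq_sum subset_rfl, ← Finset.sum_add_distrib]
    refine Finset.sum_congr rfl fun i _ => ?_
    rw [← map_add, ← add_mul, ← star_add, PreGNS.coeff_add]
  smul_left x y r := by
    rw [PreGNS.form_eq_sum subset_rfl, PreGNS.form_eq_sum subset_rfl, Finset.mul_sum]
    refine Finset.sum_congr rfl fun i _ => ?_
    rw [PreGNS.coeff_smul, star_smul, smul_mul_assoc, map_smul, smul_eq_mul, Complex.star_def]

noncomputable instance : SeminormedAddCommGroup (PreGNS E Q) :=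
  InnerProductSpace.Core.toSeminormedAddCommGroup (c := PreGNS.core E Q)

noncomputable instance : InnerProductSpace ℂ (PreGNS E Q) :=
  InnerProductSpace.ofCore (PreGNS.core E Q)

theorem PreGNS.inner_def (x y : PreGNS E Q) : inner ℂ x y = PreGNS.form x y := rfl

/-- Left multiplication, as a linear map. -/
noncomputable def PreGNS.mulLeft (a : M.toStarSubalgebra) : PreGNS E Q →ₗ[ℂ] PreGNS E Q :=
  Finsupp.mapRange.linearMap (LinearMap.mulLeft ℂ a)

theorem PreGNS.coeff_mulLeft (a : M.toStarSubalgebra) (x : PreGNS E Q) (i : NormalSupport E Q) :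
    (PreGNS.mulLeft a x).coeff i = a * x.coeff i := rfl

theorem PreGNS.support_mulLeft (a : M.toStarSubalgebra) (x : PreGNS E Q) :
    (PreGNS.mulLeft a x).support ⊆ x.support :=
  Finsupp.support_mapRange (hf := mul_zero a)

theorem PreGNS.mulLeft_single (a : M.toStarSubalgebra) (i : NormalSupport E Q)
    (x : M.toStarSubalgebra) : PreGNS.mulLeft a (.single i x) = .single i (a * x) :=
  Finsupp.mapRange_single (hf := mul_zero a)

theorem PreGNS.form_single_right (x : PreGNS E Q) (i : NormalSupport E Q)
    (y : M.toStarSubalgebra) : PreGNS.form x (.single i y) = i.pos (star (x.coeff i) * y) :=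
  Finsupp.sum_single_index (by simp)

theorem PreGNS.norm_mulLeft_le (a : M.toStarSubalgebra) (x : PreGNS E Q) :
    ‖PreGNS.mulLeft a x‖ ≤ ‖a‖ * ‖x‖ := by
  refine le_of_sq_le_sq ?_ (by positivity)
  rw [mul_pow, @norm_sq_eq_re_inner ℂ (PreGNS E Q), @norm_sq_eq_re_inner ℂ (PreGNS E Q),
    PreGNS.inner_def, PreGNS.inner_def,
    PreGNS.form_eq_sum subset_rfl (y := x), PreGNS.form_eq_sum (PreGNS.support_mulLeft a x),
    map_sum, map_sum, Finset.mul_sum]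
  exact Finset.sum_le_sum fun i _ => i.2.1.re_star_mul_mul_le a _

theorem PreGNS.form_mulLeft (a : M.toStarSubalgebra) (x y : PreGNS E Q) :
    PreGNS.form (PreGNS.mulLeft a x) y = PreGNS.form x (PreGNS.mulLeft (star a) y) := by
  rw [PreGNS.form_eq_sum subset_rfl,
    PreGNS.form_eq_sum (PreGNS.support_mulLeft (star a) y)]
  refine Finset.sum_congr rfl fun i _ => congrArg i.pos ?_
  rw [PreGNS.coeff_mulLeft, PreGNS.coeff_mulLeft, star_mul, mul_assoc]

variable (E Q) in
/-- The Hilbert space of the Gelfand-Naimark-Segal representation. -/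
abbrev GNS : Type _ := UniformSpace.Completion (PreGNS E Q)

variable (E Q) in
/-- The Gelfand-Naimark-Segal representation. -/
noncomputable def gnsRep (a : M.toStarSubalgebra) : GNS E Q →L[ℂ] GNS E Q :=
  ((PreGNS.mulLeft a).mkContinuous ‖a‖ (PreGNS.norm_mulLeft_le a)).completion

/-- The canonical vectors. -/
noncomputable def gnsVec (i : NormalSupport E Q) (x : M.toStarSubalgebra) : GNS E Q :=
  (PreGNS.single i x : PreGNS E Q)

theorem gnsRep_coe (a : M.toStarSubalgebra) (x : PreGNS E Q) :
    gnsRep E Q a (x : GNS E Q) = (PreGNS.mulLeft a x : PreGNS E Q) :=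
  ContinuousLinearMap.completion_apply_coe _ _

theorem gnsRep_gnsVec (a : M.toStarSubalgebra) (i : NormalSupport E Q) (x : M.toStarSubalgebra) :
    gnsRep E Q a (gnsVec i x) = gnsVec i (a * x) := by
  rw [gnsVec, gnsRep_coe, PreGNS.mulLeft_single, gnsVec]

theorem inner_gnsVec (i : NormalSupport E Q) (x y : M.toStarSubalgebra) :
    inner ℂ (gnsVec i x) (gnsVec i y) = i.1.1 (i.1.2 * (star x * y)) := by
  rw [gnsVec, gnsVec, UniformSpace.Completion.inner_coe, PreGNS.inner_def,
    PreGNS.form_single_right, ← NormalSupport.pos_apply]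
  congr 3
  exact Finsupp.single_eq_same

theorem inner_gnsVec_of_ne {i j : NormalSupport E Q} (h : i ≠ j) (x y : M.toStarSubalgebra) :
    inner ℂ (gnsVec i x) (gnsVec j y) = 0 := by
  rw [gnsVec, gnsVec, UniformSpace.Completion.inner_coe, PreGNS.inner_def,
    PreGNS.form_single_right]
  have h1 : (PreGNS.single i x).coeff j = 0 :=
    Finsupp.single_eq_of_ne h.symm
  rw [h1, star_zero, zero_mul, map_zero]

theorem norm_gnsRep_le (a : M.toStarSubalgebra) : ‖gnsRep E Q a‖ ≤ ‖a‖ := by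
  refine ContinuousLinearMap.opNorm_le_bound _ (norm_nonneg _) fun x => ?_
  induction x using UniformSpace.Completion.induction_on with
  | hp => exact isClosed_le (by fun_prop) (by fun_prop)
  | ih x =>
    rw [gnsRep_coe, UniformSpace.Completion.norm_coe, UniformSpace.Completion.norm_coe]
    exact PreGNS.norm_mulLeft_le a x

theorem adjoint_gnsRep (a : M.toStarSubalgebra) :
    ContinuousLinearMap.adjoint (gnsRep E Q a) = gnsRep E Q (star a) := by
  symm
  refine (ContinuousLinearMap.eq_adjoint_iff _ _).2 fun x y => ?_
  induction x, y using UniformSpace.Completion.induction_on₂ with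
  | hp => apply isClosed_eq <;> fun_prop
  | ih x y =>
    rw [gnsRep_coe, gnsRep_coe, UniformSpace.Completion.inner_coe,
      UniformSpace.Completion.inner_coe, PreGNS.inner_def, PreGNS.inner_def,
      PreGNS.form_mulLeft, star_star]

theorem gnsRep_add (a b : M.toStarSubalgebra) :
    gnsRep E Q (a + b) = gnsRep E Q a + gnsRep E Q b := by
  ext x
  induction x using UniformSpace.Completion.induction_on with
  | hp => apply isClosed_eq <;> fun_prop
  | ih x =>
    rw [add_apply, gnsRep_coe, gnsRep_coe, gnsRep_coe, ← UniformSpace.Completion.coe_add]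
    congr 1
    refine Finsupp.ext fun i => ?_
    exact add_mul a b _

theorem gnsRep_smul (c : ℂ) (a : M.toStarSubalgebra) :
    gnsRep E Q (c • a) = c • gnsRep E Q a := by
  ext x
  induction x using UniformSpace.Completion.induction_on with
  | hp => exact isClosed_eq (gnsRep E Q (c • a)).continuous (c • gnsRep E Q a).continuous
  | ih x =>
    change gnsRep E Q (c • a) (x : GNS E Q) = c • gnsRep E Q a (x : GNS E Q)
    rw [gnsRep_coe, gnsRep_coe, ← UniformSpace.Completion.coe_smul]
    congr 1
    refine Finsupp.ext fun i => ?_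
    exact smul_mul_assoc c a _

end GNS

/-- The C*-identity for `T*T` gives `‖T‖⁴ = ‖T*(TT*T)‖ ≤ ‖T‖ ‖TT*T‖`. -/
theorem norm_comp_adjoint_comp {H K : Type*} [NormedAddCommGroup H] [InnerProductSpace ℂ H]
    [CompleteSpace H] [NormedAddCommGroup K] [InnerProductSpace ℂ K] [CompleteSpace K]
    (T : H →L[ℂ] K) : ‖T ∘L ContinuousLinearMap.adjoint T ∘L T‖ = ‖T‖ ^ 3 := by
  have h1 := ContinuousLinearMap.norm_adjoint_comp_self T
  refine le_antisymm ?_ ?_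
  · refine (ContinuousLinearMap.opNorm_comp_le _ _).trans_eq ?_
    rw [h1]
    ring
  · rcases (norm_nonneg T).eq_or_lt with h0 | h0
    · rw [← h0, zero_pow (by norm_num)]
      exact norm_nonneg _
    have h2 := ContinuousLinearMap.norm_adjoint_comp_self (ContinuousLinearMap.adjoint T ∘L T)
    rw [ContinuousLinearMap.adjoint_comp, ContinuousLinearMap.adjoint_adjoint, h1] at h2
    have h3 := ContinuousLinearMap.opNorm_comp_le (ContinuousLinearMap.adjoint T)
      (T ∘L ContinuousLinearMap.adjoint T ∘L T)
    rw [LinearIsometryEquiv.norm_map] at h3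
    have h4 : ContinuousLinearMap.adjoint T ∘L (T ∘L ContinuousLinearMap.adjoint T ∘L T) =
      (ContinuousLinearMap.adjoint T ∘L T) ∘L (ContinuousLinearMap.adjoint T ∘L T) := rfl
    rw [h4, h2] at h3
    refine le_of_mul_le_mul_left (le_trans (le_of_eq ?_) h3) h0
    ring

/-! ### The ternary representation on the GNS space -/

section Representation

variable {H : Type*} [NormedAddCommGroup H] [InnerProductSpace ℂ H] [CompleteSpace H]
  {M : VonNeumannAlgebra H} {E : Submodule ℂ M.toStarSubalgebra}
  {Q : M.toStarSubalgebra →ₗ[ℂ] M.toStarSubalgebra}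

variable (E Q) in
/-- The closed linear span of the canonical vectors of the elements `e ∈ E`. -/
noncomputable def gnsCod : Submodule ℂ (GNS E Q) :=
  (Submodule.span ℂ {v | ∃ (i : NormalSupport E Q) (e : E), gnsVec i e = v}).topologicalClosure

variable (E Q) in
/-- The closed linear span of the canonical vectors of the elements `d*e` with `d, e ∈ E`. -/
noncomputable def gnsDom : Submodule ℂ (GNS E Q) :=
  (Submodule.span ℂ {v | ∃ (i : NormalSupport E Q) (d e : E),
    gnsVec i (star (d : M.toStarSubalgebra) * e) = v}).topologicalClosure

noncomputable instance : CompleteSpace (gnsCod E Q) :=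
  (Submodule.isClosed_topologicalClosure _).completeSpace_coe

noncomputable instance : CompleteSpace (gnsDom E Q) :=
  (Submodule.isClosed_topologicalClosure _).completeSpace_coe

theorem gnsVec_mem_gnsCod (i : NormalSupport E Q) {e : M.toStarSubalgebra} (he : e ∈ E) :
    gnsVec i e ∈ gnsCod E Q :=
  Submodule.le_topologicalClosure _ (Submodule.subset_span ⟨i, ⟨e, he⟩, rfl⟩)

theorem gnsVec_mem_gnsDom (i : NormalSupport E Q) {d e : M.toStarSubalgebra} (hd : d ∈ E)
    (he : e ∈ E) : gnsVec i (star d * e) ∈ gnsDom E Q :=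
  Submodule.le_topologicalClosure _ (Submodule.subset_span ⟨i, ⟨d, hd⟩, ⟨e, he⟩, rfl⟩)

/-- The vector of `x - Qx` is orthogonal to those of `e ∈ E`, because `F(ue*k) = 0` for `k` in the
kernel of `Q`. Thus `Q` acts as an orthogonal projection. -/
theorem starProjection_gnsCod_gnsVec (hQ : IsCCProjection M E Q) (i : NormalSupport E Q)
    (x : M.toStarSubalgebra) : (gnsCod E Q).starProjection (gnsVec i x) = gnsVec i (Q x) := by
  refine Submodule.eq_starProjection_of_mem_orthogonal (gnsVec_mem_gnsCod i (hQ.mem x)) ?_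
  rw [gnsCod, Submodule.orthogonal_closure]
  refine (Submodule.mem_orthogonal _ _).2 fun w hw => ?_
  induction hw using Submodule.span_induction with
  | mem w hw =>
    obtain ⟨j, e, rfl⟩ := hw
    by_cases h : j = i
    · subst h
      rw [inner_sub_right, inner_gnsVec, inner_gnsVec, ← map_sub, ← mul_sub, ← mul_sub,
        ← mul_assoc]
      exact j.2.1.map_mul_star_mul_eq_zero_right hQ (by rw [map_sub, hQ.idem, sub_self]) e.2
        j.2.1.mem
    · rw [inner_sub_right, inner_gnsVec_of_ne h, inner_gnsVec_of_ne h, sub_zero]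
  | zero => exact inner_zero_left _
  | add v w _ _ hv hw => rw [inner_add_left, hv, hw, add_zero]
  | smul c v _ hv => rw [inner_smul_left, hv, mul_zero]

variable (E Q) in
/-- The compression of the Gelfand-Naimark-Segal representation to `gnsDom` and `gnsCod`. -/
noncomputable def gnsMap : E →ₗ[ℂ] (GNS E Q →L[ℂ] GNS E Q) where
  toFun a := (gnsCod E Q).starProjection ∘L gnsRep E Q a ∘L (gnsDom E Q).starProjection
  map_add' a b := by
    rw [Submodule.coe_add, gnsRep_add, ContinuousLinearMap.add_comp, ContinuousLinearMap.comp_add]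
  map_smul' c a := by
    rw [Submodule.coe_smul, gnsRep_smul, ContinuousLinearMap.smul_comp,
      ContinuousLinearMap.comp_smul, RingHom.id_apply]

theorem gnsMap_apply (a : E) (v : GNS E Q) : gnsMap E Q a v =
    (gnsCod E Q).starProjection (gnsRep E Q a ((gnsDom E Q).starProjection v)) := rfl

theorem gnsMap_gnsVec (hQ : IsCCProjection M E Q) (i : NormalSupport E Q) (a : E)
    {d e : M.toStarSubalgebra} (hd : d ∈ E) (he : e ∈ E) :
    gnsMap E Q a (gnsVec i (star d * e)) = gnsVec i (Q (a * star d * e)) := by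
  rw [gnsMap_apply, Submodule.starProjection_eq_self_iff.2 (gnsVec_mem_gnsDom i hd he),
    gnsRep_gnsVec, starProjection_gnsCod_gnsVec hQ, mul_assoc]

theorem adjoint_gnsMap_gnsVec (i : NormalSupport E Q) (b : E)
    {e : M.toStarSubalgebra} (he : e ∈ E) :
    ContinuousLinearMap.adjoint (gnsMap E Q b) (gnsVec i e) =
      gnsVec i (star (b : M.toStarSubalgebra) * e) := by
  change ContinuousLinearMap.adjoint ((gnsCod E Q).starProjection ∘L gnsRep E Q b ∘L
    (gnsDom E Q).starProjection) _ = _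
  rw [ContinuousLinearMap.adjoint_comp, ContinuousLinearMap.adjoint_comp,
    (isSelfAdjoint_starProjection _).adjoint_eq, (isSelfAdjoint_starProjection _).adjoint_eq,
    adjoint_gnsRep]
  simp only [ContinuousLinearMap.comp_apply]
  rw [Submodule.starProjection_eq_self_iff.2 (gnsVec_mem_gnsCod i he), gnsRep_gnsVec,
    Submodule.starProjection_eq_self_iff.2 (gnsVec_mem_gnsDom i b.2 he)]

theorem gnsMap_starProjection (a : E) (v : GNS E Q) :
    gnsMap E Q a ((gnsDom E Q).starProjection v) = gnsMap E Q a v := by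
  rw [gnsMap_apply, gnsMap_apply, Submodule.starProjection_eq_self_iff.2
    (Submodule.starProjection_apply_mem _ _)]

theorem eqOn_gnsDom {S T : GNS E Q →L[ℂ] GNS E Q}
    (h : ∀ (i : NormalSupport E Q) (d e : E), S (gnsVec i (star (d : M.toStarSubalgebra) * e)) =
      T (gnsVec i (star (d : M.toStarSubalgebra) * e))) {v : GNS E Q} (hv : v ∈ gnsDom E Q) :
    S v = T v := by
  have h1 : gnsDom E Q ≤ LinearMap.eqLocus S.toLinearMap T.toLinearMap := by
    refine Submodule.topologicalClosure_minimal _ (Submodule.span_le.2 ?_)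
      (isClosed_eq S.continuous T.continuous)
    rintro _ ⟨i, d, e, rfl⟩
    exact h i d e
  exact h1 hv

/-- At the vector of `d*e` the two sides are given by `Q(Q(ab*c)d*e)` and `Q(ab*Q(cd*e))`; the inner
`Q` can be dropped in both. -/
theorem gnsMap_ternary (he : IsClosed[ultraweak H H] (Set.range (subInclIso M E)))
    (hQ : IsCCProjection M E Q) (a b c : E) : gnsMap E Q (hQ.ternary a b c) =
      gnsMap E Q a ∘L ContinuousLinearMap.adjoint (gnsMap E Q b) ∘L gnsMap E Q c := by
  ext1 v
  rw [ContinuousLinearMap.comp_apply, ContinuousLinearMap.comp_apply, ← gnsMap_starProjection,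
    ← gnsMap_starProjection c]
  refine eqOn_gnsDom (T := gnsMap E Q a ∘L ContinuousLinearMap.adjoint (gnsMap E Q b) ∘L
    gnsMap E Q c) (fun i d e => ?_) (Submodule.starProjection_apply_mem _ _)
  rw [ContinuousLinearMap.comp_apply, ContinuousLinearMap.comp_apply,
    gnsMap_gnsVec hQ i _ d.2 e.2, gnsMap_gnsVec hQ i _ d.2 e.2, adjoint_gnsMap_gnsVec i b (hQ.mem _),
    gnsMap_gnsVec hQ i _ b.2 (hQ.mem _), hQ.map_proj_mul_right he b.2 a.2,
    IsCCProjection.ternary, hQ.map_proj_mul_left he d.2 e.2]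
  simp only [mul_assoc]

theorem norm_gnsMap_le (a : E) : ‖gnsMap E Q a‖ ≤ ‖a‖ := by
  refine ContinuousLinearMap.opNorm_le_bound _ (norm_nonneg _) fun v => ?_
  rw [gnsMap_apply]
  refine (Submodule.norm_starProjection_apply_le _ _).trans
    ((ContinuousLinearMap.le_opNorm _ _).trans ?_)
  exact mul_le_mul (norm_gnsRep_le _) (Submodule.norm_starProjection_apply_le _ _)
    (norm_nonneg _) (norm_nonneg _)

theorem IsSupport.map_self_mul {F : StrongDual ℂ M.toStarSubalgebra} {u : M.toStarSubalgebra}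
    (h : IsSupport E Q F u) : F (u * (star u * u)) = 1 := by
  rw [← mul_assoc, h.map_left, h.map_eq]

theorem norm_eq_one_of_inner {V : Type*} [NormedAddCommGroup V] [InnerProductSpace ℂ V] {v : V}
    (h : inner ℂ v v = (1 : ℂ)) : ‖v‖ = 1 := by
  rw [@norm_eq_sqrt_re_inner ℂ, h]
  simp

theorem norm_gnsVec_self (i : NormalSupport E Q) : ‖gnsVec i i.1.2‖ = 1 :=
  norm_eq_one_of_inner (by rw [inner_gnsVec, i.2.1.map_self_mul])

theorem norm_gnsVec_star_mul_self (i : NormalSupport E Q) :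
    ‖gnsVec i (star i.1.2 * i.1.2)‖ = 1 :=
  norm_eq_one_of_inner (by
    have h := i.2.1
    rw [inner_gnsVec, star_mul, star_star, mul_assoc (star i.1.2), ← mul_assoc i.1.2 (star i.1.2),
      h.map_left, h.map_self_mul])

/-- The support functionals are vector functionals. -/
theorem inner_gnsMap (hQ : IsCCProjection M E Q) (i : NormalSupport E Q) (a : E) :
    inner ℂ (gnsVec i i.1.2) (gnsMap E Q a (gnsVec i (star i.1.2 * i.1.2))) = i.1.1 a := by
  have h := i.2.1
  rw [gnsMap_gnsVec hQ i a h.mem h.mem, inner_gnsVec, ← mul_assoc, h.map_left, h.map_proj,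
    h.map_right]

theorem norm_apply_le_norm_gnsMap (hQ : IsCCProjection M E Q) (i : NormalSupport E Q) (a : E) :
    ‖i.1.1 a‖ ≤ ‖gnsMap E Q a‖ := by
  rw [← inner_gnsMap hQ]
  refine (norm_inner_le_norm _ _).trans ?_
  rw [norm_gnsVec_self, one_mul]
  refine (ContinuousLinearMap.le_opNorm _ _).trans_eq ?_
  rw [norm_gnsVec_star_mul_self, mul_one]

/-- A vector functional restricted to `E` is zero or `rF` with `F` a support functional. Here `r` is
its value at `u`, so `‖r‖ ≤ ‖ξ‖‖η‖`, and `F` is a coefficient of `gnsMap` at unit vectors. -/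
theorem norm_gnsMap (he : IsClosed[ultraweak H H] (Set.range (subInclIso M E)))
    (hQ : IsCCProjection M E Q) (a : E) : ‖gnsMap E Q a‖ = ‖a‖ := by
  refine le_antisymm (norm_gnsMap_le a) ?_
  change ‖vnIncl M a‖ ≤ _
  refine opNorm_le_of_inner (norm_nonneg _) fun ξ η => ?_
  rw [← traceForm_vecForm]
  have hφ : IsNormalFun E fun a => traceForm (vecForm ξ η) (subInclIso M E a) := ⟨_, fun a => rfl⟩
  rcases hφ.exists_isSupport he hQ with h0 | ⟨F, u, r, hFu, hF, hr⟩
  · have := h0 a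
    rw [subInclIso_apply] at this
    rw [this, norm_zero]
    positivity
  · have h1 := hr a
    rw [subInclIso_apply] at h1
    have h2 := hr ⟨u, hFu.mem⟩
    rw [hFu.map_eq, mul_one, traceForm_vecForm] at h2
    have h3 : ‖r‖ ≤ ‖ξ‖ * ‖η‖ := by
      rw [← h2]
      refine (norm_inner_le_norm _ _).trans ?_
      rw [mul_comm]
      gcongr
      exact ContinuousLinearMap.le_of_opNorm_le _ hFu.norm_le' ξ |>.trans_eq (one_mul _)
    rw [h1, norm_mul, mul_assoc, mul_comm]
    exact mul_le_mul (norm_apply_le_norm_gnsMap hQ ⟨(F, u), hFu, hF⟩ a) h3 (norm_nonneg _)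
      (norm_nonneg _)

theorem le_of_pow_three_pow_le {a b C : ℝ} (hb : 0 ≤ b)
    (h : ∀ k : ℕ, a ^ 3 ^ k ≤ C * b ^ 3 ^ k) : a ≤ b := by
  by_contra! hab
  rcases hb.eq_or_lt with rfl | hb
  · have := h 0
    simp at this
    linarith
  · have h1 : 1 < a / b := (one_lt_div hb).2 hab
    have h2 : Tendsto (fun k : ℕ => (a / b) ^ 3 ^ k) atTop atTop :=
      (tendsto_pow_atTop_atTop_of_one_lt h1).comp
        (tendsto_pow_atTop_atTop_of_one_lt (by norm_num : 1 < 3))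
    obtain ⟨k, hk⟩ := (h2.eventually_gt_atTop C).exists
    rw [div_pow, lt_div_iff₀ (by positivity)] at hk
    exact (h k).not_gt hk

theorem norm_gnsMap_matTernary (he : IsClosed[ultraweak H H] (Set.range (subInclIso M E)))
    (hQ : IsCCProjection M E Q) {n : ℕ} (x : Matrix (Fin n) (Fin n) E) :
    ‖amplify (gnsMap E Q) n (hQ.matTernary x x x)‖ = ‖amplify (gnsMap E Q) n x‖ ^ 3 := by
  have h : amplify (gnsMap E Q) n (hQ.matTernary x x x) = amplify (gnsMap E Q) n x ∘L
      ContinuousLinearMap.adjoint (amplify (gnsMap E Q) n x) ∘L amplify (gnsMap E Q) n x := by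
    rw [amplify_apply, amplify_apply, matrixOp_ternary]
    congr 1
    ext1 i j
    simp only [Matrix.map_apply, Matrix.of_apply, IsCCProjection.matTernary, map_sum,
      gnsMap_ternary he hQ]
  rw [h]
  exact norm_comp_adjoint_comp _

/-- The isometry on `E` makes the two norms on `Mₙ(E)` equivalent with constant `n²`. Both are cubed
exactly by `x ↦ {x,x,x}`, so iterating and taking `3ᵏ`-th roots removes the constant. -/
theorem isCompletelyIsometric_gnsMap
    (he : IsClosed[ultraweak H H] (Set.range (subInclIso M E)))
    (hQ : IsCCProjection M E Q) : IsCompletelyIsometric (subIncl M E) (gnsMap E Q) := by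
  intro n x
  have hι : ∀ x : Matrix (Fin n) (Fin n) E, ‖amplify (gnsMap E Q) n x‖ ≤
      (n * n : ℝ) * ‖amplify (subIncl M E) n x‖ := by
    intro x
    refine (norm_matrixOp_le_sum _).trans ((Finset.sum_le_sum fun i _ => Finset.sum_le_sum
      fun j _ => (norm_gnsMap_le (x i j)).trans
        (norm_entry_le_norm_matrixOp (x.map (subIncl M E)) i j)).trans_eq ?_)
    simp [amplify_apply, mul_assoc]
  have he' : ∀ x : Matrix (Fin n) (Fin n) E, ‖amplify (subIncl M E) n x‖ ≤
      (n * n : ℝ) * ‖amplify (gnsMap E Q) n x‖ := by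
    intro x
    refine (norm_matrixOp_le_sum _).trans ((Finset.sum_le_sum fun i _ => Finset.sum_le_sum
      fun j _ => (norm_gnsMap he hQ (x i j)).ge.trans
        (norm_entry_le_norm_matrixOp (x.map (gnsMap E Q)) i j)).trans_eq ?_)
    simp [amplify_apply, mul_assoc]
  let X : ℕ → Matrix (Fin n) (Fin n) E := fun k => (fun y => hQ.matTernary y y y)^[k] x
  have h1 : ∀ k, ‖amplify (gnsMap E Q) n (X k)‖ = ‖amplify (gnsMap E Q) n x‖ ^ 3 ^ k := by
    intro k
    induction k with
    | zero => rw [pow_zero, pow_one]; rfl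
    | succ k ih =>
      have : X (k + 1) = hQ.matTernary (X k) (X k) (X k) :=
        Function.iterate_succ_apply' _ _ _
      rw [this, norm_gnsMap_matTernary he, ih, ← pow_mul, ← pow_succ]
  have h2 : ∀ k, ‖amplify (subIncl M E) n (X k)‖ = ‖amplify (subIncl M E) n x‖ ^ 3 ^ k := by
    intro k
    induction k with
    | zero => rw [pow_zero, pow_one]; rfl
    | succ k ih =>
      have : X (k + 1) = hQ.matTernary (X k) (X k) (X k) :=
        Function.iterate_succ_apply' _ _ _
      rw [this, hQ.norm_matTernary, ih, ← pow_mul, ← pow_succ]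
  refine le_antisymm
    (le_of_pow_three_pow_le (C := n * n) (norm_nonneg _) fun k => ?_)
    (le_of_pow_three_pow_le (C := n * n) (norm_nonneg _) fun k => ?_)
  · change ‖amplify (gnsMap E Q) n x‖ ^ 3 ^ k ≤ _ * ‖amplify (subIncl M E) n x‖ ^ 3 ^ k
    rw [← h1, ← h2]
    exact hι _
  · change ‖amplify (subIncl M E) n x‖ ^ 3 ^ k ≤ _ * ‖amplify (gnsMap E Q) n x‖ ^ 3 ^ k
    rw [← h1, ← h2]
    exact he' _

end Representation

/-! ### Weak* topologies and weak* closed images -/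

theorem induced_ultraweak_le {H G E : Type*} [NormedAddCommGroup H] [InnerProductSpace ℂ H]
    [NormedAddCommGroup G] [InnerProductSpace ℂ G] {e : E → H →L[ℂ] H} {ι : E → G →L[ℂ] G}
    (h : ∀ c, ∃ d, ∀ a, traceForm c (ι a) = traceForm d (e a)) :
    TopologicalSpace.induced e (ultraweak H H) ≤ TopologicalSpace.induced ι (ultraweak G G) := by
  rw [← continuous_iff_le_induced]
  let _ : TopologicalSpace E := TopologicalSpace.induced e (ultraweak H H)
  refine @continuous_iff_continuousAt _ _ _ (ultraweak G G) _ |>.2 fun a => ?_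
  refine tendsto_ultraweak_iff.2 fun c => ?_
  obtain ⟨d, hd⟩ := h c
  simp only [hd]
  exact tendsto_ultraweak_iff.1
    ((@continuous_iff_continuousAt _ _ _ (ultraweak H H) _).1 continuous_induced_dom a) d

section DualRepresentation

variable {H G E : Type*} [NormedAddCommGroup H] [InnerProductSpace ℂ H]
  [NormedAddCommGroup G] [InnerProductSpace ℂ G] [NormedAddCommGroup E] [NormedSpace ℂ E]
  {e : E →ₗᵢ[ℂ] (H →L[ℂ] H)} {ι : E →ₗᵢ[ℂ] (G →L[ℂ] G)}

theorem traceRestrict_vecForm_apply (ξ η : G) (a : E) :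
    traceRestrict ι (vecForm ξ η) a = inner ℂ η (ι a ξ) := by
  rw [traceRestrict_apply, traceForm_vecForm]

/-- The coefficient functional is continuous in each vector, linear in `ξ` and conjugate linear in
`η`, so membership in the closed subspace `P` passes to closed spans one vector at a time. -/
theorem traceRestrict_vecForm_mem_of_generators {P : Submodule ℂ (StrongDual ℂ E)}
    (hP : IsClosed (P : Set (StrongDual ℂ E))) {S T : Set G}
    (h : ∀ ξ ∈ S, ∀ η ∈ T, traceRestrict ι (vecForm ξ η) ∈ P) {ξ η : G}
    (hξ : ξ ∈ (Submodule.span ℂ S).topologicalClosure)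
    (hη : η ∈ (Submodule.span ℂ T).topologicalClosure) : traceRestrict ι (vecForm ξ η) ∈ P := by
  have h1 : ∀ ξ ∈ S, traceRestrict ι (vecForm ξ η) ∈ P := by
    intro ξ hξ
    let L : G →L⋆[ℂ] StrongDual ℂ E := ((ContinuousLinearMap.compL ℂ E G ℂ).flip
      (ι.toContinuousLinearMap.flip ξ)).comp (innerSL ℂ)
    have hL : ∀ η, L η = traceRestrict ι (vecForm ξ η) := fun η => by
      ext a
      rw [traceRestrict_vecForm_apply]
      rfl
    have h2 : (Submodule.span ℂ T).topologicalClosure ≤ P.comap L.toLinearMap :=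
      Submodule.topologicalClosure_minimal _ (Submodule.span_le.2 fun η hη => by
        change L η ∈ P
        rw [hL]
        exact h ξ hξ η hη) (hP.preimage L.continuous)
    have h3 : L η ∈ P := h2 hη
    rwa [hL] at h3
  let L : G →L[ℂ] StrongDual ℂ E :=
    (ContinuousLinearMap.compL ℂ E G ℂ (innerSL ℂ η)).comp ι.toContinuousLinearMap.flip
  have hL : ∀ ξ, L ξ = traceRestrict ι (vecForm ξ η) := fun ξ => by
    ext a
    rw [traceRestrict_vecForm_apply]
    rfl
  have h2 : (Submodule.span ℂ S).topologicalClosure ≤ P.comap L.toLinearMap :=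
    Submodule.topologicalClosure_minimal _ (Submodule.span_le.2 fun ξ hξ => by
      change L ξ ∈ P
      rw [hL]
      exact h1 ξ hξ) (hP.preimage L.continuous)
  have h3 : L ξ ∈ P := h2 hξ
  rwa [hL] at h3

theorem traceRestrict_mem_of_vecForm {P : Submodule ℂ (StrongDual ℂ E)}
    (hP : IsClosed (P : Set (StrongDual ℂ E)))
    (h : ∀ ξ η, traceRestrict ι (vecForm ξ η) ∈ P) (c : VecSum G) : traceRestrict ι c ∈ P := by
  classical
  have h1 := (traceRestrict ι).hasSum (lp.hasSum_single (by norm_num) c)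
  refine hP.mem_of_tendsto h1 (.of_forall fun s => P.sum_mem fun i _ => ?_)
  have h2 : traceRestrict ι (lp.single 1 i (c i)) =
      c i • traceRestrict ι (vecForm i.1.1 i.1.2) := by
    ext a
    rw [traceRestrict_apply, lp_single_vecPair]
    rfl
  rw [h2]
  exact P.smul_mem _ (h _ _)

/-- A point `y` of the closure annihilates the functionals vanishing on the range, so it defines a
functional on the predual of `E`, bounded because functionals lift without increase of norm. This
functional is evaluation at some `x`, and then `y = ι x`. -/
theorem isClosed_range_of_predual [CompleteSpace H]
    (he : IsClosed[ultraweak H H] (Set.range e)) (h1 : ∀ c, traceRestrict ι c ∈ predual e)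
    (h2 : ∀ f ∈ predual e, ∃ d, ‖d‖ ≤ ‖f‖ ∧ traceRestrict ι d = f) :
    IsClosed[ultraweak G G] (Set.range ι) := by
  let _ : TopologicalSpace (G →L[ℂ] G) := ultraweak G G
  refine isClosed_of_closure_subset fun y hy => ?_
  have hy0 : ∀ c : VecSum G, traceRestrict ι c = 0 → traceForm c y = 0 := by
    intro c hc
    have h3 : IsClosed {z : G →L[ℂ] G | traceForm c z = 0} :=
      isClosed_eq (continuous_traceForm c) continuous_const
    refine closure_minimal ?_ h3 hy
    rintro _ ⟨a, rfl⟩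
    exact congrArg (· a) hc
  choose d hd hdι using h2
  have hyd : ∀ (c : VecSum G) (f) (hf : f ∈ predual e), traceRestrict ι c = f →
      traceForm c y = traceForm (d f hf) y := by
    intro c f hf hcf
    refine sub_eq_zero.1 ?_
    rw [← sub_apply, ← map_sub]
    refine hy0 _ ?_
    rw [map_sub, hcf, hdι, sub_self]
  let Λ : predual e →ₗ[ℂ] ℂ :=
    { toFun := fun f => traceForm (d f.1 f.2) y
      map_add' := fun f g => by
        rw [← add_apply, ← map_add]
        exact (hyd _ _ _ (by rw [map_add, hdι, hdι]; rfl)).symm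
      map_smul' := fun r f => by
        rw [RingHom.id_apply, ← smul_apply, ← map_smul]
        exact (hyd _ _ _ (by rw [map_smul, hdι]; rfl)).symm }
  obtain ⟨x, hx, -⟩ := exists_eval_of_dual_predual e he Λ (norm_nonneg y) fun f => by
    refine (norm_traceForm_le _ _).trans ?_
    rw [mul_comm]
    gcongr
    exact hd f.1 f.2
  refine ⟨x, eq_of_traceForm_eq fun c => ?_⟩
  rw [hyd c _ (h1 c) rfl]
  exact (hx ⟨_, h1 c⟩).symm

end DualRepresentation

/-! ### The GNS representation as a weak* homeomorphism -/

section WStarRepresentation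

variable {H : Type*} [NormedAddCommGroup H] [InnerProductSpace ℂ H] [CompleteSpace H]
  {M : VonNeumannAlgebra H} {E : Submodule ℂ M.toStarSubalgebra}
  {Q : M.toStarSubalgebra →ₗ[ℂ] M.toStarSubalgebra}

/-- The isometry `gnsMap`. -/
noncomputable def gnsIso (he : IsClosed[ultraweak H H] (Set.range (subInclIso M E)))
    (hQ : IsCCProjection M E Q) : E →ₗᵢ[ℂ] (GNS E Q →L[ℂ] GNS E Q) :=
  ⟨gnsMap E Q, norm_gnsMap he hQ⟩

theorem traceRestrict_gnsIso_mem_iff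
    (he : IsClosed[ultraweak H H] (Set.range (subInclIso M E)))
    (hQ : IsCCProjection M E Q) (c : VecSum (GNS E Q)) :
    traceRestrict (gnsIso he hQ) c ∈ predual (subInclIso M E) ↔
      IsNormalFun E fun a => traceForm c (gnsMap E Q a) := mem_predual _

/-- For equal indices the coefficient is `F(ub*Q(ad*e))`: the weak* continuous functional `F(ub*·)`
composed with the product in its first variable. -/
theorem isNormalFun_gnsMap_gnsVec (he : IsClosed[ultraweak H H] (Set.range (subInclIso M E)))
    (hQ : IsCCProjection M E Q) (i j : NormalSupport E Q) (d e b : E) :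
    IsNormalFun E fun a => inner ℂ (gnsVec j (b : M.toStarSubalgebra))
      (gnsMap E Q a (gnsVec i (star (d : M.toStarSubalgebra) * e))) := by
  by_cases hij : j = i
  · subst hij
    obtain ⟨c, hc⟩ := (j.2.1.isNormalFun_left he hQ j.2.2 b.2).comp_ternary_right he hQ d e
    refine ⟨c, fun a => Eq.trans ?_ (hc a)⟩
    beta_reduce
    rw [gnsMap_gnsVec hQ j a d.2 e.2, inner_gnsVec, ← mul_assoc]
    rfl
  · refine ⟨0, fun a => ?_⟩
    beta_reduce
    rw [gnsMap_gnsVec hQ i a d.2 e.2, inner_gnsVec_of_ne hij, map_zero]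
    rfl

/-- The map `gnsMap` is weak* continuous. -/
theorem traceRestrict_gnsIso_mem (he : IsClosed[ultraweak H H] (Set.range (subInclIso M E)))
    (hQ : IsCCProjection M E Q) (c : VecSum (GNS E Q)) :
    traceRestrict (gnsIso he hQ) c ∈ predual (subInclIso M E) := by
  have hP := isClosed_predual (subInclIso M E) he
  have h0 : ∀ ξ ∈ gnsDom E Q, ∀ η ∈ gnsCod E Q,
      traceRestrict (gnsIso he hQ) (vecForm ξ η) ∈ predual (subInclIso M E) := by
    intro ξ hξ η hη
    refine traceRestrict_vecForm_mem_of_generators hP ?_ hξ hη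
    rintro _ ⟨i, d, e, rfl⟩ _ ⟨j, b, rfl⟩
    refine (traceRestrict_gnsIso_mem_iff he hQ _).2 ?_
    simp only [traceForm_vecForm]
    exact isNormalFun_gnsMap_gnsVec he hQ i j d e b
  refine traceRestrict_mem_of_vecForm hP (fun ξ η => ?_) c
  -- Arbitrary vectors may be replaced by their projections to `gnsDom` and `gnsCod`, since `gnsMap`
  -- is compressed to these subspaces.
  have h1 := (traceRestrict_gnsIso_mem_iff he hQ _).1
    (h0 _ (Submodule.starProjection_apply_mem _ ξ) _ (Submodule.starProjection_apply_mem _ η))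
  refine (traceRestrict_gnsIso_mem_iff he hQ _).2 ?_
  convert h1 using 2 with a
  rw [traceForm_vecForm, traceForm_vecForm, gnsMap_starProjection,
    Submodule.inner_starProjection_left_eq_right, Submodule.starProjection_eq_self_iff.2]
  exact Submodule.starProjection_apply_mem _ _

/-- If `φ = rF`, then `F` is a coefficient at two unit vectors and `r = φ(u)` with `‖u‖ ≤ 1`, so the
lift has norm at most `C`. -/
theorem exists_traceForm_gnsMap_eq (he : IsClosed[ultraweak H H] (Set.range (subInclIso M E)))
    (hQ : IsCCProjection M E Q) {φ : E → ℂ} (hφ : IsNormalFun E φ) {C : ℝ} (hC : 0 ≤ C)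
    (hφC : ∀ a, ‖φ a‖ ≤ C * ‖a‖) :
    ∃ d : VecSum (GNS E Q), ‖d‖ ≤ C ∧ ∀ a, traceForm d (gnsMap E Q a) = φ a := by
  rcases hφ.exists_isSupport he hQ with h0 | ⟨F, u, r, hFu, hF, hr⟩
  · refine ⟨0, ?_, fun a => ?_⟩
    · rwa [norm_zero]
    · rw [map_zero, h0]
      rfl
  let i : NormalSupport E Q := ⟨(F, u), hFu, hF⟩
  refine ⟨r • vecForm (gnsVec i (star u * u)) (gnsVec i u), ?_, fun a => ?_⟩
  · have h1 : ‖gnsVec i u‖ = 1 := norm_gnsVec_self i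
    have h2 : ‖gnsVec i (star u * u)‖ = 1 := norm_gnsVec_star_mul_self i
    have h3 := hr ⟨u, hFu.mem⟩
    rw [hFu.map_eq, mul_one] at h3
    rw [norm_smul, norm_vecForm, h1, h2, mul_one, mul_one, ← h3]
    exact (hφC _).trans (mul_le_of_le_one_right hC hFu.norm_le')
  · rw [map_smul, smul_apply, traceForm_vecForm, hr]
    exact congrArg (r * ·) (inner_gnsMap hQ i a)

theorem exists_traceRestrict_gnsIso_eq
    (he : IsClosed[ultraweak H H] (Set.range (subInclIso M E)))
    (hQ : IsCCProjection M E Q) (f : StrongDual ℂ E) (hf : f ∈ predual (subInclIso M E)) :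
    ∃ d, ‖d‖ ≤ ‖f‖ ∧ traceRestrict (gnsIso he hQ) d = f := by
  obtain ⟨d, hd, hdf⟩ := exists_traceForm_gnsMap_eq he hQ (mem_predual_iff_isNormalFun.1 hf)
    f.opNorm_nonneg f.le_opNorm
  exact ⟨d, hd, ContinuousLinearMap.ext hdf⟩

end WStarRepresentation

theorem IsWStarTROProduct.isTROProduct {H K E : Type u}
    [NormedAddCommGroup H] [InnerProductSpace ℂ H] [NormedAddCommGroup K] [InnerProductSpace ℂ K]
    [AddCommGroup E] [Module ℂ E] {e : E →ₗ[ℂ] (H →L[ℂ] K)} {m : E → E → E → E}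
    (h : IsWStarTROProduct.{u, v} e m) : IsTROProduct.{u, v} e m := by
  obtain ⟨H', i1, i2, i3, K', j1, j2, j3, ι, h1, h2, -, h3⟩ := h
  exact ⟨H', i1, i2, i3, K', j1, j2, j3, ι, h1, h2.toIsTRO, h3⟩

theorem IsClosed.of_ultraweak {H : Type*} [NormedAddCommGroup H] [InnerProductSpace ℂ H]
    {S : Set (H →L[ℂ] H)} (h : IsClosed[ultraweak H H] S) : IsClosed S := by
  refine isClosed_of_closure_subset fun x hx => ?_
  obtain ⟨l, hl, hlx⟩ := mem_closure_iff_ultrafilter.1 hx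
  have h1 := tendsto_ultraweak_of_norm (a := id) (l := (l : Filter (H →L[ℂ] H))) hlx
  have h2 : (l : Filter (H →L[ℂ] H)) ≤ @nhds _ (ultraweak H H) x := h1
  let _ := ultraweak H H
  exact isClosed_iff_ultrafilter.1 h x l h2 hl

/-- The range of a weak* closed completely contractive projection is a W*-TRO. -/
theorem IsCCProjection.isWStarTROProduct {H : Type u} [NormedAddCommGroup H]
    [InnerProductSpace ℂ H] [CompleteSpace H] {M : VonNeumannAlgebra H}
    {E : Submodule ℂ M.toStarSubalgebra} {Q : M.toStarSubalgebra →ₗ[ℂ] M.toStarSubalgebra}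
    (he : IsClosed[ultraweak H H] (Set.range (subInclIso M E))) (hQ : IsCCProjection M E Q) :
    IsWStarTROProduct.{u, u} (subIncl M E) hQ.ternary := by
  have hcl : IsClosed[ultraweak (GNS E Q) (GNS E Q)] (LinearMap.range (gnsMap E Q) : Set _) :=
    isClosed_range_of_predual he (traceRestrict_gnsIso_mem he hQ)
      (exists_traceRestrict_gnsIso_eq he hQ)
  refine ⟨GNS E Q, inferInstance, inferInstance, inferInstance, GNS E Q, inferInstance,
    inferInstance, inferInstance, gnsMap E Q, isCompletelyIsometric_gnsMap he hQ,
    ⟨⟨hcl.of_ultraweak, ?_⟩, hcl⟩, ?_, gnsMap_ternary he hQ⟩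
  · rintro _ ⟨a, rfl⟩ _ ⟨b, rfl⟩ _ ⟨c, rfl⟩
    exact ⟨hQ.ternary a b c, gnsMap_ternary he hQ a b c⟩
  · refine le_antisymm (induced_ultraweak_le fun c => ?_) (induced_ultraweak_le fun c => ?_)
    · exact (traceRestrict_gnsIso_mem_iff he hQ c).1 (traceRestrict_gnsIso_mem he hQ c)
    · obtain ⟨d, -, hd⟩ := exists_traceForm_gnsMap_eq he hQ
        (φ := fun a => traceForm c (subInclIso M E a)) ⟨c, fun a => rfl⟩ (norm_nonneg c)
        fun a => norm_traceForm_le c _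
      exact ⟨d, fun a => (hd a).symm⟩

/-! ### Cesàro means and their weak* limits -/

theorem tendsto_weakStar_iff_ultraweak {H K E : Type*} [NormedAddCommGroup H]
    [InnerProductSpace ℂ H] [NormedAddCommGroup K] [InnerProductSpace ℂ K] [AddCommGroup E]
    [Module ℂ E] {e : E →ₗ[ℂ] (H →L[ℂ] K)} {T : Type*} {l : Filter T} {z : T → E} {x : E} :
    Tendsto z l (@nhds _ (weakStar e) x) ↔
      Tendsto (fun t => e (z t)) l (@nhds _ (ultraweak H K) (e x)) := by
  rw [@nhds_induced _ _ (ultraweak H K), tendsto_comap_iff]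
  rfl

theorem tendsto_weakStar_iff {H E : Type*} [NormedAddCommGroup H]
    [InnerProductSpace ℂ H] [AddCommGroup E] [Module ℂ E] {e : E →ₗ[ℂ] (H →L[ℂ] H)}
    {T : Type*} {l : Filter T} {z : T → E} {x : E} :
    Tendsto z l (@nhds _ (weakStar e) x) ↔
      ∀ c, Tendsto (fun t => traceForm c (e (z t))) l (𝓝 (traceForm c (e x))) :=
  tendsto_weakStar_iff_ultraweak.trans tendsto_ultraweak_iff

theorem continuous_traceForm_weakStar {H E : Type*} [NormedAddCommGroup H]
    [InnerProductSpace ℂ H] [AddCommGroup E] [Module ℂ E] (e : E →ₗ[ℂ] (H →L[ℂ] H))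
    (c : VecSum H) : @Continuous _ _ (weakStar e) _ (fun x => traceForm c (e x)) := by
  let _ := weakStar e
  exact continuous_iff_continuousAt.2 fun x => tendsto_weakStar_iff.1 tendsto_id c

/-- Covers `m = 0`, where the Cesàro mean is 0 because `0⁻¹ = 0`. -/
theorem inv_natCast_mul_le {m : ℕ} {s r : ℝ} (hr : 0 ≤ r) (h : s ≤ m * r) :
    (m : ℝ)⁻¹ * s ≤ r := by
  rcases m.eq_zero_or_pos with rfl | hm
  · rwa [Nat.cast_zero, inv_zero, zero_mul]
  · exact (inv_mul_le_iff₀ (Nat.cast_pos.2 hm)).2 h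

section Cesaro

variable {H : Type*} [NormedAddCommGroup H] [InnerProductSpace ℂ H] [CompleteSpace H]
  {M : VonNeumannAlgebra H} {P : M.toStarSubalgebra →ₗ[ℂ] M.toStarSubalgebra}

variable (M) in
/-- Von Neumann algebras are weak* closed. -/
theorem isClosed_range_vnIncl : IsClosed[ultraweak H H] (Set.range (vnIncl M)) := by
  -- `M` is the commutant of its commutant, and commutation with `y` is a family of equations
  -- between vector functionals.
  have h1 : Set.range (vnIncl M) = ⋂ (y : M.commutant) (ξ : H) (η : H),
      {x : H →L[ℂ] H | traceForm (vecForm ((y : H →L[ℂ] H) ξ) η) x =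
        traceForm (vecForm ξ (ContinuousLinearMap.adjoint (y : H →L[ℂ] H) η)) x} := by
    ext x
    simp only [Set.mem_iInter, Set.mem_ofPred_eq, traceForm_vecForm,
      ContinuousLinearMap.adjoint_inner_left]
    constructor
    · rintro ⟨x, rfl⟩ ⟨y, hy⟩ ξ η
      have := VonNeumannAlgebra.mem_commutant_iff.1 hy x x.2
      exact congrArg (fun T : H →L[ℂ] H => inner ℂ η (T ξ)) this
    · intro h
      have hx : x ∈ M.commutant.commutant := by
        refine VonNeumannAlgebra.mem_commutant_iff.2 fun y hy => ?_
        ext ξ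
        exact ext_inner_left ℂ fun η => (h ⟨y, hy⟩ ξ η).symm
      rw [VonNeumannAlgebra.commutant_commutant] at hx
      exact ⟨⟨x, hx⟩, rfl⟩
  rw [h1]
  let _ := ultraweak H H
  exact isClosed_iInter fun y => isClosed_iInter fun ξ => isClosed_iInter fun η =>
    isClosed_eq (continuous_traceForm _) (continuous_traceForm _)

theorem mem_fixSpace {x : M.toStarSubalgebra} : x ∈ fixSpace M P ↔ P x = x := Iff.rfl

theorem isClosed_fixSpace (hPn : IsNormalMap M P) :
    IsClosed[weakStar (vnIncl M)] (fixSpace M P : Set M.toStarSubalgebra) := by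
  have h1 : (fixSpace M P : Set M.toStarSubalgebra) =
      ⋂ c, {x | traceForm c (vnIncl M (P x)) = traceForm c (vnIncl M x)} := by
    ext x
    simp only [Set.mem_iInter, Set.mem_ofPred_eq]
    constructor
    · intro hx c
      rw [mem_fixSpace.1 hx]
    · intro h
      exact vnIncl_injective (eq_of_traceForm_eq h)
  rw [h1]
  let _ := weakStar (vnIncl M)
  exact isClosed_iInter fun c => isClosed_eq
    ((continuous_traceForm_weakStar (vnIncl M) c).comp hPn) (continuous_traceForm_weakStar _ c)

theorem isClosed_range_fixIncl (hPn : IsNormalMap M P) :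
    IsClosed[ultraweak H H] (Set.range (fixIncl M P)) := by
  obtain ⟨C, hC, hCF⟩ := (@isClosed_induced_iff _ _ (ultraweak H H) _ _).1 (isClosed_fixSpace hPn)
  have h1 : Set.range (fixIncl M P) = C ∩ Set.range (vnIncl M) := by
    ext x
    constructor
    · rintro ⟨a, rfl⟩
      refine ⟨?_, (a : M.toStarSubalgebra), rfl⟩
      have : (a : M.toStarSubalgebra) ∈ vnIncl M ⁻¹' C := hCF ▸ a.2
      exact this
    · rintro ⟨hx, a, rfl⟩
      have : a ∈ (fixSpace M P : Set M.toStarSubalgebra) := hCF ▸ hx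
      exact ⟨⟨a, this⟩, rfl⟩
  rw [h1]
  exact @IsClosed.inter _ _ _ (ultraweak H H) hC (isClosed_range_vnIncl M)

theorem ampNorm_pow_le (hP : IsCompletelyContractive (vnIncl M) (vnIncl M) P) (k n : ℕ)
    (x : Matrix (Fin n) (Fin n) M.toStarSubalgebra) :
    ampNorm (vnIncl M) n (x.map ⇑(P ^ k)) ≤ ampNorm (vnIncl M) n x := by
  induction k with
  | zero =>
    have h1 : x.map ⇑(P ^ 0) = x := by
      ext1 i j
      rw [Matrix.map_apply, pow_zero, Module.End.one_apply]
    rw [h1]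
  | succ k ih =>
    have h1 : x.map ⇑(P ^ (k + 1)) = (x.map ⇑(P ^ k)).map P := by
      ext1 i j
      rw [Matrix.map_apply, Matrix.map_apply, Matrix.map_apply, pow_succ', Module.End.mul_apply]
    rw [h1]
    exact (amplify_map_le hP _).trans ih

theorem ampNorm_cesaro_le (hP : IsCompletelyContractive (vnIncl M) (vnIncl M) P) (m n : ℕ)
    (x : Matrix (Fin n) (Fin n) M.toStarSubalgebra) :
    ampNorm (vnIncl M) n (x.map (cesaro M P m)) ≤ ampNorm (vnIncl M) n x := by
  have h1 : x.map (cesaro M P m) = (m : ℂ)⁻¹ • ∑ k ∈ Finset.range m, x.map ⇑(P ^ k) := by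
    ext1 i j
    rw [Matrix.smul_apply, Matrix.sum_apply]
    rfl
  rw [h1, map_smul_eq_mul, norm_inv, Complex.norm_natCast]
  have h2 : ampNorm (vnIncl M) n (∑ k ∈ Finset.range m, x.map ⇑(P ^ k)) ≤
      m * ampNorm (vnIncl M) n x := by
    refine (Finset.le_sum_of_subadditive _ (map_zero _).le
      (map_add_le_add _) _ _).trans
      ((Finset.sum_le_sum fun k _ => ampNorm_pow_le hP k n x).trans_eq ?_)
    rw [Finset.sum_const, Finset.card_range, nsmul_eq_mul]
  exact inv_natCast_mul_le (apply_nonneg _ _) h2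

theorem norm_pow_apply_le (hP : IsCompletelyContractive (vnIncl M) (vnIncl M) P) (k : ℕ)
    (x : M.toStarSubalgebra) : ‖(P ^ k) x‖ ≤ ‖x‖ := by
  induction k with
  | zero => exact le_of_eq rfl
  | succ k ih =>
    rw [pow_succ', Module.End.mul_apply]
    exact (norm_map_le_of_cc hP _).trans ih

theorem norm_cesaro_le (hP : IsCompletelyContractive (vnIncl M) (vnIncl M) P) (m : ℕ)
    (x : M.toStarSubalgebra) : ‖cesaro M P m x‖ ≤ ‖x‖ := by
  rw [cesaro, norm_smul, norm_inv, Complex.norm_natCast]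
  have h2 : ‖∑ k ∈ Finset.range m, (P ^ k) x‖ ≤ m * ‖x‖ := by
    refine (norm_sum_le _ _).trans
      ((Finset.sum_le_sum fun k _ => norm_pow_apply_le hP k x).trans_eq ?_)
    rw [Finset.sum_const, Finset.card_range, nsmul_eq_mul]
  exact inv_natCast_mul_le (norm_nonneg x) h2

theorem cesaro_add (m : ℕ) (x y : M.toStarSubalgebra) :
    cesaro M P m (x + y) = cesaro M P m x + cesaro M P m y := by
  simp only [cesaro, map_add, Finset.sum_add_distrib, smul_add]

theorem cesaro_smul (m : ℕ) (c : ℂ) (x : M.toStarSubalgebra) :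
    cesaro M P m (c • x) = c • cesaro M P m x := by
  simp only [cesaro, map_smul, ← Finset.smul_sum, smul_comm c]

/-- The sum telescopes, so the means are invariant under `P` up to an error of norm `O(1/m)`. -/
theorem map_cesaro (m : ℕ) (x : M.toStarSubalgebra) :
    P (cesaro M P m x) = cesaro M P m x + (m : ℂ)⁻¹ • ((P ^ m) x - x) := by
  rw [cesaro, map_smul, map_sum, ← smul_add]
  congr 1
  have h1 : ∀ k, P ((P ^ k) x) = (P ^ (k + 1)) x := fun k => by
    rw [pow_succ', Module.End.mul_apply]
  simp only [h1]
  have h2 := Finset.sum_range_succ (fun k => (P ^ k) x) m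
  rw [Finset.sum_range_succ', pow_zero, Module.End.one_apply] at h2
  rw [add_sub, ← h2, add_sub_cancel_right]

theorem cesaro_of_mem {m : ℕ} (hm : m ≠ 0) {x : M.toStarSubalgebra} (hx : x ∈ fixSpace M P) :
    cesaro M P m x = x := by
  have h1 : ∀ k, (P ^ k) x = x := by
    intro k
    induction k with
    | zero => rfl
    | succ k ih => rw [pow_succ', Module.End.mul_apply, ih, mem_fixSpace.1 hx]
  simp only [cesaro, h1, Finset.sum_const, Finset.card_range]
  rw [← Nat.cast_smul_eq_nsmul ℂ, inv_smul_smul₀ (by exact_mod_cast hm)]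

theorem exists_isCesaroLimit (hP : IsCompletelyContractive (vnIncl M) (vnIncl M) P)
    (β : Ultrafilter ℕ) : ∃ Q, IsCesaroLimit M P β Q := by
  have h : ∀ x, ∃ y, Tendsto (fun n => cesaro M P n x) β (@nhds _ (weakStar (vnIncl M)) y) := by
    intro x
    obtain ⟨y, hy⟩ := exists_tendsto_ultraweak
      (⟨vnIncl M, fun _ => rfl⟩ : M.toStarSubalgebra →ₗᵢ[ℂ] (H →L[ℂ] H)) (isClosed_range_vnIncl M) β
      (fun n => norm_cesaro_le hP n x)
    exact ⟨y, tendsto_weakStar_iff_ultraweak.2 hy⟩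
  choose Q hQ using h
  exact ⟨Q, hQ⟩

theorem tendsto_weakStar_unique {T : Type*} {l : Filter T} [NeBot l] {z : T → M.toStarSubalgebra}
    {x y : M.toStarSubalgebra} (hx : Tendsto z l (@nhds _ (weakStar (vnIncl M)) x))
    (hy : Tendsto z l (@nhds _ (weakStar (vnIncl M)) y)) : x = y :=
  vnIncl_injective (tendsto_ultraweak_unique (tendsto_weakStar_iff_ultraweak.1 hx)
    (tendsto_weakStar_iff_ultraweak.1 hy))

/-- The Cesàro limit along a free ultrafilter is a completely contractive projection onto the
fixed points. -/
theorem IsCesaroLimit.exists_isCCProjection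
    (hP : IsCompletelyContractive (vnIncl M) (vnIncl M) P) (hPn : IsNormalMap M P)
    {β : Ultrafilter ℕ} (hβ : (β : Filter ℕ) ≤ cofinite)
    {Q : M.toStarSubalgebra → M.toStarSubalgebra} (hQ : IsCesaroLimit M P β Q) :
    ∃ Q' : M.toStarSubalgebra →ₗ[ℂ] M.toStarSubalgebra,
      IsCCProjection M (fixSpace M P) Q' ∧ ∀ x, Q' x = Q x := by
  rw [Nat.cofinite_eq_atTop] at hβ
  have hQc : ∀ x c, Tendsto (fun n => traceForm c (vnIncl M (cesaro M P n x))) β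
      (𝓝 (traceForm c (vnIncl M (Q x)))) := fun x => tendsto_weakStar_iff.1 (hQ x)
  let Q' : M.toStarSubalgebra →ₗ[ℂ] M.toStarSubalgebra :=
    { toFun := Q
      map_add' := fun x y => by
        refine tendsto_weakStar_unique (hQ (x + y)) (tendsto_weakStar_iff.2 fun c => ?_)
        simp only [cesaro_add, map_add]
        exact (hQc x c).add (hQc y c)
      map_smul' := fun r x => by
        refine tendsto_weakStar_unique (hQ (r • x)) (tendsto_weakStar_iff.2 fun c => ?_)
        simp only [cesaro_smul, map_smul, RingHom.id_apply]
        exact (hQc x c).const_smul r }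
  refine ⟨Q', ⟨fun n x => ?_, fun x => ?_, fun x hx => ?_⟩, fun x => rfl⟩
  · refine norm_matrixOp_le_of_tendsto (l := (β : Filter ℕ))
      (x := fun m => x.map fun y => vnIncl M (cesaro M P m y))
      (.of_forall fun m => ampNorm_cesaro_le hP m n x) fun i j ξ η => ?_
    have h1 := hQc (x i j) (vecForm ξ η)
    simp only [traceForm_vecForm] at h1
    exact h1
  -- Normality lets `P` pass to the limit, and the error of at most `2‖x‖/m` in norm vanishes along
  -- `β` because `β` is free.
  · let _ := weakStar (vnIncl M)
    have h1 : Tendsto (fun n => P (cesaro M P n x)) β (𝓝 (P (Q x))) :=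
      ((@Continuous.tendsto _ _ (weakStar (vnIncl M)) (weakStar (vnIncl M)) _ hPn (Q x))).comp
        (hQ x)
    refine mem_fixSpace.2 (tendsto_weakStar_unique h1 (tendsto_weakStar_iff.2 fun c => ?_))
    simp only [map_cesaro, map_add]
    have h2 : Tendsto (fun m : ℕ => traceForm c (vnIncl M ((m : ℂ)⁻¹ • ((P ^ m) x - x)))) β
        (𝓝 0) := by
      refine Tendsto.mono_left ?_ hβ
      refine squeeze_zero_norm (a := fun m : ℕ => (m : ℝ)⁻¹ * (‖c‖ * (‖x‖ + ‖x‖))) (fun m => ?_) ?_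
      · rw [map_smul, map_smul, norm_smul, norm_inv, Complex.norm_natCast]
        refine mul_le_mul_of_nonneg_left ((norm_traceForm_le c _).trans ?_) (by positivity)
        refine mul_le_mul_of_nonneg_left ?_ (norm_nonneg c)
        exact (norm_sub_le _ x).trans (add_le_add_left (norm_pow_apply_le hP m x) _)
      · simpa using (tendsto_inv_atTop_nhds_zero_nat (𝕜 := ℝ)).mul_const (‖c‖ * (‖x‖ + ‖x‖))
    have h3 := (hQc x c).add h2
    rw [add_zero] at h3
    exact h3
  · refine tendsto_weakStar_unique (hQ x) (tendsto_weakStar_iff.2 fun c => ?_)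
    -- The mean for `m = 0` is 0 rather than `x`; a free ultrafilter ignores this index.
    refine tendsto_const_nhds.congr' (hβ ((eventually_ne_atTop 0).mono fun m hm => ?_))
    beta_reduce
    rw [cesaro_of_mem hm hx]

end Cesaro

theorem mainTheorem2 {H : Type u} [NormedAddCommGroup H] [InnerProductSpace ℂ H] [CompleteSpace H]
    (M : VonNeumannAlgebra H) (P : M.toStarSubalgebra →ₗ[ℂ] M.toStarSubalgebra)
    (hP : IsCompletelyContractive (vnIncl M) (vnIncl M) P) (hPn : IsNormalMap M P) :
    IsClosed[weakStar (vnIncl M)] (fixSpace M P : Set M.toStarSubalgebra) ∧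
    IsClosed[ultraweak H H] (LinearMap.range (fixIncl M P) : Set (H →L[ℂ] H)) ∧
    ∃ m : fixSpace M P → fixSpace M P → fixSpace M P → fixSpace M P,
      IsWStarTROProduct.{u, u} (fixIncl M P) m ∧
      (∀ m', IsTROProduct.{u, v} (fixIncl M P) m' → m' = m) ∧
      ∀ β : Ultrafilter ℕ, (β : Filter ℕ) ≤ cofinite →
        ∃ Q : M.toStarSubalgebra → M.toStarSubalgebra, IsCesaroLimit M P β Q ∧
          ∀ a b c : fixSpace M P,
            (m a b c : M.toStarSubalgebra) =
              Q ((a : M.toStarSubalgebra) * star (b : M.toStarSubalgebra) *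
                (c : M.toStarSubalgebra)) := by
  have he := isClosed_range_fixIncl hPn
  have hinj : Function.Injective (fixIncl M P) :=
    vnIncl_injective.comp Subtype.val_injective
  -- One free ultrafilter supplies the product `m`. For any other `β` the limit gives a W*-TRO
  -- product as well, and uniqueness identifies it with `m`.
  obtain ⟨Q₀, hQ₀⟩ := exists_isCesaroLimit hP (hyperfilter ℕ)
  obtain ⟨Q, hQ, -⟩ := hQ₀.exists_isCCProjection hP hPn hyperfilter_le_cofinite
  have hm : IsWStarTROProduct.{u, u} (fixIncl M P) hQ.ternary := hQ.isWStarTROProduct he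
  refine ⟨isClosed_fixSpace hPn, he, hQ.ternary, hm,
    fun m' hm' => isTROProduct_unique hinj hm.isTROProduct hm', fun β hβ => ?_⟩
  obtain ⟨Q₁, hQ₁⟩ := exists_isCesaroLimit hP β
  obtain ⟨Q', hQ', hQQ⟩ := hQ₁.exists_isCCProjection hP hPn hβ
  have hm' : IsWStarTROProduct.{u, u} (fixIncl M P) hQ'.ternary := hQ'.isWStarTROProduct he
  refine ⟨Q₁, hQ₁, fun a b c => ?_⟩
  rw [← isTROProduct_unique hinj hm.isTROProduct hm'.isTROProduct]
  exact hQQ _
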